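/- Let $N\ge 2$, let $F_N$ be the free group of rank $N$, and let $\Gamma$ be a finite connected graph all of whose vertices have degree $\ge 3$, with first Betti number $N$ and with a fixed isomorphism $F_N\cong\pi_1(\Gamma,x_0)$. Every edge has length $1$, $E\Gamma$ is the set of oriented edges, $e^{-1}$ is $e$ with the opposite orientation, $o(e)$ and $t(e)$ are the initial and terminal vertices of $e$, $\Omega_k(\Gamma)$ is the set of reduced edge-paths of length $k$, and $T_0=\widetilde\Gamma$ is the universal cover, on which $F_N$ acts by covering transformations; $\partial F_N$ is identified with $\partial T_0$. A geodesic current is a positive Borel measure $\nu$ on $\partial^2F_N=\{(x,y)\in\partial F_N\times\partial F_N : x\ne y\}$ that is finite on compact sets and invariant under $F_N$ and under $(x,y)\mapsto(y,x)$; the space of currents carries the weak-* topology. For $v\in\Omega_k(\Gamma)$ the weight $\langle v,\nu\rangle_\Gamma$ is the $\nu$-measure of the set of $(x,y)$ for which the geodesic in $T_0$ from $x$ to $y$ runs through a given lift of $v$ (in the direction of $v$). The number $\langle T_0,\nu\rangle$ is the geometric intersection number: $\langle T_0,\cdot\rangle$ is the continuous $\mathbb R_{\ge0}$-valued $\mathbb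 R_{\ge0}$-linear function on currents that takes the value $\|g\|_{T_0}$ (the translation length of $g$ on $T_0$) at the counting current $\eta_g=\sum_{h\in F_N/\langle g\rangle}\bigl(\delta_{h(g^{-\infty},g^{\infty})}+\delta_{h(g^{\infty},g^{-\infty})}\bigr)$ of every $1\ne g\in F_N$. Let $\mathcal X$ be an irreducible finite-state Markov chain with state set $S\subseteq E\Gamma$, $\#S\ge2$, and transition probabilities $p(e,e')$ such that $p(e,e')>0$ implies $t(e)=o(e')$ and $e'\ne e^{-1}$. Let $\mu_0$ be its unique stationary probability distribution. For $k\ge1$ and $v=e_1\cdots e_k\in\Omega_k(\Gamma)$ put $$\mu_0[k](v)=\mu_0(e_1)\,p(e_1,e_2)\cdots p(e_{k-1},e_k)$$ if all $e_i$ lie in $S$, and $\mu_0[k](v)=0$ otherwise (on feasible words this is the stationary distribution of the $k$-iterated chain). Then there exists a unique geodesic current $\nu=\nu_{\mathcal X}$ on $F_N$ such that: 1. for every $k\ge1$ and every $v\in\Omega_k(\Gamma)$, $\langle v,\nu\rangle_\Gamma=\mu_0[k](v)+\mu_0[k](v^{-1})$; 2. $\langle T_0,\nu\rangle=1$. -/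

import Mathlib

open scoped NNReal ENNReal

/-- A graph as a one-dimensional cell complex, given by its vertices `V` and its oriented edges
`E`: every oriented edge has an initial vertex `o e`, and `inv` sends an oriented edge to the same
topological edge with the opposite orientation. Loops and multiple edges are allowed. -/
structure OrGraph (V : Type*) (E : Type*) where
  o : E → V
  inv : E → E
  inv_inv : ∀ e, inv (inv e) = e
  inv_ne : ∀ e, inv e ≠ e

namespace OrGraph

section Basic

variable {V E : Type*} (Γ : OrGraph V E)

/-- The terminal vertex of an oriented edge. -/
def t (e : E) : V := Γ.o (Γ.inv e)

/-- `Γ.IsPath x l y`: the list of edges `l` is an edge-path from `x` to `y`. -/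
def IsPath : V → List E → V → Prop
  | x, [], y => x = y
  | x, e :: l, y => Γ.o e = x ∧ IsPath (Γ.t e) l y

/-- An edge-path is reduced if it has no subpath `e, e⁻¹`. -/
def IsReduced (l : List E) : Prop := l.IsChain (fun e f => f ≠ Γ.inv e)

/-- The inverse path. -/
def invPath (l : List E) : List E := (l.map Γ.inv).reverse

/-- `Ω_k(Γ)`: the reduced edge-paths of length `k`. -/
def Omega (k : ℕ) : Set (List E) :=
  {l | l.length = k ∧ Γ.IsReduced l ∧ ∃ x y, Γ.IsPath x l y}

def Connected : Prop := ∀ x y, ∃ l, Γ.IsPath x l y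

/-- The combinatorial distance (every edge has length `1`). -/
noncomputable def pathDist (x y : V) : ℕ := sInf {n | ∃ l, Γ.IsPath x l y ∧ l.length = n}

/-- Reduced semi-infinite edge-paths. -/
@[ext]
structure Ray where
  edge : ℕ → E
  isReduced : ∀ n, Γ.t (edge n) = Γ.o (edge (n + 1)) ∧ edge (n + 1) ≠ Γ.inv (edge n)

/-- Reduced bi-infinite edge-paths. -/
@[ext]
structure Line where
  edge : ℤ → E
  isReduced : ∀ n, Γ.t (edge n) = Γ.o (edge (n + 1)) ∧ edge (n + 1) ≠ Γ.inv (edge n)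

/-- Two rays are equivalent if they have a common tail. -/
def raySetoid : Setoid Γ.Ray where
  r r s := ∃ m n, ∀ k, r.edge (m + k) = s.edge (n + k)
  iseqv :=
    { refl := fun _ => ⟨0, 0, fun _ => rfl⟩
      symm := fun ⟨m, n, h⟩ => ⟨n, m, fun k => (h k).symm⟩
      trans := by
        rintro r s u ⟨m, n, h⟩ ⟨p, q, h2⟩
        refine ⟨m + p, q + n, fun k => ?_⟩
        rw [add_assoc, h, add_assoc, ← h2, add_left_comm] }

/-- The boundary of a graph that is a tree: reduced rays up to having a common tail. -/
def Boundary : Type _ := Quotient Γ.raySetoid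

variable {Γ}

/-- The end of a ray. -/
def Ray.toEnd (r : Γ.Ray) : Γ.Boundary := Quotient.mk Γ.raySetoid r

/-- The forward half of a bi-infinite path. -/
def Line.forward (c : Γ.Line) : Γ.Ray :=
  ⟨fun n => c.edge n, fun n => by simpa using c.isReduced n⟩

/-- The backward half of a bi-infinite path, traversed backwards. -/
def Line.backward (c : Γ.Line) : Γ.Ray :=
  ⟨fun n => Γ.inv (c.edge (-1 - (n : ℤ))), fun n => by
    have h := c.isReduced (-1 - ((n + 1 : ℕ) : ℤ))
    have e : -1 - ((n + 1 : ℕ) : ℤ) + 1 = -1 - (n : ℤ) := by push_cast; ring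
    rw [e] at h
    refine ⟨?_, fun h2 => h.2 ?_⟩
    · change Γ.o (Γ.inv (Γ.inv _)) = Γ.t _
      rw [Γ.inv_inv, h.1]
    · have h3 := congrArg Γ.inv h2
      simp only [Γ.inv_inv] at h3
      rw [h3, Γ.inv_inv]⟩

variable (Γ)

/-- The ends that are reached through the oriented edge `e`. -/
def shadow (e : E) : Set Γ.Boundary := {x | ∃ r : Γ.Ray, r.edge 0 = e ∧ r.toEnd = x}

/-- The topology of the boundary of a locally finite tree, generated by the shadows of edges. -/
instance : TopologicalSpace Γ.Boundary :=
  TopologicalSpace.generateFrom (Set.range Γ.shadow)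

/-- `∂²`: ordered pairs of distinct boundary points, with the subspace topology. -/
abbrev Boundary2 : Type _ := {P : Γ.Boundary × Γ.Boundary // P.1 ≠ P.2}

instance : MeasurableSpace Γ.Boundary2 := borel _

instance : BorelSpace Γ.Boundary2 := ⟨rfl⟩

variable {Γ} in
/-- The flip `(x, y) ↦ (y, x)`. -/
def flip (P : Γ.Boundary2) : Γ.Boundary2 := ⟨P.1.swap, P.2.symm⟩

/-- The cylinder of a path `l` in a tree: the pairs `(x, y)` such that the bi-infinite geodesic
from `x` to `y` runs through `l`, in the direction of `l`. -/
def cyl (l : List E) : Set Γ.Boundary2 :=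
  {P | ∃ c : Γ.Line, c.backward.toEnd = P.1.1 ∧ c.forward.toEnd = P.1.2 ∧
    ∃ i : ℤ, ∀ (j : ℕ) (h : j < l.length), c.edge (i + j) = l[j]}

/-- The vertices of a tree that are reached through the oriented edge `e`. -/
def halfTree (e : E) : Set V :=
  {y | ∃ l, Γ.IsReduced (e :: l) ∧ Γ.IsPath (Γ.o e) (e :: l) y}

/-- Convergence of a sequence of vertices of a tree to a boundary point. -/
def ConvergesTo (u : ℕ → V) (x : Γ.Boundary) : Prop :=
  ∀ e, x ∈ Γ.shadow e → ∀ᶠ n in Filter.atTop, u n ∈ Γ.halfTree e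

/-- The group generated by the oriented edges, subject to the relations that `e` and `Γ.inv e` are
inverse to each other. Two edge-paths with the same initial vertex are homotopic relative to their
endpoints if and only if they represent the same element of it. -/
abbrev EdgeGroup : Type _ :=
  PresentedGroup (Set.range fun e => FreeGroup.of e * FreeGroup.of (Γ.inv e))

/-- The class of an edge in the edge group. -/
def gen (e : E) : Γ.EdgeGroup := PresentedGroup.of e

/-- The class of a path in the edge group. -/
def word (l : List E) : Γ.EdgeGroup := (l.map Γ.gen).prod

lemma gen_mul_gen_inv (e : E) : Γ.gen e * Γ.gen (Γ.inv e) = 1 := by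
  have h := PresentedGroup.one_of_mem (rels := Set.range fun e =>
    FreeGroup.of e * FreeGroup.of (Γ.inv e)) ⟨e, rfl⟩
  rw [map_mul] at h
  exact h

lemma word_append (l m : List E) : Γ.word (l ++ m) = Γ.word l * Γ.word m := by
  simp [word]

lemma word_singleton (e : E) : Γ.word [e] = Γ.gen e := by
  simp [word]

lemma isPath_append {x y z : V} {l m : List E} (h : Γ.IsPath x l y) (h2 : Γ.IsPath y m z) :
    Γ.IsPath x (l ++ m) z := by
  induction l generalizing x with
  | nil => cases h; exact h2
  | cons e l ih => exact ⟨h.1, ih h.2⟩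

lemma isPath_singleton (e : E) : Γ.IsPath (Γ.o e) [e] (Γ.t e) := ⟨rfl, rfl⟩

lemma t_inv (e : E) : Γ.t (Γ.inv e) = Γ.o e := congrArg Γ.o (Γ.inv_inv e)

lemma isPath_invPath {x y : V} {l : List E} (h : Γ.IsPath x l y) :
    Γ.IsPath y (Γ.invPath l) x := by
  induction l generalizing x with
  | nil => cases h; exact rfl
  | cons e l ih =>
    have h1 := Γ.isPath_append (ih h.2) (Γ.isPath_singleton (Γ.inv e))
    rw [t_inv, h.1] at h1
    simpa [invPath] using h1

lemma word_invPath (l : List E) : Γ.word (Γ.invPath l) = (Γ.word l)⁻¹ := by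
  induction l with
  | nil => simp [word, invPath]
  | cons e l ih =>
    have h1 : Γ.invPath (e :: l) = Γ.invPath l ++ [Γ.inv e] := by simp [invPath]
    have h2 : Γ.word (e :: l) = Γ.gen e * Γ.word l := by simp [word]
    rw [h1, h2, word_append, ih, word_singleton, mul_inv_rev,
      eq_inv_of_mul_eq_one_right (Γ.gen_mul_gen_inv e)]

/-- The fundamental group `π₁(Γ, x₀)`: homotopy classes of closed edge-paths at `x₀`, multiplied by
concatenation. -/
def pi1 (x₀ : V) : Subgroup Γ.EdgeGroup where
  carrier := {w | ∃ l, Γ.IsPath x₀ l x₀ ∧ Γ.word l = w}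
  mul_mem' := by
    rintro _ _ ⟨l, hl, rfl⟩ ⟨m, hm, rfl⟩
    exact ⟨l ++ m, Γ.isPath_append hl hm, Γ.word_append l m⟩
  one_mem' := ⟨[], rfl, by simp [word]⟩
  inv_mem' := by
    rintro _ ⟨l, hl, rfl⟩
    exact ⟨Γ.invPath l, Γ.isPath_invPath hl, Γ.word_invPath l⟩

variable {x₀ : V}

variable (x₀) in
/-- The vertices of the universal cover: homotopy classes of edge-paths that start at `x₀`,
together with their terminal vertices. -/
@[ext]
structure CoverVertex where
  cls : Γ.EdgeGroup
  term : V
  exists_path : ∃ l, Γ.IsPath x₀ l term ∧ Γ.word l = cls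

variable (x₀) in
/-- The oriented edges of the universal cover: for every vertex over `y` one lift of every edge
of `Γ` that starts at `y`. -/
@[ext]
structure CoverEdge where
  start : Γ.CoverVertex x₀
  proj : E
  o_proj : Γ.o proj = start.term

variable {Γ}

/-- The terminal vertex of an edge of the universal cover. -/
def CoverEdge.finish (q : Γ.CoverEdge x₀) : Γ.CoverVertex x₀ where
  cls := q.start.cls * Γ.gen q.proj
  term := Γ.t q.proj
  exists_path := by
    obtain ⟨l, hl, hw⟩ := q.start.exists_path
    refine ⟨l ++ [q.proj], Γ.isPath_append hl ⟨q.o_proj, rfl⟩, ?_⟩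
    rw [word_append, word_singleton, hw]

variable (Γ) (x₀) in
/-- The universal cover `T₀` of `Γ`. -/
def cover : OrGraph (Γ.CoverVertex x₀) (Γ.CoverEdge x₀) where
  o q := q.start
  inv q := ⟨q.finish, Γ.inv q.proj, rfl⟩
  inv_inv q := by
    refine CoverEdge.ext (CoverVertex.ext ?_ ?_) (Γ.inv_inv q.proj)
    · change q.start.cls * Γ.gen q.proj * Γ.gen (Γ.inv q.proj) = q.start.cls
      rw [mul_assoc, gen_mul_gen_inv, mul_one]
    · change Γ.t (Γ.inv q.proj) = q.start.term
      rw [t_inv, q.o_proj]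
  inv_ne q h := Γ.inv_ne q.proj (congrArg CoverEdge.proj h)

variable (Γ) (x₀) in
/-- The base vertex of the universal cover. -/
def coverBase : Γ.CoverVertex x₀ where
  cls := 1
  term := x₀
  exists_path := ⟨[], rfl, by simp [word]⟩

variable (Γ) in
/-- `l` is an edge-path of the universal cover that projects to the path `v`. -/
def IsLift (l : List (Γ.CoverEdge x₀)) (v : List E) : Prop :=
  (∃ p q, (Γ.cover x₀).IsPath p l q) ∧ l.map CoverEdge.proj = v

/-! The action of the fundamental group by covering transformations. -/

instance : MulAction (Γ.pi1 x₀) (Γ.CoverVertex x₀) where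
  smul g p :=
    { cls := g.1 * p.cls
      term := p.term
      exists_path := by
        obtain ⟨l, hl, hw⟩ := p.exists_path
        obtain ⟨m, hm, hg⟩ := g.2
        exact ⟨m ++ l, Γ.isPath_append hm hl, by rw [word_append, hw, hg]⟩ }
  one_smul _ := CoverVertex.ext (one_mul _) rfl
  mul_smul _ _ _ := CoverVertex.ext (mul_assoc _ _ _) rfl

instance : MulAction (Γ.pi1 x₀) (Γ.CoverEdge x₀) where
  smul g q := ⟨g • q.start, q.proj, q.o_proj⟩
  one_smul _ := CoverEdge.ext (one_smul _ _) rfl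
  mul_smul _ _ _ := CoverEdge.ext (mul_smul _ _ _) rfl

lemma cover_o_smul (g : Γ.pi1 x₀) (q : Γ.CoverEdge x₀) :
    (Γ.cover x₀).o (g • q) = g • (Γ.cover x₀).o q := rfl

lemma cover_inv_smul (g : Γ.pi1 x₀) (q : Γ.CoverEdge x₀) :
    (Γ.cover x₀).inv (g • q) = g • (Γ.cover x₀).inv q :=
  CoverEdge.ext (CoverVertex.ext (mul_assoc _ _ _) rfl) rfl

lemma cover_t_smul (g : Γ.pi1 x₀) (q : Γ.CoverEdge x₀) :
    (Γ.cover x₀).t (g • q) = g • (Γ.cover x₀).t q := by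
  simp only [t, cover_inv_smul, cover_o_smul]

instance : MulAction (Γ.pi1 x₀) (Γ.cover x₀).Ray where
  smul g r := ⟨fun n => g • r.edge n, fun n => by
    rw [cover_t_smul, cover_o_smul, cover_inv_smul, (r.isReduced n).1]
    exact ⟨rfl, fun h => (r.isReduced n).2 (MulAction.injective g h)⟩⟩
  one_smul r := Ray.ext (funext fun n => one_smul _ (r.edge n))
  mul_smul g h r := Ray.ext (funext fun n => mul_smul g h (r.edge n))

instance : MulAction (Γ.pi1 x₀) (Γ.cover x₀).Boundary where
  smul g := Quotient.map (sa := (Γ.cover x₀).raySetoid) (sb := (Γ.cover x₀).raySetoid)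
    (fun r => g • r) (by
      rintro r s ⟨m, n, h⟩
      exact ⟨m, n, fun k => congrArg (g • ·) (h k)⟩)
  one_smul x := by
    induction x using Quotient.ind with
    | _ r => exact congrArg (Quotient.mk _) (one_smul (Γ.pi1 x₀) r)
  mul_smul g h x := by
    induction x using Quotient.ind with
    | _ r => exact congrArg (Quotient.mk _) (mul_smul g h r)

instance : MulAction (Γ.pi1 x₀) (Γ.cover x₀).Boundary2 where
  smul g P := ⟨(g • P.1.1, g • P.1.2), fun h => P.2 (MulAction.injective g h)⟩
  one_smul _ := Subtype.ext (Prod.ext (one_smul _ _) (one_smul _ _))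
  mul_smul g h _ := Subtype.ext (Prod.ext (mul_smul g h _) (mul_smul g h _))

end Basic

end OrGraph

/-- A simplicial chart on the free group `F_N`: a connected graph all of whose vertices have degree
at least `3`, with first Betti number `N`, and a marking `F_N ≅ π₁(Γ, x₀)`. -/
structure SimplicialChart (N : ℕ) {V E : Type*} (Γ : OrGraph V E) (x₀ : V) where
  connected : Γ.Connected
  three_le_degree : ∀ x, 3 ≤ Nat.card {e // Γ.o e = x}
  betti : Nat.card E + 2 = 2 * N + 2 * Nat.card V
  marking : FreeGroup (Fin N) ≃* Γ.pi1 x₀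

section Currents

open MeasureTheory

variable {N : ℕ} {V E : Type*} {Γ : OrGraph V E} {x₀ : V}

/-- A geodesic current on `F_N`: a positive Borel measure on `∂²F_N`, finite on compact sets and
invariant under `F_N` and under the flip. Here `∂F_N` is identified with the boundary of the
universal cover through the marking of the chart. -/
@[ext]
structure GeodesicCurrent (C : SimplicialChart N Γ x₀) where
  measure : Measure (Γ.cover x₀).Boundary2
  finite_on_compact : ∀ K, IsCompact K → measure K < ∞
  invariant : ∀ (g : FreeGroup (Fin N)) (A : Set (Γ.cover x₀).Boundary2), MeasurableSet A →
    measure ((fun P => C.marking g • P) ⁻¹' A) = measure A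
  flip_invariant : ∀ A : Set (Γ.cover x₀).Boundary2, MeasurableSet A →
    measure (OrGraph.flip ⁻¹' A) = measure A

variable (C : SimplicialChart N Γ x₀)

/-- The weak-* topology on the space of geodesic currents. -/
noncomputable instance : TopologicalSpace (GeodesicCurrent C) :=
  TopologicalSpace.induced
    (fun ν => fun f : CompactlySupportedContinuousMap (Γ.cover x₀).Boundary2 ℝ =>
      ∫ P, f P ∂ν.measure) inferInstance

variable {C}

/-- `⟨v, ν⟩_Γ = r`: the path `v` has weight `r` in `ν`, measured on any lift of `v`. -/
def GeodesicCurrent.HasWeight (ν : GeodesicCurrent C) (v : List E) (r : ℝ≥0∞) : Prop :=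
  (∃ l : List (Γ.CoverEdge x₀), Γ.IsLift l v) ∧
    ∀ l : List (Γ.CoverEdge x₀), Γ.IsLift l v → ν.measure ((Γ.cover x₀).cyl l) = r

variable (C)

/-- The translation length of `g` on the universal cover `T₀`. -/
noncomputable def translationLength (g : FreeGroup (Fin N)) : ℕ :=
  ⨅ p : Γ.CoverVertex x₀, (Γ.cover x₀).pathDist p (C.marking g • p)

/-- `P = (g^{-∞}, g^{∞})`, the limits of `g⁻ⁿ` and of `gⁿ`. -/
def IsPolePair (g : FreeGroup (Fin N)) (P : (Γ.cover x₀).Boundary2) : Prop :=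
  (Γ.cover x₀).ConvergesTo (fun n => C.marking (g⁻¹ ^ n) • Γ.coverBase x₀) P.1.1 ∧
  (Γ.cover x₀).ConvergesTo (fun n => C.marking (g ^ n) • Γ.coverBase x₀) P.1.2

/-- The measure `∑_{h ∈ F_N/⟨g⟩} (δ_{hP} + δ_{h flip(P)})`, where `P` is the pole pair of `g`. -/
noncomputable def countingMeasure (g : FreeGroup (Fin N)) (P : (Γ.cover x₀).Boundary2) :
    Measure (Γ.cover x₀).Boundary2 :=
  Measure.sum fun h : FreeGroup (Fin N) ⧸ Subgroup.zpowers g =>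
    Measure.dirac (C.marking h.out • P) + Measure.dirac (C.marking h.out • OrGraph.flip P)

/-- `I` is the intersection pairing `⟨T₀, ·⟩` on geodesic currents: it is continuous, linear over
the nonnegative reals, and its value at the counting current `η_g` of any `g ≠ 1` is the
translation length of `g` on `T₀`. -/
structure IsIntersectionPairing (I : GeodesicCurrent C → ℝ≥0) : Prop where
  continuous : Continuous I
  linear : ∀ (a b : ℝ≥0) (ν₁ ν₂ ν : GeodesicCurrent C),
    ν.measure = a • ν₁.measure + b • ν₂.measure → I ν = a * I ν₁ + b * I ν₂
  counting : ∀ g : FreeGroup (Fin N), g ≠ 1 → ∀ P, IsPolePair C g P →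
    ∀ η : GeodesicCurrent C, η.measure = countingMeasure C g P → I η = translationLength C g

variable {C}

/-- `⟨T₀, ν⟩ = r`: the intersection pairing with `T₀` exists, and it takes the value `r` at `ν`
(no matter how it was constructed). -/
def HasIntersectionNumber (ν : GeodesicCurrent C) (r : ℝ≥0) : Prop :=
  (∃ I, IsIntersectionPairing C I) ∧ ∀ I, IsIntersectionPairing C I → I ν = r

end Currents

/-- A finite-state Markov chain with state set `S`. -/
structure FSMC {E : Type*} (S : Finset E) where
  nonempty : S.Nonempty
  p : Matrix S S ℝ
  nonneg : ∀ s s', 0 ≤ p s s'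
  row_sum : ∀ s, ∑ s', p s s' = 1

namespace FSMC

variable {E : Type*} {S : Finset E}

/-- Irreducibility: any state is reached from any state in some number `n ≥ 1` of steps with
positive probability. -/
def IsIrreducible [DecidableEq E] (X : FSMC S) : Prop :=
  ∀ s s', ∃ n : ℕ, 1 ≤ n ∧ 0 < (X.p ^ n) s s'

/-- `μ` is a stationary probability distribution of the chain. -/
def IsStationary (X : FSMC S) (μ : S → ℝ) : Prop :=
  (∀ s, 0 ≤ μ s) ∧ ∑ s, μ s = 1 ∧ ∀ s', ∑ s, μ s * X.p s s' = μ s'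

/-- The chain is `Γ`-based. -/
def IsBased {V : Type*} (X : FSMC S) (Γ : OrGraph V E) : Prop :=
  2 ≤ S.card ∧ ∀ e e' : S, 0 < X.p e e' → Γ.t e = Γ.o e' ∧ (e' : E) ≠ Γ.inv e

open Classical in
/-- The transition probabilities, extended by `0` to edges that are not states. -/
noncomputable def extP (X : FSMC S) (e e' : E) : ℝ :=
  if h : e ∈ S ∧ e' ∈ S then X.p ⟨e, h.1⟩ ⟨e', h.2⟩ else 0

open Classical in
/-- A distribution on the states, extended by `0` to edges that are not states. -/
noncomputable def extDist (μ : S → ℝ) (e : E) : ℝ := if h : e ∈ S then μ ⟨e, h⟩ else 0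

/-- `p(e₁, e₂) ⋯ p(e_{k-1}, e_k)` -/
noncomputable def pathProb (X : FSMC S) : List E → ℝ
  | [] => 1
  | [_] => 1
  | e :: e' :: l => X.extP e e' * pathProb X (e' :: l)

/-- `μ[k](v) = μ(e₁) p(e₁, e₂) ⋯ p(e_{k-1}, e_k)` for a path `v = e₁ ⋯ e_k` of length `k ≥ 1`. It is
`0` unless `v` is a feasible word in the states. (The value at the empty path is irrelevant.) -/
noncomputable def iterProb (X : FSMC S) (μ : S → ℝ) : List E → ℝ
  | [] => 1
  | e :: l => extDist μ e * X.pathProb (e :: l)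

end FSMC

/-!
The universal cover `T` of `Γ` is a tree, and the cylinder of a nonempty reduced path of `T` is a
product of two shadows. The cylinders are therefore compact open sets; they form a countable basis
of `∂²` and a `π`-system, since the intersection of two cylinders is empty or the cylinder of the
hull of the two paths. A current is thus determined by its weights (`measure_ext_of_cyl`), and a
measure with finite weights that depend only on the projected path and are symmetric under inversion
is a current (`GeodesicCurrent.ofWeights`).

For existence, fix `K ≥ 2`. Stationarity says that `v ↦ μ₀[K](v)` is a circulation on the graph
whose arcs are the words of length `K`, and a circulation is a nonnegative combination of cycles. A
cycle is a periodic bi-infinite reduced path of `Γ`; it is the projection of the axis of some `g`, and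
the weights of the counting current `η_g` are the numbers of occurrences of a word and of its inverse
in one period (`countingMeasure_cyl`). So there is a combination `ν_K` of counting currents that has
the required weights on words of length `K`, hence also on shorter words, because both sides are
additive under continuation of a word by one edge. Every cylinder has the same measure for all
large `K`, so integrals of step functions stabilize, integrals of continuous functions with compact
support converge, and the Riesz–Markov–Kakutani theorem gives the limit current `ν`
(`exists_measure_tendsto_integral`, `exists_current_markovWeight`).

Half the sum of the weights of all oriented edges is an intersection pairing: one period of the axis
of `g` has `‖g‖` edges, and `η_g` counts each of them once in each direction
(`isIntersectionPairing_halfTotalWeight`). Any two pairings agree at counting currents, by linearity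
at the `ν_K`, and by continuity at `ν`. So every pairing takes at `ν` the value
`(1/2) ∑ₑ (μ₀(e) + μ₀(e⁻¹)) = 1`.
-/

namespace OrGraph

/-! ### Reduced words in the edge group -/

section NormalForm

variable {V E : Type*} (Γ : OrGraph V E)

open Classical in
/-- Left multiplication of a reduced list by the edge `e`: cons, followed by a cancellation if
necessary. -/
noncomputable def reducedCons (e : E) (l : List E) : List E :=
  if l.head? = some (Γ.inv e) then l.tail else e :: l

variable {Γ}

lemma isReduced_cons_cons {e f : E} {l : List E} :
    Γ.IsReduced (e :: f :: l) ↔ f ≠ Γ.inv e ∧ Γ.IsReduced (f :: l) :=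
  List.isChain_cons_cons

lemma IsReduced.tail {e : E} {l : List E} (h : Γ.IsReduced (e :: l)) : Γ.IsReduced l :=
  List.IsChain.tail h

lemma isReduced_cons {e : E} {l : List E} (h : Γ.IsReduced l) (h' : l.head? ≠ some (Γ.inv e)) :
    Γ.IsReduced (e :: l) := by
  cases l with
  | nil => exact List.isChain_singleton _
  | cons a l => exact isReduced_cons_cons.2 ⟨fun ha => h' (by simp [ha]), h⟩

lemma isReduced_reducedCons (e : E) {l : List E} (h : Γ.IsReduced l) :
    Γ.IsReduced (Γ.reducedCons e l) := by
  unfold reducedCons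
  split_ifs with h1
  · exact List.IsChain.tail h
  · exact isReduced_cons h h1

lemma reducedCons_of_isReduced {e : E} {l : List E} (h : Γ.IsReduced (e :: l)) :
    Γ.reducedCons e l = e :: l := by
  refine if_neg fun h1 => ?_
  cases l with
  | nil => simp at h1
  | cons a l => exact (isReduced_cons_cons.1 h).1 (by simpa using h1)

lemma reducedCons_inv_reducedCons (e : E) {l : List E} (h : Γ.IsReduced l) :
    Γ.reducedCons (Γ.inv e) (Γ.reducedCons e l) = l := by
  by_cases h1 : l.head? = some (Γ.inv e)
  · cases l with
    | nil => simp at h1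
    | cons a l =>
      obtain rfl : a = Γ.inv e := by simpa using h1
      rw [show Γ.reducedCons e (Γ.inv e :: l) = l from if_pos h1]
      exact reducedCons_of_isReduced h
  · rw [show Γ.reducedCons e l = e :: l from if_neg h1]
    exact if_pos (by simp [Γ.inv_inv])

variable (Γ) in
/-- Left multiplication by an edge as a permutation of the reduced lists. -/
noncomputable def reducedPerm (e : E) : Equiv.Perm {l // Γ.IsReduced l} where
  toFun l := ⟨Γ.reducedCons e l.1, isReduced_reducedCons e l.2⟩
  invFun l := ⟨Γ.reducedCons (Γ.inv e) l.1, isReduced_reducedCons _ l.2⟩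
  left_inv l := Subtype.ext (reducedCons_inv_reducedCons e l.2)
  right_inv l := Subtype.ext (by
    have h := reducedCons_inv_reducedCons (Γ.inv e) l.2
    rwa [Γ.inv_inv] at h)

variable (Γ) in
/-- The action of the edge group on reduced lists by left multiplication. -/
noncomputable def reducedHom : Γ.EdgeGroup →* Equiv.Perm {l // Γ.IsReduced l} :=
  PresentedGroup.toGroup (f := Γ.reducedPerm) (by
    rintro _ ⟨e, rfl⟩
    rw [map_mul, FreeGroup.lift_apply_of, FreeGroup.lift_apply_of]
    ext1 l
    refine Subtype.ext ?_
    have h := reducedCons_inv_reducedCons (Γ.inv e) l.2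
    rwa [Γ.inv_inv] at h)

lemma reducedHom_word {l : List E} (h : Γ.IsReduced l) :
    (Γ.reducedHom (Γ.word l) ⟨[], List.isChain_nil⟩).1 = l := by
  induction l with
  | nil => simp [word]
  | cons e l ih =>
    have h2 : Γ.word (e :: l) = Γ.gen e * Γ.word l := by simp [word]
    have h3 : Γ.reducedHom (Γ.gen e) = Γ.reducedPerm e := PresentedGroup.toGroup.of _
    rw [h2, map_mul, Equiv.Perm.mul_apply, h3]
    change Γ.reducedCons e _ = _
    rw [ih h.tail, reducedCons_of_isReduced h]

/-- A reduced list is determined by its class in the edge group. -/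
lemma eq_of_word_eq {l m : List E} (hl : Γ.IsReduced l) (hm : Γ.IsReduced m)
    (h : Γ.word l = Γ.word m) : l = m := by
  rw [← reducedHom_word hl, ← reducedHom_word hm, h]

end NormalForm

/-! ### The universal cover is a tree -/

section Tree

variable {V E : Type*}

/-- A tree: a connected graph in which two vertices are joined by only one reduced path. -/
structure IsTree (T : OrGraph V E) : Prop where
  connected : T.Connected
  unique : ∀ {x y : V} {l m : List E}, T.IsReduced l → T.IsReduced m → T.IsPath x l y →
    T.IsPath x m y → l = m

variable {Γ : OrGraph V E} {x₀ : V}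

lemma cover_proj_inv (q : Γ.CoverEdge x₀) : ((Γ.cover x₀).inv q).proj = Γ.inv q.proj := rfl

lemma isPath_map_proj {p q : Γ.CoverVertex x₀} {l : List (Γ.CoverEdge x₀)}
    (h : (Γ.cover x₀).IsPath p l q) :
    Γ.IsPath p.term (l.map CoverEdge.proj) q.term ∧
      q.cls = p.cls * Γ.word (l.map CoverEdge.proj) := by
  induction l generalizing p with
  | nil => cases h; exact ⟨rfl, by simp [word]⟩
  | cons e l ih =>
    obtain ⟨rfl, h2⟩ := h
    obtain ⟨h3, h4⟩ := ih h2
    refine ⟨⟨e.o_proj, h3⟩, ?_⟩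
    rw [h4]
    change e.start.cls * Γ.gen e.proj * _ = e.start.cls * _
    simp [word, mul_assoc]

/-- Paths of the base lift to the universal cover. -/
lemma exists_lift {v : List E} {y : V} (p : Γ.CoverVertex x₀) (h : Γ.IsPath p.term v y) :
    ∃ l q, (Γ.cover x₀).IsPath p l q ∧ l.map CoverEdge.proj = v ∧ q.term = y := by
  induction v generalizing p with
  | nil => exact ⟨[], p, rfl, rfl, h⟩
  | cons e v ih =>
    obtain ⟨l, q, h1, h2, h3⟩ := ih (CoverEdge.finish ⟨p, e, h.1⟩) h.2
    exact ⟨⟨p, e, h.1⟩ :: l, q, ⟨rfl, h1⟩, by simp [h2], h3⟩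

/-- Lifts of a path are determined by their initial vertex. -/
lemma lift_unique {p q q' : Γ.CoverVertex x₀} {l m : List (Γ.CoverEdge x₀)}
    (hl : (Γ.cover x₀).IsPath p l q) (hm : (Γ.cover x₀).IsPath p m q')
    (h : l.map CoverEdge.proj = m.map CoverEdge.proj) : l = m := by
  induction l generalizing p m with
  | nil => simpa using h
  | cons e l ih =>
    cases m with
    | nil => simp at h
    | cons f m =>
      simp only [List.map_cons, List.cons.injEq] at h
      obtain rfl : e = f := CoverEdge.ext (hl.1.trans hm.1.symm) h.1
      rw [ih hl.2 hm.2 h.2]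

/-- A path in the universal cover is reduced if and only if its projection is. -/
lemma isReduced_map_proj_iff {p q : Γ.CoverVertex x₀} {l : List (Γ.CoverEdge x₀)}
    (h : (Γ.cover x₀).IsPath p l q) :
    Γ.IsReduced (l.map CoverEdge.proj) ↔ (Γ.cover x₀).IsReduced l := by
  induction l generalizing p with
  | nil => exact iff_of_true List.isChain_nil List.isChain_nil
  | cons e l ih =>
    cases l with
    | nil => exact iff_of_true (List.isChain_singleton _) (List.isChain_singleton _)
    | cons f l =>
      have := ih h.2
      rw [isReduced_cons_cons, ← this, List.map_cons, List.map_cons, isReduced_cons_cons]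
      refine and_congr_left fun _ => not_congr ⟨fun h1 => ?_, fun h1 => by rw [h1]; rfl⟩
      exact CoverEdge.ext h.2.1 h1

lemma cover_connected : (Γ.cover x₀).Connected := by
  have h : ∀ p : Γ.CoverVertex x₀, ∃ l, (Γ.cover x₀).IsPath (Γ.coverBase x₀) l p := by
    intro p
    obtain ⟨v, hv, hw⟩ := p.exists_path
    obtain ⟨l, q, h1, h2, h3⟩ := exists_lift (Γ.coverBase x₀) hv
    have h4 := (isPath_map_proj h1).2
    rw [h2, hw] at h4
    have : q = p := CoverVertex.ext (h4.trans (one_mul _)) h3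
    exact ⟨l, this ▸ h1⟩
  intro p q
  obtain ⟨l, hl⟩ := h p
  obtain ⟨m, hm⟩ := h q
  exact ⟨_, isPath_append _ (isPath_invPath _ hl) hm⟩

variable (Γ x₀) in
theorem cover_isTree : (Γ.cover x₀).IsTree where
  connected := cover_connected
  unique {p q l m} hl hm h1 h2 := by
    refine lift_unique h1 h2 (eq_of_word_eq ((isReduced_map_proj_iff h1).2 hl)
      ((isReduced_map_proj_iff h2).2 hm) ?_)
    exact mul_left_cancel ((isPath_map_proj h1).2.symm.trans (isPath_map_proj h2).2)

end Tree

end OrGraph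

namespace OrGraph

/-! ### Rays, lines and shadows in a tree -/

section RaysAndLines

variable {V E : Type*} {T : OrGraph V E}

lemma inv_injective : Function.Injective T.inv := fun a b h => by
  rw [← T.inv_inv a, h, T.inv_inv]

namespace Ray

/-- The ray without its first `m` edges. -/
def drop (r : T.Ray) (m : ℕ) : T.Ray := ⟨fun n => r.edge (m + n), fun n => r.isReduced (m + n)⟩

lemma toEnd_drop (r : T.Ray) (m : ℕ) : (r.drop m).toEnd = r.toEnd :=
  Quotient.sound ⟨0, m, fun k => by simp [drop]⟩

/-- The ray with an additional first edge. -/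
def cons (e : E) (r : T.Ray) (h : T.t e = T.o (r.edge 0)) (h' : r.edge 0 ≠ T.inv e) : T.Ray :=
  ⟨fun n => Nat.casesOn n e r.edge, fun n => by
    cases n with
    | zero => exact ⟨h, h'⟩
    | succ n => exact r.isReduced n⟩

lemma toEnd_cons (e : E) (r : T.Ray) (h : T.t e = T.o (r.edge 0)) (h' : r.edge 0 ≠ T.inv e) :
    (r.cons e h h').toEnd = r.toEnd :=
  Quotient.sound ⟨1, 0, fun k => by rw [add_comm, zero_add]; rfl⟩

/-- The first `n` edges of a ray. -/
def take (r : T.Ray) (n : ℕ) : List E := (List.range n).map r.edge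

lemma isPath_take (r : T.Ray) (n : ℕ) :
    T.IsPath (T.o (r.edge 0)) (r.take n) (T.o (r.edge n)) := by
  induction n with
  | zero => exact rfl
  | succ n ih =>
    rw [take, List.range_succ, List.map_append]
    exact T.isPath_append ih ⟨rfl, (r.isReduced n).1⟩

lemma isReduced_take (r : T.Ray) (n : ℕ) : T.IsReduced (r.take n) := by
  rw [IsReduced, take, List.isChain_map, List.isChain_range]
  exact fun m _ => (r.isReduced m).2

lemma toEnd_eq_iff {r s : T.Ray} :
    r.toEnd = s.toEnd ↔ ∃ m n, ∀ k, r.edge (m + k) = s.edge (n + k) :=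
  Quotient.eq (r := T.raySetoid)

lemma toEnd_mem_shadow (r : T.Ray) (n : ℕ) : r.toEnd ∈ T.shadow (r.edge n) :=
  ⟨r.drop n, rfl, r.toEnd_drop n⟩

end Ray

lemma exists_toEnd (x : T.Boundary) : ∃ r : T.Ray, r.toEnd = x := Quotient.exists_rep x

lemma shadow_subset_shadow {e f : E} (h : T.t e = T.o f) (h' : f ≠ T.inv e) :
    T.shadow f ⊆ T.shadow e := by
  rintro _ ⟨r, rfl, rfl⟩
  exact ⟨r.cons e h h', rfl, r.toEnd_cons e h h'⟩

lemma Ray.antitone_shadow (r : T.Ray) : Antitone fun n => T.shadow (r.edge n) :=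
  antitone_nat_of_succ_le fun n => shadow_subset_shadow (r.isReduced n).1 (r.isReduced n).2

/-- If a ray ends in a shadow, the shadows of its edges eventually lie inside that shadow. -/
lemma Ray.exists_shadow_subset (r : T.Ray) {a : E} (h : r.toEnd ∈ T.shadow a) :
    ∃ m, ∀ n, m ≤ n → T.shadow (r.edge n) ⊆ T.shadow a := by
  obtain ⟨s, rfl, hs⟩ := h
  obtain ⟨m, n, hmn⟩ := Ray.toEnd_eq_iff.1 hs
  refine ⟨n, fun k hk => ?_⟩
  obtain ⟨k, rfl⟩ := Nat.exists_eq_add_of_le hk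
  rw [← hmn k]
  exact s.antitone_shadow (Nat.zero_le _)

namespace Line

/-- The line with its parametrization shifted by `k`. -/
def shift (c : T.Line) (k : ℤ) : T.Line :=
  ⟨fun i => c.edge (i + k), fun i => by
    have := c.isReduced (i + k)
    rwa [show i + k + 1 = i + 1 + k by ring] at this⟩

/-- The line with its orientation reversed. -/
def reverse (c : T.Line) : T.Line :=
  ⟨fun i => T.inv (c.edge (-1 - i)), fun i => by
    have h := c.isReduced (-1 - (i + 1))
    rw [show -1 - (i + 1) + 1 = -1 - i by ring] at h
    refine ⟨?_, fun h2 => h.2 ?_⟩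
    · change T.o (T.inv (T.inv _)) = T.t _
      rw [T.inv_inv, h.1]
    · have h3 := congrArg T.inv h2
      simp only [T.inv_inv] at h3
      rw [h3, T.inv_inv]⟩

lemma forward_reverse (c : T.Line) : c.reverse.forward = c.backward := rfl

lemma backward_reverse (c : T.Line) : c.reverse.backward = c.forward :=
  Ray.ext (funext fun n => by
    change T.inv (T.inv (c.edge (-1 - (-1 - (n : ℤ))))) = c.edge n
    rw [T.inv_inv, sub_sub_cancel])

lemma toEnd_forward_shift (c : T.Line) (k : ℤ) :
    (c.shift k).forward.toEnd = c.forward.toEnd := by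
  rw [Ray.toEnd_eq_iff]
  refine ⟨(-k).toNat, k.toNat, fun j => ?_⟩
  change c.edge (_ + k) = c.edge _
  congr 1
  push_cast
  omega

lemma toEnd_backward_shift (c : T.Line) (k : ℤ) :
    (c.shift k).backward.toEnd = c.backward.toEnd := by
  have h : (c.shift k).reverse = c.reverse.shift (-k) :=
    Line.ext (funext fun i => congrArg (fun j => T.inv (c.edge j)) (by ring))
  rw [← forward_reverse, h, toEnd_forward_shift, forward_reverse]

lemma forward_mem_shadow (c : T.Line) (i : ℤ) : c.forward.toEnd ∈ T.shadow (c.edge i) :=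
  ⟨(c.shift i).forward, congrArg c.edge (zero_add i), c.toEnd_forward_shift i⟩

lemma backward_mem_shadow (c : T.Line) (i : ℤ) :
    c.backward.toEnd ∈ T.shadow (T.inv (c.edge i)) := by
  have h := c.reverse.forward_mem_shadow (-1 - i)
  rwa [forward_reverse, show c.reverse.edge (-1 - i) = T.inv (c.edge (-1 - (-1 - i))) from rfl,
    sub_sub_cancel] at h

lemma antitone_shadow (c : T.Line) : Antitone fun i => T.shadow (c.edge i) :=
  antitone_int_of_succ_le fun n => shadow_subset_shadow (c.isReduced n).1 (c.isReduced n).2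

lemma monotone_shadow_inv (c : T.Line) : Monotone fun i => T.shadow (T.inv (c.edge i)) := by
  intro i j h
  have h1 := c.reverse.antitone_shadow (show -1 - j ≤ -1 - i by omega)
  change T.shadow (T.inv (c.edge (-1 - (-1 - i)))) ⊆ T.shadow (T.inv (c.edge (-1 - (-1 - j)))) at h1
  rwa [sub_sub_cancel, sub_sub_cancel] at h1

/-- Two rays that leave a vertex through different edges form a line. -/
def join (r s : T.Ray) (h : T.o (r.edge 0) = T.o (s.edge 0)) (h' : r.edge 0 ≠ s.edge 0) :
    T.Line where
  edge
    | Int.ofNat n => s.edge n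
    | Int.negSucc n => T.inv (r.edge n)
  isReduced n := by
    match n with
    | Int.ofNat n => exact s.isReduced n
    | Int.negSucc 0 =>
      refine ⟨(T.t_inv _).trans h, fun h2 => h' ?_⟩
      change s.edge 0 = T.inv (T.inv (r.edge 0)) at h2
      rw [h2, T.inv_inv]
    | Int.negSucc (n + 1) =>
      refine ⟨?_, fun h2 => (r.isReduced n).2 ?_⟩
      · change T.t (T.inv (r.edge (n + 1))) = T.o (T.inv (r.edge n))
        rw [T.t_inv]
        exact (r.isReduced n).1.symm
      · change T.inv (r.edge n) = T.inv (T.inv (r.edge (n + 1))) at h2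
        rw [h2, T.inv_inv]

variable {r s : T.Ray} (h : T.o (r.edge 0) = T.o (s.edge 0)) (h' : r.edge 0 ≠ s.edge 0)

lemma forward_join : (join r s h h').forward = s := rfl

lemma backward_join : (join r s h h').backward = r :=
  Ray.ext (funext fun n => by
    have : (-1 - (n : ℤ)) = Int.negSucc n := by omega
    change T.inv ((join r s h h').edge (-1 - (n : ℤ))) = _
    rw [this]
    exact T.inv_inv _)

end Line

/-- Every end of a connected graph is the end of a ray from any given vertex. -/
lemma Connected.exists_ray (hT : T.Connected) (v : V) (x : T.Boundary) :
    ∃ r : T.Ray, T.o (r.edge 0) = v ∧ r.toEnd = x := by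
  obtain ⟨r, rfl⟩ := exists_toEnd x
  obtain ⟨l, hl⟩ := hT v (T.o (r.edge 0))
  induction l generalizing v with
  | nil => exact ⟨r, hl.symm, rfl⟩
  | cons e l ih =>
    obtain ⟨s, h1, h2⟩ := ih (T.t e) hl.2
    by_cases h3 : s.edge 0 = T.inv e
    · refine ⟨s.drop 1, ?_, (s.toEnd_drop 1).trans h2⟩
      change T.o (s.edge 1) = v
      rw [← (s.isReduced 0).1, h3, T.t_inv, hl.1]
    · exact ⟨s.cons e h1.symm h3, hl.1, (s.toEnd_cons e h1.symm h3).trans h2⟩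

lemma Connected.mem_shadow_or_mem_shadow_inv (hT : T.Connected) (e : E) (x : T.Boundary) :
    x ∈ T.shadow e ∨ x ∈ T.shadow (T.inv e) := by
  obtain ⟨r, h1, rfl⟩ := hT.exists_ray (T.o e) x
  by_cases h2 : r.edge 0 = e
  · exact .inl (h2 ▸ r.toEnd_mem_shadow 0)
  · have h3 : T.t (T.inv e) = T.o (r.edge 0) := (T.t_inv e).trans h1.symm
    have h4 : r.edge 0 ≠ T.inv (T.inv e) := by rwa [T.inv_inv]
    exact .inr ⟨r.cons _ h3 h4, rfl, r.toEnd_cons _ h3 h4⟩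

namespace IsTree

/-- In a tree, a ray is determined by its initial vertex and its end. -/
lemma ray_unique (hT : T.IsTree) {r s : T.Ray} (h : T.o (r.edge 0) = T.o (s.edge 0))
    (h' : r.toEnd = s.toEnd) : r = s := by
  obtain ⟨m, n, hmn⟩ := Ray.toEnd_eq_iff.1 h'
  have h0 := hmn 0
  rw [add_zero, add_zero] at h0
  have h2 := s.isPath_take n
  rw [← h, ← h0] at h2
  have h1 := hT.unique (r.isReduced_take m) (s.isReduced_take n) (r.isPath_take m) h2
  obtain rfl : m = n := by simpa [Ray.take] using congrArg List.length h1
  refine Ray.ext (funext fun k => ?_)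
  by_cases hk : k < m
  · exact List.map_inj_left.1 h1 k (List.mem_range.2 hk)
  · obtain ⟨k, rfl⟩ := Nat.exists_eq_add_of_le (not_lt.1 hk)
    exact hmn k

/-- The shadows of two different edges with the same initial vertex are disjoint. -/
lemma disjoint_shadow (hT : T.IsTree) {e f : E} (h : T.o e = T.o f) (h' : e ≠ f) :
    Disjoint (T.shadow e) (T.shadow f) := by
  rw [Set.disjoint_left]
  rintro x ⟨r, rfl, hr⟩ ⟨s, rfl, hs⟩
  exact h' (by rw [hT.ray_unique h (hr.trans hs.symm)])

lemma disjoint_shadow_inv (hT : T.IsTree) (e : E) :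
    Disjoint (T.shadow e) (T.shadow (T.inv e)) := by
  rw [Set.disjoint_left]
  rintro x hx ⟨r, h1, rfl⟩
  have h2 := r.isReduced 0
  rw [zero_add, h1, T.t_inv, T.inv_inv] at h2
  refine Set.disjoint_left.1 (hT.disjoint_shadow h2.1 h2.2.symm) hx ?_
  exact r.toEnd_mem_shadow 1

lemma compl_shadow (hT : T.IsTree) (e : E) : (T.shadow e)ᶜ = T.shadow (T.inv e) := by
  ext x
  refine ⟨(hT.connected.mem_shadow_or_mem_shadow_inv e x).resolve_left, fun h h' => ?_⟩
  exact Set.disjoint_left.1 (hT.disjoint_shadow_inv e) h' h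

lemma exists_line (hT : T.IsTree) {x y : T.Boundary} (h : x ≠ y) :
    ∃ c : T.Line, c.backward.toEnd = x ∧ c.forward.toEnd = y := by
  obtain ⟨r₀, rfl⟩ := exists_toEnd x
  obtain ⟨s, h1, rfl⟩ := hT.connected.exists_ray (T.o (r₀.edge 0)) y
  have hne : ∃ n, r₀.edge n ≠ s.edge n := by
    by_contra! hn
    exact h (by rw [Ray.ext (funext hn)])
  obtain ⟨n, h2, h3⟩ : ∃ n, r₀.edge n ≠ s.edge n ∧ ∀ m < n, r₀.edge m = s.edge m := by
    classical
    exact ⟨Nat.find hne, Nat.find_spec hne, fun m hm => not_not.1 (Nat.find_min hne hm)⟩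
  have h4 : T.o ((r₀.drop n).edge 0) = T.o ((s.drop n).edge 0) := by
    change T.o (r₀.edge n) = T.o (s.edge n)
    cases n with
    | zero => exact h1.symm
    | succ m => rw [← (r₀.isReduced m).1, ← (s.isReduced m).1, h3 m (Nat.lt_succ_self m)]
  have h5 : (r₀.drop n).edge 0 ≠ (s.drop n).edge 0 := h2
  refine ⟨Line.join (r₀.drop n) (s.drop n) h4 h5, ?_, ?_⟩
  · rw [Line.backward_join, Ray.toEnd_drop]
  · rw [Line.forward_join, Ray.toEnd_drop]

/-- In a tree, a line is determined by its ends up to a shift of the parametrization. -/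
lemma line_unique (hT : T.IsTree) {c d : T.Line} (hb : c.backward.toEnd = d.backward.toEnd)
    (hf : c.forward.toEnd = d.forward.toEnd) : ∃ k, d = c.shift k := by
  obtain ⟨m, n, hmn⟩ := Ray.toEnd_eq_iff.1 hf
  refine ⟨m - n, ?_⟩
  have h1 : ∀ k : ℕ, (c.shift m).edge k = (d.shift n).edge k := fun k => by
    have := hmn k
    change c.edge (m + k : ℕ) = d.edge (n + k : ℕ) at this
    change c.edge (k + m) = d.edge (k + n)
    rw [add_comm (k : ℤ), add_comm (k : ℤ)]
    exact_mod_cast this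
  have h2 : (c.shift m).backward = (d.shift n).backward := by
    refine hT.ray_unique ?_ ?_
    · change T.t ((c.shift m).edge (-1)) = T.t ((d.shift n).edge (-1))
      rw [((c.shift m).isReduced (-1)).1, ((d.shift n).isReduced (-1)).1]
      exact congrArg T.o (h1 0)
    · rw [Line.toEnd_backward_shift, Line.toEnd_backward_shift, hb]
  have h3 : c.shift m = d.shift n := by
    refine Line.ext (funext fun i => ?_)
    rcases i with k | k
    · exact h1 k
    · have := congrFun (congrArg Ray.edge h2) k
      have := inv_injective this
      rwa [show (-1 - (k : ℤ)) = Int.negSucc k by omega] at this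
  refine Line.ext (funext fun i => ?_)
  have := congrFun (congrArg Line.edge h3) (i - n)
  change c.edge (i - n + m) = d.edge (i - n + n) at this
  rw [sub_add_cancel] at this
  rw [← this]
  exact congrArg c.edge (by ring)

lemma line_edge_injective (hT : T.IsTree) (c : T.Line) : Function.Injective c.edge := by
  have h : ∀ i (n : ℕ), c.edge i ≠ c.edge (i + (n + 1)) := fun i n h => by
    have h2 := (c.shift i).forward.isPath_take (n + 1)
    have h3 : (c.shift i).forward.edge (n + 1) = (c.shift i).forward.edge 0 := by
      change c.edge ((n + 1 : ℕ) + i) = c.edge ((0 : ℕ) + i)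
      rw [Nat.cast_zero, zero_add, h]
      exact congrArg c.edge (by push_cast; ring)
    rw [h3] at h2
    have h4 := hT.unique ((c.shift i).forward.isReduced_take (n + 1)) List.isChain_nil h2
      (rfl : T.IsPath _ [] _)
    simpa [Ray.take] using congrArg List.length h4
  intro i j hij
  rcases lt_trichotomy i j with hlt | heq | hlt
  · refine (h i (j - i - 1).toNat ?_).elim
    rw [hij]
    exact congrArg c.edge (by omega)
  · exact heq
  · refine (h j (i - j - 1).toNat ?_).elim
    rw [← hij]
    exact congrArg c.edge (by omega)

end IsTree

/-! ### Cylinders -/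

/-- Every end in the shadow of the last edge of a reduced path is the end of a ray that starts with
this path. -/
lemma exists_ray_of_isReduced {e : E} {l : List E} {v w : V} (hl : T.IsPath v (e :: l) w)
    (hr : T.IsReduced (e :: l)) {x : T.Boundary}
    (hx : x ∈ T.shadow ((e :: l).getLast (List.cons_ne_nil e l))) :
    ∃ r : T.Ray, r.toEnd = x ∧ ∀ (j : ℕ) (h : j < (e :: l).length), r.edge j = (e :: l)[j] := by
  induction l generalizing e v with
  | nil =>
    obtain ⟨r, h1, rfl⟩ := hx
    refine ⟨r, rfl, fun j h => ?_⟩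
    obtain rfl : j = 0 := by simpa using h
    simpa using h1
  | cons f l ih =>
    rw [List.getLast_cons_cons] at hx
    obtain ⟨r, rfl, h2⟩ := ih hl.2 hr.tail hx
    have h3 : r.edge 0 = f := h2 0 (by simp)
    have h4 := isReduced_cons_cons.1 hr
    have h5 : T.t e = T.o (r.edge 0) := by rw [h3]; exact hl.2.1.symm
    refine ⟨r.cons e h5 (h3 ▸ h4.1), r.toEnd_cons _ _ _, fun j h => ?_⟩
    cases j with
    | zero => rfl
    | succ j => exact h2 j (by simpa using h)

/-- The cylinder of a reduced path is the product of the shadow of its inverted first edge and the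
shadow of its last edge. -/
lemma mem_cyl_iff {e : E} {l : List E} {v w : V} (hl : T.IsPath v (e :: l) w)
    (hr : T.IsReduced (e :: l)) {P : T.Boundary2} :
    P ∈ T.cyl (e :: l) ↔ P.1.1 ∈ T.shadow (T.inv e) ∧
      P.1.2 ∈ T.shadow ((e :: l).getLast (List.cons_ne_nil e l)) := by
  constructor
  · rintro ⟨c, h1, h2, i, h3⟩
    rw [← h1, ← h2]
    constructor
    · have := h3 0 (by simp)
      simp only [Nat.cast_zero, add_zero, List.getElem_cons_zero] at this
      exact this ▸ c.backward_mem_shadow i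
    · rw [List.getLast_eq_getElem, ← h3 _ (by simp)]
      exact c.forward_mem_shadow _
  · rintro ⟨⟨r, h1, h2⟩, h3⟩
    obtain ⟨s, h4, h5⟩ := exists_ray_of_isReduced hl hr h3
    have h6 : s.edge 0 = e := h5 0 (by simp)
    have h7 := r.isReduced 0
    rw [h1, T.t_inv, T.inv_inv] at h7
    have h8 : T.o ((r.drop 1).edge 0) = T.o (s.edge 0) := by
      rw [h6]; exact h7.1.symm
    have h9 : (r.drop 1).edge 0 ≠ s.edge 0 := by
      rw [h6]; exact h7.2
    refine ⟨Line.join (r.drop 1) s h8 h9, ?_, ?_, 0, fun j h => ?_⟩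
    · rw [Line.backward_join, Ray.toEnd_drop, h2]
    · rw [Line.forward_join, h4]
    · rw [zero_add]
      exact h5 j h

namespace IsTree

/-- The line with given ends runs through the path `l` if and only if its pair of ends is in the
cylinder of `l`. -/
lemma mem_cyl_iff_of_line (hT : T.IsTree) {c : T.Line} {P : T.Boundary2}
    (hb : c.backward.toEnd = P.1.1) (hf : c.forward.toEnd = P.1.2) {l : List E} :
    P ∈ T.cyl l ↔ ∃ i : ℤ, ∀ (j : ℕ) (h : j < l.length), c.edge (i + j) = l[j] := by
  refine ⟨fun ⟨d, h1, h2, i, h3⟩ => ?_, fun h => ⟨c, hb, hf, h⟩⟩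
  obtain ⟨k, rfl⟩ := hT.line_unique (hb.trans h1.symm) (hf.trans h2.symm)
  refine ⟨i + k, fun j h => ?_⟩
  rw [← h3 j h]
  exact congrArg c.edge (by ring)

end IsTree

/-- The segment of length `n` of a line that starts at time `i`. -/
def Line.segment (c : T.Line) (i : ℤ) (n : ℕ) : List E := (c.shift i).forward.take n

namespace Line

lemma length_segment (c : T.Line) (i : ℤ) (n : ℕ) : (c.segment i n).length = n := by
  simp [segment, Ray.take]

lemma getElem_segment (c : T.Line) (i : ℤ) (n j : ℕ) (h : j < (c.segment i n).length) :
    (c.segment i n)[j] = c.edge (i + j) := by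
  simp only [segment, Ray.take, List.getElem_map, List.getElem_range]
  exact congrArg c.edge (add_comm _ _)

lemma isPath_segment (c : T.Line) (i : ℤ) (n : ℕ) :
    T.IsPath (T.o (c.edge i)) (c.segment i n) (T.o (c.edge (i + n))) := by
  have h := (c.shift i).forward.isPath_take n
  change T.IsPath (T.o (c.edge ((0 : ℕ) + i))) _ (T.o (c.edge (n + i))) at h
  rwa [Nat.cast_zero, zero_add, add_comm] at h

lemma isReduced_segment (c : T.Line) (i : ℤ) (n : ℕ) : T.IsReduced (c.segment i n) :=
  Ray.isReduced_take _ _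

lemma segment_succ (c : T.Line) (i : ℤ) (n : ℕ) :
    c.segment i (n + 1) = c.edge i :: c.segment (i + 1) n := by
  refine List.ext_getElem (by simp [length_segment]) fun j h1 h2 => ?_
  cases j with
  | zero => simp [getElem_segment]
  | succ j =>
    rw [getElem_segment, List.getElem_cons_succ, getElem_segment]
    exact congrArg c.edge (by push_cast; ring)

lemma segment_succ' (c : T.Line) (i : ℤ) (n : ℕ) :
    c.segment i (n + 1) = c.segment i n ++ [c.edge (i + n)] := by
  rw [segment, Ray.take, List.range_succ, List.map_append]
  exact congrArg (fun k => _ ++ [c.edge k]) (add_comm _ _)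

end Line

/-- The cylinder of a segment of a line in terms of the shadows of its extremal edges. -/
lemma Line.mem_cyl_segment (c : T.Line) (i : ℤ) (n : ℕ) {P : T.Boundary2} :
    P ∈ T.cyl (c.segment i (n + 1)) ↔
      P.1.1 ∈ T.shadow (T.inv (c.edge i)) ∧ P.1.2 ∈ T.shadow (c.edge (i + n)) := by
  have h1 := c.isPath_segment i (n + 1)
  have h2 := c.isReduced_segment i (n + 1)
  have h3 : (c.segment i (n + 1)).getLast (by simp [c.segment_succ]) = c.edge (i + n) := by
    rw [List.getLast_congr _ _ (c.segment_succ' i n), List.getLast_append_singleton]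
    simp
  simp only [c.segment_succ] at h1 h2 h3 ⊢
  rw [mem_cyl_iff h1 h2, h3]

/-- Nonempty reduced paths. -/
def IsGeodesic (T : OrGraph V E) (l : List E) : Prop :=
  l ≠ [] ∧ T.IsReduced l ∧ ∃ v w, T.IsPath v l w

lemma Line.isGeodesic_segment (c : T.Line) (i : ℤ) (n : ℕ) : T.IsGeodesic (c.segment i (n + 1)) :=
  ⟨by simp [c.segment_succ], c.isReduced_segment _ _, _, _, c.isPath_segment _ _⟩

/-- If a pair of ends lies in the cylinder of a path, the path is a segment of the line between
them. -/
lemma IsTree.exists_segment (hT : T.IsTree) {c : T.Line} {P : T.Boundary2}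
    (hb : c.backward.toEnd = P.1.1) (hf : c.forward.toEnd = P.1.2)
    {l : List E} (hl : l ≠ []) (h : P ∈ T.cyl l) :
    ∃ (i : ℤ) (n : ℕ), l = c.segment i (n + 1) := by
  obtain ⟨i, hi⟩ := (hT.mem_cyl_iff_of_line hb hf).1 h
  have h0 : l.length - 1 + 1 = l.length := Nat.succ_pred_eq_of_pos (List.length_pos_of_ne_nil hl)
  refine ⟨i, l.length - 1, List.ext_getElem (by rw [Line.length_segment, h0]) fun j h1 h2 => ?_⟩
  rw [Line.getElem_segment, hi j h1]

/-- If the cylinders of two nonempty paths in a tree meet, their intersection is the cylinder of the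
hull of the two paths. -/
lemma IsTree.exists_cyl_eq_inter (hT : T.IsTree) {l m : List E} (hl : l ≠ [])
    (hm : m ≠ []) (h : (T.cyl l ∩ T.cyl m).Nonempty) :
    ∃ n, T.IsGeodesic n ∧ T.cyl n = T.cyl l ∩ T.cyl m := by
  obtain ⟨P, h1, h2⟩ := h
  obtain ⟨c, hb, hf⟩ := hT.exists_line P.2
  obtain ⟨i, p, rfl⟩ := hT.exists_segment hb hf hl h1
  obtain ⟨j, q, rfl⟩ := hT.exists_segment hb hf hm h2
  have h3 : min i j + (max (i + p) (j + q) - min i j).toNat = max (i + p) (j + q) := by omega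
  refine ⟨c.segment (min i j) ((max (i + p) (j + q) - min i j).toNat + 1),
    c.isGeodesic_segment _ _, Set.ext fun Q => ?_⟩
  rw [Set.mem_inter_iff, Line.mem_cyl_segment, Line.mem_cyl_segment, Line.mem_cyl_segment, h3]
  have h4 : T.shadow (T.inv (c.edge (min i j))) =
      T.shadow (T.inv (c.edge i)) ∩ T.shadow (T.inv (c.edge j)) := by
    rcases le_total i j with h | h
    · rw [min_eq_left h, Set.inter_eq_left.2 (c.monotone_shadow_inv h)]
    · rw [min_eq_right h, Set.inter_eq_right.2 (c.monotone_shadow_inv h)]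
  have h5 : T.shadow (c.edge (max (i + p) (j + q))) =
      T.shadow (c.edge (i + p)) ∩ T.shadow (c.edge (j + q)) := by
    rcases le_total (i + p : ℤ) (j + q) with h | h
    · rw [max_eq_right h, Set.inter_eq_right.2 (c.antitone_shadow h)]
    · rw [max_eq_left h, Set.inter_eq_left.2 (c.antitone_shadow h)]
  rw [h4, h5]
  exact and_and_and_comm

end RaysAndLines
end OrGraph

namespace OrGraph

/-! ### The topology of the boundary -/

section Topology

variable {V E : Type*} {T : OrGraph V E}

lemma isOpen_shadow (e : E) : IsOpen (T.shadow e) :=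
  TopologicalSpace.isOpen_generateFrom_of_mem ⟨e, rfl⟩

variable (T) in
lemma isTopologicalBasis_shadow :
    TopologicalSpace.IsTopologicalBasis (Set.range T.shadow) where
  exists_subset_inter := by
    rintro _ ⟨a, rfl⟩ _ ⟨b, rfl⟩ x ⟨ha, hb⟩
    obtain ⟨r, rfl⟩ := exists_toEnd x
    obtain ⟨m, hm⟩ := r.exists_shadow_subset ha
    obtain ⟨n, hn⟩ := r.exists_shadow_subset hb
    exact ⟨_, ⟨r.edge (max m n), rfl⟩, r.toEnd_mem_shadow _,
      Set.subset_inter (hm _ (le_max_left _ _)) (hn _ (le_max_right _ _))⟩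
  sUnion_eq := Set.eq_univ_of_forall fun x => by
    obtain ⟨r, rfl⟩ := exists_toEnd x
    exact ⟨_, ⟨r.edge 0, rfl⟩, r.toEnd_mem_shadow 0⟩
  eq_generateFrom := rfl

lemma IsTree.isClosed_shadow (hT : T.IsTree) (e : E) : IsClosed (T.shadow e) :=
  ⟨by rw [hT.compl_shadow]; exact isOpen_shadow _⟩

lemma IsTree.t2Space (hT : T.IsTree) : T2Space T.Boundary where
  t2 x y h := by
    obtain ⟨c, rfl, rfl⟩ := hT.exists_line h
    exact ⟨_, _, isOpen_shadow _, isOpen_shadow _, c.backward_mem_shadow 0,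
      c.forward_mem_shadow 0, (hT.disjoint_shadow_inv _).symm⟩

lemma IsGeodesic.isOpen_cyl {l : List E} (hl : T.IsGeodesic l) : IsOpen (T.cyl l) := by
  obtain ⟨h1, h2, v, w, h3⟩ := hl
  cases l with
  | nil => exact absurd rfl h1
  | cons e l =>
    have : T.cyl (e :: l) = (fun P : T.Boundary2 => P.1.1) ⁻¹' T.shadow (T.inv e) ∩
        (fun P : T.Boundary2 => P.1.2) ⁻¹' T.shadow ((e :: l).getLast h1) :=
      Set.ext fun P => mem_cyl_iff h3 h2
    rw [this]
    exact ((isOpen_shadow _).preimage (continuous_fst.comp continuous_subtype_val)).inter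
      ((isOpen_shadow _).preimage (continuous_snd.comp continuous_subtype_val))

lemma IsTree.isCompact_cyl (hT : T.IsTree) [CompactSpace T.Boundary] {l : List E}
    (hl : T.IsGeodesic l) : IsCompact (T.cyl l) := by
  obtain ⟨h1, h2, v, w, h3⟩ := hl
  cases l with
  | nil => exact absurd rfl h1
  | cons e l =>
    have h4 : T.shadow ((e :: l).getLast h1) ⊆ T.shadow e := by
      intro x hx
      obtain ⟨r, rfl, h5⟩ := exists_ray_of_isReduced h3 h2 hx
      have h6 := h5 0 (by simp)
      rw [List.getElem_cons_zero] at h6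
      exact h6 ▸ r.toEnd_mem_shadow 0
    have : Subtype.val '' T.cyl (e :: l) =
        T.shadow (T.inv e) ×ˢ T.shadow ((e :: l).getLast h1) := by
      ext ⟨x, y⟩
      constructor
      · rintro ⟨P, hP, h5⟩
        rw [← h5]
        exact (mem_cyl_iff h3 h2).1 hP
      · rintro ⟨hx, hy⟩
        refine ⟨⟨(x, y), ?_⟩, (mem_cyl_iff h3 h2).2 ⟨hx, hy⟩, rfl⟩
        intro h
        exact Set.disjoint_left.1 (hT.disjoint_shadow_inv e) (h4 hy) (h ▸ hx)
    have hc := (hT.isClosed_shadow (T.inv e)).isCompact.prod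
      (hT.isClosed_shadow ((e :: l).getLast h1)).isCompact
    exact Topology.IsInducing.subtypeVal.isCompact_iff.2 (this ▸ hc)

variable (T) in
/-- The cylinders of nonempty reduced paths. -/
def cylinders : Set (Set T.Boundary2) := T.cyl '' {l | T.IsGeodesic l}

lemma IsTree.isTopologicalBasis_cylinders (hT : T.IsTree) :
    TopologicalSpace.IsTopologicalBasis T.cylinders := by
  refine TopologicalSpace.isTopologicalBasis_of_isOpen_of_nhds ?_ fun P U hP hU => ?_
  · rintro _ ⟨l, hl, rfl⟩
    exact hl.isOpen_cyl
  · obtain ⟨W, hW, rfl⟩ := isOpen_induced_iff.1 hU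
    obtain ⟨_, ⟨_, ⟨a, rfl⟩, _, ⟨b, rfl⟩, rfl⟩, ⟨hPa, hPb⟩, hab⟩ :=
      (T.isTopologicalBasis_shadow.prod T.isTopologicalBasis_shadow).exists_subset_of_mem_open
        hP hW
    obtain ⟨c, hb, hf⟩ := hT.exists_line P.2
    obtain ⟨m, hm⟩ := c.backward.exists_shadow_subset (a := a) (hb ▸ hPa)
    obtain ⟨n, hn⟩ := c.forward.exists_shadow_subset (a := b) (hf ▸ hPb)
    have h1 : -1 - (m : ℤ) + (m + 1 + n : ℕ) = n := by push_cast; ring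
    refine ⟨_, ⟨_, c.isGeodesic_segment (-1 - m) (m + 1 + n), rfl⟩, ?_, fun Q hQ => hab ?_⟩
    · rw [Line.mem_cyl_segment, ← hb, ← hf]
      exact ⟨c.backward_mem_shadow _, c.forward_mem_shadow _⟩
    · rw [Line.mem_cyl_segment, h1] at hQ
      exact ⟨hm m le_rfl hQ.1, hn n le_rfl hQ.2⟩

lemma IsTree.isPiSystem_cylinders (hT : T.IsTree) : IsPiSystem T.cylinders := by
  rintro _ ⟨l, hl, rfl⟩ _ ⟨m, hm, rfl⟩ h
  obtain ⟨n, hn, h'⟩ := hT.exists_cyl_eq_inter hl.1 hm.1 h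
  exact ⟨n, hn, h'⟩

lemma countable_cylinders [Countable E] : T.cylinders.Countable :=
  (Set.to_countable _).image _

/-- A pair of ends whose line runs through `l` also runs through one of the edges by which the
reduced path `l` can be continued. -/
lemma IsTree.cyl_eq_iUnion (hT : T.IsTree) {l : List E} (hl : l ≠ []) :
    T.cyl l = ⋃ f ∈ {f | T.t (l.getLast hl) = T.o f ∧ f ≠ T.inv (l.getLast hl)},
      T.cyl (l ++ [f]) := by
  ext P
  simp only [Set.mem_iUnion]
  obtain ⟨c, hb, hf⟩ := hT.exists_line P.2
  constructor
  · intro h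
    obtain ⟨i, n, rfl⟩ := hT.exists_segment hb hf hl h
    have h3 : (c.segment i (n + 1)).getLast hl = c.edge (i + n) := by
      rw [List.getLast_congr _ _ (c.segment_succ' i n), List.getLast_append_singleton]
      simp
    refine ⟨c.edge (i + (n + 1 : ℕ)), ?_, ?_⟩
    · rw [h3, Nat.cast_add, Nat.cast_one, ← add_assoc]
      exact c.isReduced (i + n)
    · rw [← Line.segment_succ', hT.mem_cyl_iff_of_line hb hf]
      exact ⟨i, fun j h => (c.getElem_segment _ _ _ h).symm⟩
  · rintro ⟨f, -, d, h1, h2, i, h3⟩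
    refine ⟨d, h1, h2, i, fun j h => ?_⟩
    rw [h3 j (by simp; omega), List.getElem_append_left]

lemma IsTree.disjoint_cyl_append (hT : T.IsTree) {l : List E} (hl : l ≠ []) {f g : E}
    (h : f ≠ g) : Disjoint (T.cyl (l ++ [f])) (T.cyl (l ++ [g])) := by
  rw [Set.disjoint_left]
  intro P hP hQ
  obtain ⟨c, hb, hf⟩ := hT.exists_line P.2
  obtain ⟨i, hi⟩ := (hT.mem_cyl_iff_of_line hb hf).1 hP
  obtain ⟨j, hj⟩ := (hT.mem_cyl_iff_of_line hb hf).1 hQ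
  have h0 := List.length_pos_of_ne_nil hl
  have h1 := hi 0 (by simp)
  have h2 := hj 0 (by simp)
  rw [List.getElem_append_left h0] at h1 h2
  have h3 := hT.line_edge_injective c (h1.trans h2.symm)
  simp only [Nat.cast_zero, add_zero] at h3
  have h4 := hi l.length (by simp)
  have h5 := hj l.length (by simp)
  rw [h3, h5] at h4
  exact h (by simpa using h4.symm)

lemma flip_preimage_cyl (l : List E) :
    flip ⁻¹' T.cyl l = T.cyl (T.invPath l) := by
  have key : ∀ {l : List E} {P : T.Boundary2}, flip P ∈ T.cyl l → P ∈ T.cyl (T.invPath l) := by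
    rintro l P ⟨c, h1, h2, i, h3⟩
    refine ⟨c.reverse, by rwa [c.backward_reverse], by rwa [c.forward_reverse], -i - l.length,
      fun j h => ?_⟩
    have h4 : j < l.length := by simpa [invPath] using h
    simp only [invPath, List.getElem_reverse, List.getElem_map, List.length_map]
    rw [← h3 (l.length - 1 - j) (by omega)]
    exact congrArg (fun i => T.inv (c.edge i)) (by omega)
  ext P
  refine ⟨key, fun h => ?_⟩
  have h1 : T.invPath (T.invPath l) = l := by
    simp [invPath, Function.comp_def, T.inv_inv]
  have h2 := key (l := T.invPath l) (P := flip P) h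
  rwa [h1] at h2

end Topology

section Cover

variable {V E : Type*} {Γ : OrGraph V E} {x₀ : V}

instance [Countable E] : Countable Γ.EdgeGroup :=
  have : Countable (FreeGroup E) := Quot.mk_surjective.countable
  (PresentedGroup.mk_surjective _).countable

instance [Countable V] [Countable E] : Countable (Γ.CoverVertex x₀) :=
  Function.Injective.countable (f := fun p : Γ.CoverVertex x₀ => (p.cls, p.term))
    fun _ _ h => CoverVertex.ext (congrArg Prod.fst h) (congrArg Prod.snd h)

instance [Countable V] [Countable E] : Countable (Γ.CoverEdge x₀) :=
  Function.Injective.countable (f := fun q : Γ.CoverEdge x₀ => (q.start, q.proj))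
    fun _ _ h => CoverEdge.ext (congrArg Prod.fst h) (congrArg Prod.snd h)

/-- The lift of a ray of `Γ` to the universal cover with a given initial vertex. -/
def Ray.lift (r : Γ.Ray) (p : Γ.CoverVertex x₀) (h : Γ.o (r.edge 0) = p.term) :
    (Γ.cover x₀).Ray where
  edge n :=
    { start :=
        { cls := p.cls * Γ.word (r.take n)
          term := Γ.o (r.edge n)
          exists_path := by
            obtain ⟨l, hl, hw⟩ := p.exists_path
            refine ⟨l ++ r.take n, Γ.isPath_append hl ?_, by rw [word_append, hw]⟩
            rw [← h]
            exact r.isPath_take n }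
      proj := r.edge n
      o_proj := rfl }
  isReduced n := by
    refine ⟨CoverVertex.ext ?_ (r.isReduced n).1,
      fun h' => (r.isReduced n).2 (congrArg CoverEdge.proj h')⟩
    change p.cls * Γ.word (r.take n) * Γ.gen (r.edge n) = p.cls * Γ.word (r.take (n + 1))
    have : r.take (n + 1) = r.take n ++ [r.edge n] := by simp [Ray.take, List.range_succ]
    rw [this, word_append, word_singleton, mul_assoc]

/-- The projection of a ray of the universal cover. -/
def Ray.proj (r : (Γ.cover x₀).Ray) : Γ.Ray where
  edge n := (r.edge n).proj
  isReduced n := by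
    have h : (r.edge n).finish = (r.edge (n + 1)).start := (r.isReduced n).1
    refine ⟨?_, fun h' => (r.isReduced n).2 (CoverEdge.ext h.symm h')⟩
    rw [(r.edge (n + 1)).o_proj, ← h]
    rfl

/-- The boundary of the universal cover is compact: it is the image of the space of reduced rays
of the finite graph `Γ` based at `x₀`, a closed subset of `E ^ ℕ`. -/
instance compactSpace_boundary_cover [Finite E] : CompactSpace (Γ.cover x₀).Boundary := by
  let _ : TopologicalSpace E := ⊥
  have : DiscreteTopology E := ⟨rfl⟩
  let K : Set (ℕ → E) := {f | Γ.o (f 0) = x₀ ∧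
    ∀ n, Γ.t (f n) = Γ.o (f (n + 1)) ∧ f (n + 1) ≠ Γ.inv (f n)}
  have hK : IsClosed K := by
    have h1 : ∀ (n : ℕ) (s : E → E → Prop), IsClosed {f : ℕ → E | s (f n) (f (n + 1))} := by
      intro n s
      have hc : Continuous fun f : ℕ → E => (f n, f (n + 1)) :=
        (continuous_apply n).prodMk (continuous_apply (n + 1))
      exact (isClosed_discrete {p : E × E | s p.1 p.2}).preimage hc
    have h2 : K = {f : ℕ → E | Γ.o (f 0) = x₀} ∩ ⋂ n, {f : ℕ → E | Γ.t (f n) = Γ.o (f (n + 1)) ∧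
        f (n + 1) ≠ Γ.inv (f n)} := by
      ext f; simp [K]
    rw [h2]
    exact (h1 0 fun a _ => Γ.o a = x₀).inter
      (isClosed_iInter fun n => h1 n fun a b => Γ.t a = Γ.o b ∧ b ≠ Γ.inv a)
  have : CompactSpace K := isCompact_iff_compactSpace.1 hK.isCompact
  let φ : K → (Γ.cover x₀).Boundary := fun f =>
    (Ray.lift ⟨f.1, f.2.2⟩ (Γ.coverBase x₀) f.2.1).toEnd
  have hφ : Continuous φ := by
    refine (isTopologicalBasis_shadow _).continuous_iff.2 ?_
    rintro _ ⟨a, rfl⟩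
    rw [isOpen_iff_forall_mem_open]
    intro f hf
    obtain ⟨m, hm⟩ := Ray.exists_shadow_subset _ hf
    refine ⟨{g | ∀ n ∈ Finset.range (m + 1), g.1 n = f.1 n}, fun g hg => ?_, ?_, fun n _ => rfl⟩
    · refine hm m le_rfl ?_
      have h1 : (Ray.lift ⟨g.1, g.2.2⟩ (Γ.coverBase x₀) g.2.1).edge m =
          (Ray.lift ⟨f.1, f.2.2⟩ (Γ.coverBase x₀) f.2.1).edge m := by
        have h2 : (Ray.take ⟨g.1, g.2.2⟩ m : List E) = Ray.take (T := Γ) ⟨f.1, f.2.2⟩ m :=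
          List.map_congr_left fun n hn => hg n (by simp at hn ⊢; omega)
        have h3 := hg m (by simp)
        refine CoverEdge.ext (CoverVertex.ext ?_ ?_) h3
        · exact congrArg (fun l => _ * Γ.word l) h2
        · exact congrArg Γ.o h3
      rw [← h1]
      exact Ray.toEnd_mem_shadow _ m
    · have hc : ∀ n, Continuous fun g : K => g.1 n := fun n =>
        (continuous_apply n).comp continuous_subtype_val
      simp only [Set.ofPred_forall]
      exact isOpen_biInter_finset fun n _ => (isOpen_discrete {f.1 n}).preimage
        (hc n)
  have hsurj : Function.Surjective φ := by
    intro x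
    obtain ⟨r, h1, rfl⟩ := (cover_isTree Γ x₀).connected.exists_ray (Γ.coverBase x₀) x
    have h0 : Γ.o (r.proj.edge 0) = x₀ := (r.edge 0).o_proj.trans (congrArg CoverVertex.term h1)
    refine ⟨⟨r.proj.edge, h0, r.proj.isReduced⟩, congrArg Ray.toEnd ?_⟩
    refine Ray.ext (funext fun n => ?_)
    induction n with
    | zero =>
      refine CoverEdge.ext (Eq.trans ?_ h1.symm) rfl
      exact CoverVertex.ext (by simp [Ray.lift, Ray.take, word]) h0
    | succ n ih =>
      refine CoverEdge.ext ?_ rfl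
      have h2 := (Ray.isReduced r n).1
      rw [← ih] at h2
      exact ((Ray.isReduced (Ray.lift _ _ _) n).1.symm.trans h2)
  exact hsurj.compactSpace hφ

instance : T2Space (Γ.cover x₀).Boundary := (cover_isTree Γ x₀).t2Space

instance [Finite E] : LocallyCompactSpace (Γ.cover x₀).Boundary2 := by
  have : IsOpen {P : (Γ.cover x₀).Boundary × (Γ.cover x₀).Boundary | P.1 ≠ P.2} :=
    isOpen_ne_fun continuous_fst continuous_snd
  exact this.locallyCompactSpace

end Cover

end OrGraph

/-! ### Limits of measures that converge on a basis of compact open sets -/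

section Limits

open MeasureTheory Filter Topology CompactlySupported

variable {X : Type*} [TopologicalSpace X]

/-- The indicator function of a compact open set as a continuous function with compact support. -/
noncomputable def IsCompact.indicatorCc [T2Space X] {A : Set X} (hA : IsCompact A)
    (hA' : IsOpen A) : C_c(X, ℝ) where
  toFun := A.indicator 1
  continuous_toFun := (LocallyConstant.charFn ℝ ⟨hA.isClosed, hA'⟩).continuous
  hasCompactSupport' := HasCompactSupport.intro hA fun _ hx => Set.indicator_of_notMem hx _

variable [MeasurableSpace X] [BorelSpace X]

lemma IsCompact.integral_indicatorCc [T2Space X] {A : Set X} (hA : IsCompact A) (hA' : IsOpen A)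
    (μ : Measure X) : ∫ x, hA.indicatorCc hA' x ∂μ = μ.real A :=
  integral_indicator_one hA'.measurableSet

variable {𝓑 : Set (Set X)} {μ : ℕ → Measure X} [∀ k, IsFiniteMeasureOnCompacts (μ k)]

/-- If the values of a sequence of measures on the members of a `π`-system of compact open sets
are eventually constant, then so are the values on finite unions of such sets, by
inclusion–exclusion. -/
lemma exists_eventually_measureReal_sUnion (hpi : IsPiSystem 𝓑)
    (hc : ∀ B ∈ 𝓑, IsCompact B ∧ IsOpen B)
    (hW : ∀ B ∈ 𝓑, ∃ w : ℝ, ∀ᶠ k in atTop, (μ k).real B = w) (L : List (Set X))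
    (hL : ∀ B ∈ L, B ∈ 𝓑 ∨ B = ∅) :
    ∃ w : ℝ, ∀ᶠ k in atTop, (μ k).real (L.foldr (· ∪ ·) ∅) = w := by
  have hc' : ∀ L : List (Set X), (∀ B ∈ L, B ∈ 𝓑 ∨ B = ∅) →
      IsCompact (L.foldr (· ∪ ·) ∅) ∧ MeasurableSet (L.foldr (· ∪ ·) ∅) := by
    intro L hL
    induction L with
    | nil => exact ⟨isCompact_empty, .empty⟩
    | cons B L ih =>
      obtain ⟨h1, h2⟩ := ih fun B hB => hL B (List.mem_cons_of_mem _ hB)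
      rcases hL B List.mem_cons_self with hB | rfl
      · exact ⟨(hc B hB).1.union h1, (hc B hB).2.measurableSet.union h2⟩
      · exact ⟨isCompact_empty.union h1, MeasurableSet.empty.union h2⟩
  induction hn : L.length generalizing L with
  | zero => exact ⟨0, by simp [List.length_eq_zero_iff.1 hn]⟩
  | succ n ih =>
    cases L with
    | nil => simp at hn
    | cons B L =>
      have hn : L.length = n := by simpa using hn
      have hL' : ∀ A ∈ L, A ∈ 𝓑 ∨ A = ∅ := fun A hA => hL A (List.mem_cons_of_mem _ hA)
      obtain ⟨w, hw⟩ := ih L hL' hn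
      rcases hL B List.mem_cons_self with hB | rfl
      · have h1 : ∀ A ∈ L.map (B ∩ ·), A ∈ 𝓑 ∨ A = ∅ := by
          intro A hA
          obtain ⟨A, hAL, rfl⟩ := List.mem_map.1 hA
          rcases hL' A hAL with hA | rfl
          · rcases (B ∩ A).eq_empty_or_nonempty with h | h
            · exact .inr h
            · exact .inl (hpi B hB A hA h)
          · exact .inr (Set.inter_empty B)
        have h2 : B ∩ L.foldr (· ∪ ·) ∅ = (L.map (B ∩ ·)).foldr (· ∪ ·) ∅ := by
          clear * -
          induction L with
          | nil => simp
          | cons A L ih =>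
            simp only [List.foldr_cons, List.map_cons, ← ih, Set.inter_union_distrib_left]
        obtain ⟨w', hw'⟩ := ih _ h1 (by simpa using hn)
        obtain ⟨w'', hw''⟩ := hW B hB
        refine ⟨w'' + w - w', ?_⟩
        filter_upwards [hw, hw', hw''] with k hk hk' hk''
        have h3 := measureReal_union_add_inter₀' (μ := μ k) (s := B)
          (hc B hB).2.measurableSet.nullMeasurableSet
          (t := L.foldr (· ∪ ·) ∅)
          (hc B hB).1.measure_lt_top.ne (hc' L hL').1.measure_lt_top.ne
        rw [h2, hk, hk', hk''] at h3
        rw [List.foldr_cons]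
        linarith
      · exact ⟨w, by simpa using hw⟩

/-- The values of the measures on every compact open set are eventually constant. -/
lemma exists_eventually_measureReal (hb : TopologicalSpace.IsTopologicalBasis 𝓑)
    (hpi : IsPiSystem 𝓑) (hc : ∀ B ∈ 𝓑, IsCompact B)
    (hW : ∀ B ∈ 𝓑, ∃ w : ℝ, ∀ᶠ k in atTop, (μ k).real B = w) {A : Set X} (hA : IsCompact A)
    (hA' : IsOpen A) : ∃ w : ℝ, ∀ᶠ k in atTop, (μ k).real A = w := by
  obtain ⟨s, rfl⟩ := eq_sUnion_finset_of_isTopologicalBasis_of_isCompact_open 𝓑 hb A hA hA'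
  obtain ⟨w, hw⟩ := exists_eventually_measureReal_sUnion hpi
    (fun B hB => ⟨hc B hB, hb.isOpen hB⟩) hW (s.toList.map Subtype.val) (by
      intro B hB
      obtain ⟨B, -, rfl⟩ := List.mem_map.1 hB
      exact .inl B.2)
  refine ⟨w, ?_⟩
  have : ∀ L : List 𝓑, (L.map Subtype.val).foldr (· ∪ ·) ∅ = {x | ∃ B ∈ L, x ∈ B.1} := by
    intro L
    induction L with
    | nil => simp
    | cons B L ih => rw [List.map_cons, List.foldr_cons, ih]; ext; simp
  have h : ⋃₀ (Subtype.val '' (s : Set 𝓑)) = (s.toList.map Subtype.val).foldr (· ∪ ·) ∅ := by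
    rw [this]
    ext
    simp
  rwa [h]

variable [T2Space X]

/-- A continuous function with compact support is a uniform limit of step functions, whose
integrals are eventually constant. -/
lemma exists_step_function (hb : TopologicalSpace.IsTopologicalBasis 𝓑)
    (hc : ∀ B ∈ 𝓑, IsCompact B)
    (hW : ∀ A : Set X, IsCompact A → IsOpen A → ∃ w : ℝ, ∀ᶠ k in atTop, (μ k).real A = w)
    (f : C_c(X, ℝ)) {U : Set X} (hU' : IsOpen U) (hfU : tsupport f ⊆ U)
    {ε : ℝ} (hε : 0 < ε) :
    ∃ s : X → ℝ, (∀ k, Integrable s (μ k)) ∧ (∃ w, ∀ᶠ k in atTop, ∫ x, s x ∂μ k = w) ∧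
      ∀ x, |f x - s x| ≤ U.indicator (fun _ => ε) x := by
  have h1 : ∀ x : X, x ∈ tsupport f → ∃ B, IsCompact B ∧ IsOpen B ∧ x ∈ B ∧ B ⊆ U ∧
      ∀ y ∈ B, |f y - f x| ≤ ε := by
    intro x hx
    have h2 : IsOpen (U ∩ f ⁻¹' Metric.ball (f x) ε) :=
      hU'.inter (Metric.isOpen_ball.preimage f.continuous)
    obtain ⟨B, hB, hxB, hBU⟩ := hb.exists_subset_of_mem_open
      (⟨hfU hx, Metric.mem_ball_self hε⟩ : x ∈ U ∩ f ⁻¹' Metric.ball (f x) ε) h2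
    refine ⟨B, hc B hB, hb.isOpen hB, hxB, fun y hy => (hBU hy).1, fun y hy => ?_⟩
    exact (Metric.mem_ball.1 (hBU hy).2).le
  choose! B hB1 hB2 hB3 hB4 hB5 using h1
  obtain ⟨t, ht, htU⟩ := f.hasCompactSupport.isCompact.elim_nhds_subcover B
    fun x hx => (hB2 x hx).mem_nhds (hB3 x hx)
  -- Approximate `f` on the union of the first few members of the cover.
  have key : ∀ u : Finset X, (∀ x ∈ u, x ∈ tsupport f) →
      IsCompact (⋃ x ∈ u, B x) ∧ IsOpen (⋃ x ∈ u, B x) ∧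
      ∃ s : X → ℝ, (∀ k, Integrable s (μ k)) ∧ (∃ w, ∀ᶠ k in atTop, ∫ x, s x ∂μ k = w) ∧
        (∀ x ∈ ⋃ x ∈ u, B x, |f x - s x| ≤ ε) ∧ ∀ x ∉ ⋃ x ∈ u, B x, s x = 0 := by
    classical
    intro u
    induction u using Finset.induction_on with
    | empty => exact fun _ => ⟨by simp, by simp, 0, by simp, ⟨0, by simp⟩, by simp, by simp⟩
    | insert a u ha ih =>
      intro hu
      obtain ⟨h2, h3, s, h4, ⟨w, h5⟩, h6, h7⟩ := ih fun x hx => hu x (Finset.mem_insert_of_mem hx)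
      have hta := hu a (Finset.mem_insert_self _ _)
      rw [Finset.set_biUnion_insert]
      set D := ⋃ x ∈ u, B x
      have h8 : IsCompact (B a \ D) := (hB1 a hta).diff h3
      have h9 : IsOpen (B a \ D) := (hB2 a hta).sdiff h2.isClosed
      obtain ⟨w', hw'⟩ := hW _ h8 h9
      have h10 : ∀ k, Integrable ((B a \ D).indicator fun _ => f a) (μ k) := fun k =>
        (integrable_indicator_iff h9.measurableSet).2
          (integrableOn_const h8.measure_lt_top.ne)
      refine ⟨(hB1 a hta).union h2, (hB2 a hta).union h3,
        (B a \ D).indicator (fun _ => f a) + s, fun k => (h10 k).add (h4 k),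
        ⟨w' * f a + w, ?_⟩, fun x hx => ?_, fun x hx => ?_⟩
      · filter_upwards [h5, hw'] with k hk hk'
        rw [integral_add' (h10 k) (h4 k), hk, integral_indicator h9.measurableSet,
          setIntegral_const, hk', smul_eq_mul]
      · by_cases hxD : x ∈ D
        · rw [Pi.add_apply, Set.indicator_of_notMem (fun h => h.2 hxD), zero_add]
          exact h6 x hxD
        · have hxa := hx.resolve_right hxD
          rw [Pi.add_apply, Set.indicator_of_mem (show x ∈ B a \ D from ⟨hxa, hxD⟩),
            h7 x hxD, add_zero]
          exact hB5 a hta x hxa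
      · rw [Pi.add_apply, Set.indicator_of_notMem (fun h => hx (.inl h.1)),
          h7 x fun h => hx (.inr h), add_zero]
  obtain ⟨-, -, s, h4, h5, h6, h7⟩ := key t ht
  refine ⟨s, h4, h5, fun x => ?_⟩
  by_cases hx : x ∈ ⋃ x ∈ t, B x
  · have hxU : x ∈ U := by
      obtain ⟨y, hy, hxy⟩ := Set.mem_iUnion₂.1 hx
      exact hB4 y (ht y hy) hxy
    rw [Set.indicator_of_mem hxU]
    exact h6 x hx
  · rw [h7 x hx, image_eq_zero_of_notMem_tsupport fun h => hx (htU h), sub_zero, abs_zero]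
    exact Set.indicator_nonneg (fun _ _ => hε.le) x

/-- The integrals of a continuous function with compact support converge. -/
lemma exists_tendsto_integral (hb : TopologicalSpace.IsTopologicalBasis 𝓑)
    (hpi : IsPiSystem 𝓑) (hc : ∀ B ∈ 𝓑, IsCompact B)
    (hW : ∀ B ∈ 𝓑, ∃ w : ℝ, ∀ᶠ k in atTop, (μ k).real B = w) (f : C_c(X, ℝ)) :
    ∃ a, Tendsto (fun k => ∫ x, f x ∂μ k) atTop (𝓝 a) := by
  have hW' : ∀ A : Set X, IsCompact A → IsOpen A → ∃ w : ℝ, ∀ᶠ k in atTop, (μ k).real A = w :=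
    fun A hA hA' => exists_eventually_measureReal hb hpi hc hW hA hA'
  obtain ⟨U, hU, hU', hfU⟩ : ∃ U, IsCompact U ∧ IsOpen U ∧ tsupport f ⊆ U := by
    have h1 : ∀ x : X, ∃ B ∈ 𝓑, x ∈ B := fun x => by
      obtain ⟨B, hB, hx, -⟩ := hb.exists_subset_of_mem_open (Set.mem_univ x) isOpen_univ
      exact ⟨B, hB, hx⟩
    choose B hB hxB using h1
    obtain ⟨t, -, ht⟩ := f.hasCompactSupport.isCompact.elim_nhds_subcover B
      fun x _ => (hb.isOpen (hB x)).mem_nhds (hxB x)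
    exact ⟨_, t.isCompact_biUnion fun x _ => hc _ (hB x),
      isOpen_biUnion fun x _ => hb.isOpen (hB x), ht⟩
  obtain ⟨M, hM⟩ := hW' U hU hU'
  have hM0 : 0 ≤ M := by
    obtain ⟨k, hk⟩ := hM.exists
    exact hk ▸ measureReal_nonneg
  refine cauchySeq_tendsto_of_complete (Metric.cauchySeq_iff'.2 fun δ hδ => ?_)
  obtain ⟨s, h1, ⟨w, h2⟩, h3⟩ := exists_step_function hb hc hW' f hU' hfU
    (show 0 < δ / (4 * (M + 1)) by positivity)
  have h4 : ∀ᶠ k in atTop, |∫ x, f x ∂μ k - w| ≤ δ / 4 := by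
    filter_upwards [h2, hM] with k hk hk'
    rw [← hk, ← integral_sub f.integrable (h1 k)]
    calc |∫ x, (f x - s x) ∂μ k| ≤ ∫ x, |f x - s x| ∂μ k := abs_integral_le_integral_abs
      _ ≤ ∫ x, U.indicator (fun _ => δ / (4 * (M + 1))) x ∂μ k :=
        integral_mono (f.integrable.sub (h1 k)).abs
          ((integrable_indicator_iff hU'.measurableSet).2
            (integrableOn_const hU.measure_lt_top.ne)) h3
      _ = M * (δ / (4 * (M + 1))) := by
        rw [integral_indicator hU'.measurableSet, setIntegral_const, hk', smul_eq_mul]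
      _ ≤ δ / 4 := by
        rw [mul_div_assoc', div_le_div_iff₀ (by positivity) (by positivity)]
        nlinarith
  obtain ⟨n, hn⟩ := eventually_atTop.1 h4
  refine ⟨n, fun k hk => ?_⟩
  have h5 := abs_le.1 (hn k hk)
  have h6 := abs_le.1 (hn n le_rfl)
  rw [Real.dist_eq, abs_lt]
  constructor <;> linarith

/-- A sequence of measures that are finite on compact sets, and whose values on the members of a
basis of compact open sets that is a `π`-system are eventually constant, has a weak-* limit, and
the limit has the eventual values on the basis. -/
theorem exists_measure_tendsto_integral [LocallyCompactSpace X]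
    (hb : TopologicalSpace.IsTopologicalBasis 𝓑) (hpi : IsPiSystem 𝓑)
    (hc : ∀ B ∈ 𝓑, IsCompact B) 
    (hW : ∀ B ∈ 𝓑, ∃ w, ∀ᶠ k in atTop, μ k B = w) :
    ∃ ν : Measure X, IsFiniteMeasureOnCompacts ν ∧
      (∀ f : C_c(X, ℝ), Tendsto (fun k => ∫ x, f x ∂μ k) atTop (𝓝 (∫ x, f x ∂ν))) ∧
      ∀ B ∈ 𝓑, ∀ᶠ k in atTop, μ k B = ν B := by
  have hlim := exists_tendsto_integral (μ := μ) hb hpi hc fun B hB =>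
    (hW B hB).elim fun w hw => ⟨w.toReal, hw.mono fun k hk => congrArg ENNReal.toReal hk⟩
  choose L hL using hlim
  let Λ : C_c(X, ℝ) →ₗ[ℝ] ℝ :=
    { toFun := L
      map_add' := fun f g => by
        refine tendsto_nhds_unique (hL (f + g)) (((hL f).add (hL g)).congr fun k => ?_)
        exact (integral_add' f.integrable g.integrable).symm
      map_smul' := fun a f => by
        refine tendsto_nhds_unique (hL (a • f)) (((hL f).const_mul a).congr fun k => ?_)
        exact (integral_const_mul a _).symm }
  let Λ' : C_c(X, ℝ) →ₚ[ℝ] ℝ := PositiveLinearMap.mk₀ Λ fun f hf =>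
    ge_of_tendsto' (hL f) fun k => integral_nonneg hf
  have h1 : ∀ f : C_c(X, ℝ), Tendsto (fun k => ∫ x, f x ∂μ k) atTop
      (𝓝 (∫ x, f x ∂(RealRMK.rieszMeasure Λ'))) := fun f => by
    rw [RealRMK.integral_rieszMeasure]
    exact hL f
  refine ⟨RealRMK.rieszMeasure Λ', ⟨fun K hK => ?_⟩, h1, fun B hB => ?_⟩
  · exact IsCompact.measure_lt_top hK
  · have h2 := h1 ((hc B hB).indicatorCc (hb.isOpen hB))
    simp only [IsCompact.integral_indicatorCc] at h2
    obtain ⟨w, hw⟩ := hW B hB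
    have h3 : Tendsto (fun k => (μ k).real B) atTop (𝓝 w.toReal) :=
      tendsto_const_nhds.congr' (hw.mono fun k hk => (congrArg ENNReal.toReal hk).symm)
    have h4 := tendsto_nhds_unique h2 h3
    obtain ⟨k, hk⟩ := hw.exists
    have h5 : w ≠ ∞ := hk ▸ (hc B hB).measure_lt_top.ne
    rwa [(ENNReal.toReal_eq_toReal_iff' (hc B hB).measure_lt_top.ne h5).1 h4]

end Limits

namespace OrGraph

/-! ### The action of the fundamental group on cylinders -/

section Action

variable {V E : Type*} {Γ : OrGraph V E} {x₀ : V}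

lemma isReduced_invPath {T : OrGraph V E} {l : List E} (h : T.IsReduced l) :
    T.IsReduced (T.invPath l) := by
  rw [IsReduced, invPath, List.isChain_reverse, List.isChain_map]
  refine List.IsChain.imp (fun a b hab h' => hab ?_) h
  rw [h', T.inv_inv]

lemma IsGeodesic.invPath {T : OrGraph V E} {l : List E} (h : T.IsGeodesic l) :
    T.IsGeodesic (T.invPath l) := by
  obtain ⟨h1, h2, v, w, h3⟩ := h
  exact ⟨by simpa [OrGraph.invPath] using h1, isReduced_invPath h2, w, v, T.isPath_invPath h3⟩

/-- The action of the fundamental group on the lines of the universal cover. -/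
def Line.deck (g : Γ.pi1 x₀) (c : (Γ.cover x₀).Line) : (Γ.cover x₀).Line where
  edge i := g • c.edge i
  isReduced n := by
    rw [cover_t_smul, cover_o_smul, cover_inv_smul, (c.isReduced n).1]
    exact ⟨rfl, fun h => (c.isReduced n).2 (MulAction.injective g h)⟩

lemma Line.toEnd_forward_deck (g : Γ.pi1 x₀) (c : (Γ.cover x₀).Line) :
    (c.deck g).forward.toEnd = g • c.forward.toEnd := rfl

lemma Line.toEnd_backward_deck (g : Γ.pi1 x₀) (c : (Γ.cover x₀).Line) :
    (c.deck g).backward.toEnd = g • c.backward.toEnd := by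
  have h : (c.deck g).backward = g • c.backward :=
    Ray.ext (funext fun n => cover_inv_smul g _)
  rw [h]
  rfl

lemma smul_mem_cyl {g : Γ.pi1 x₀} {P : (Γ.cover x₀).Boundary2} {l : List (Γ.CoverEdge x₀)}
    (h : P ∈ (Γ.cover x₀).cyl l) : g • P ∈ (Γ.cover x₀).cyl (l.map (g • ·)) := by
  obtain ⟨c, h1, h2, i, h3⟩ := h
  refine ⟨c.deck g, ?_, ?_, i, fun j hj => ?_⟩
  · rw [c.toEnd_backward_deck, h1]; rfl
  · rw [c.toEnd_forward_deck, h2]; rfl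
  · rw [List.getElem_map, ← h3 j (by simpa using hj)]
    rfl

lemma smul_preimage_cyl (g : Γ.pi1 x₀) (l : List (Γ.CoverEdge x₀)) :
    (fun P => g • P) ⁻¹' (Γ.cover x₀).cyl l = (Γ.cover x₀).cyl (l.map (g⁻¹ • ·)) := by
  ext P
  constructor
  · intro h
    have := smul_mem_cyl (g := g⁻¹) (show g • P ∈ _ from h)
    rwa [inv_smul_smul] at this
  · intro h
    have := smul_mem_cyl (g := g) h
    rw [List.map_map] at this
    simpa [Function.comp_def] using this

lemma proj_smul (g : Γ.pi1 x₀) (q : Γ.CoverEdge x₀) : (g • q).proj = q.proj := rfl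

lemma map_proj_map_smul (g : Γ.pi1 x₀) (l : List (Γ.CoverEdge x₀)) :
    (l.map (g • ·)).map CoverEdge.proj = l.map CoverEdge.proj := by
  simp [Function.comp_def, proj_smul]

lemma isPath_map_smul (g : Γ.pi1 x₀) {l : List (Γ.CoverEdge x₀)} {p q : Γ.CoverVertex x₀}
    (h : (Γ.cover x₀).IsPath p l q) : (Γ.cover x₀).IsPath (g • p) (l.map (g • ·)) (g • q) := by
  induction l generalizing p with
  | nil => exact congrArg (g • ·) h
  | cons e l ih =>
    refine ⟨congrArg (g • ·) h.1, ?_⟩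
    rw [cover_t_smul]
    exact ih h.2

lemma isReduced_map_smul (g : Γ.pi1 x₀) {l : List (Γ.CoverEdge x₀)}
    (h : (Γ.cover x₀).IsReduced l) : (Γ.cover x₀).IsReduced (l.map (g • ·)) := by
  rw [IsReduced, List.isChain_map]
  refine List.IsChain.imp (fun a b hab h' => hab ?_) h
  rw [cover_inv_smul] at h'
  exact MulAction.injective g h'

lemma IsGeodesic.smul (g : Γ.pi1 x₀) {l : List (Γ.CoverEdge x₀)}
    (h : (Γ.cover x₀).IsGeodesic l) : (Γ.cover x₀).IsGeodesic (l.map (g • ·)) := by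
  obtain ⟨h1, h2, p, q, h3⟩ := h
  exact ⟨by simpa using h1, isReduced_map_smul g h2, _, _, isPath_map_smul g h3⟩

lemma IsLift.isGeodesic {l : List (Γ.CoverEdge x₀)} {v : List E} {k : ℕ} (h : Γ.IsLift l v)
    (hk : 1 ≤ k) (hv : v ∈ Γ.Omega k) : (Γ.cover x₀).IsGeodesic l := by
  obtain ⟨⟨p, q, h1⟩, rfl⟩ := h
  refine ⟨fun h => ?_, (isReduced_map_proj_iff h1).1 hv.2.1, p, q, h1⟩
  have := hv.1
  simp [h] at this
  omega

lemma IsGeodesic.isLift {l : List (Γ.CoverEdge x₀)} (h : (Γ.cover x₀).IsGeodesic l) :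
    Γ.IsLift l (l.map CoverEdge.proj) := ⟨h.2.2, rfl⟩

lemma IsGeodesic.map_proj_mem {l : List (Γ.CoverEdge x₀)} (h : (Γ.cover x₀).IsGeodesic l) :
    l.map CoverEdge.proj ∈ Γ.Omega l.length := by
  obtain ⟨-, h2, p, q, h3⟩ := h
  exact ⟨by simp, (isReduced_map_proj_iff h3).2 h2, _, _, (isPath_map_proj h3).1⟩

lemma isPath_append_iff {T : OrGraph V E} {l m : List E} {x z : V} :
    T.IsPath x (l ++ m) z ↔ ∃ y, T.IsPath x l y ∧ T.IsPath y m z := by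
  induction l generalizing x with
  | nil => exact ⟨fun h => ⟨x, rfl, h⟩, fun ⟨y, h1, h2⟩ => h1 ▸ h2⟩
  | cons e l ih =>
    refine ⟨fun h => ?_, fun ⟨y, h1, h2⟩ => ⟨h1.1, ih.2 ⟨y, h1.2, h2⟩⟩⟩
    obtain ⟨y, h1, h2⟩ := ih.1 h.2
    exact ⟨y, ⟨h.1, h1⟩, h2⟩

lemma IsPath.eq_t_getLast {T : OrGraph V E} {l : List E} {x y : V} (h : T.IsPath x l y)
    (hl : l ≠ []) : y = T.t (l.getLast hl) := by
  obtain ⟨l, e, rfl⟩ := List.eq_nil_or_concat' l |>.resolve_left hl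
  obtain ⟨z, -, h1⟩ := isPath_append_iff.1 h
  rw [List.getLast_append_singleton]
  exact h1.2.symm

lemma IsPath.eq_o_head {T : OrGraph V E} {l : List E} {x y : V} (h : T.IsPath x l y)
    (hl : l ≠ []) : x = T.o (l.head hl) := by
  cases l with
  | nil => exact absurd rfl hl
  | cons e l => exact h.1.symm

lemma isReduced_append_singleton_iff {T : OrGraph V E} {l : List E} (hl : l ≠ []) {f : E} :
    T.IsReduced (l ++ [f]) ↔ T.IsReduced l ∧ f ≠ T.inv (l.getLast hl) := by
  rw [IsReduced, List.isChain_append]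
  simp [IsReduced, List.getLast?_eq_some_getLast hl]

lemma IsGeodesic.append_singleton {T : OrGraph V E} {l : List E} (hl : T.IsGeodesic l) {f : E}
    (h : T.t (l.getLast hl.1) = T.o f) (h' : f ≠ T.inv (l.getLast hl.1)) :
    T.IsGeodesic (l ++ [f]) := by
  obtain ⟨h1, h2, v, w, h3⟩ := hl
  refine ⟨by simp, (isReduced_append_singleton_iff h1).2 ⟨h2, h'⟩, v, T.t f, ?_⟩
  exact T.isPath_append h3 ⟨h.symm.trans (h3.eq_t_getLast h1).symm, rfl⟩

/-- If the projection of a path in the universal cover can be continued by an edge, so can the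
path. -/
lemma IsGeodesic.exists_continuation {l : List (Γ.CoverEdge x₀)}
    (hl : (Γ.cover x₀).IsGeodesic l) {e : E} {k : ℕ}
    (he : l.map CoverEdge.proj ++ [e] ∈ Γ.Omega k) :
    ∃ f, ((Γ.cover x₀).t (l.getLast hl.1) = (Γ.cover x₀).o f ∧
      f ≠ (Γ.cover x₀).inv (l.getLast hl.1)) ∧ f.proj = e := by
  obtain ⟨h1, h2, p, q, h3⟩ := hl
  obtain ⟨-, h4, x, y, h5⟩ := he
  obtain ⟨z, h6, h7⟩ := isPath_append_iff.1 h5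
  have h8 : l.map CoverEdge.proj ≠ [] := by simpa using h1
  have h9 : z = q.term := (h6.eq_t_getLast h8).trans
    ((isPath_map_proj h3).1.eq_t_getLast h8).symm
  let f : Γ.CoverEdge x₀ := ⟨q, e, h7.1.trans h9⟩
  have h10 : (Γ.cover x₀).IsPath p (l ++ [f]) f.finish := isPath_append _ h3 ⟨rfl, rfl⟩
  have h11 := (isReduced_map_proj_iff h10).1 (by simpa using h4)
  exact ⟨f, ⟨(h3.eq_t_getLast h1).symm, ((isReduced_append_singleton_iff h1).1 h11).2⟩, rfl⟩

lemma map_proj_invPath (l : List (Γ.CoverEdge x₀)) :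
    ((Γ.cover x₀).invPath l).map CoverEdge.proj = Γ.invPath (l.map CoverEdge.proj) := by
  simp [invPath, Function.comp_def, cover_proj_inv]

lemma Connected.exists_coverVertex (h : Γ.Connected) (y : V) :
    ∃ p : Γ.CoverVertex x₀, p.term = y := by
  obtain ⟨l, hl⟩ := h x₀ y
  exact ⟨⟨_, y, l, hl, rfl⟩, rfl⟩

lemma Connected.exists_isLift (h : Γ.Connected) {k : ℕ} {v : List E} (hv : v ∈ Γ.Omega k) :
    ∃ l : List (Γ.CoverEdge x₀), Γ.IsLift l v := by
  obtain ⟨-, -, x, y, h1⟩ := hv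
  obtain ⟨p, rfl⟩ := h.exists_coverVertex (x₀ := x₀) x
  obtain ⟨l, q, h2, h3, -⟩ := exists_lift p h1
  exact ⟨l, ⟨p, q, h2⟩, h3⟩

lemma continuous_smul_boundary2 (g : Γ.pi1 x₀) :
    Continuous fun P : (Γ.cover x₀).Boundary2 => g • P := by
  refine (cover_isTree Γ x₀).isTopologicalBasis_cylinders.continuous_iff.2 ?_
  rintro _ ⟨l, hl, rfl⟩
  rw [smul_preimage_cyl]
  exact (IsGeodesic.smul g⁻¹ hl).isOpen_cyl

lemma continuous_flip : Continuous (flip (Γ := Γ.cover x₀)) := by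
  refine (cover_isTree Γ x₀).isTopologicalBasis_cylinders.continuous_iff.2 ?_
  rintro _ ⟨l, hl, rfl⟩
  rw [flip_preimage_cyl]
  exact hl.invPath.isOpen_cyl

end Action

end OrGraph

/-! ### Currents and their weights -/

section Weights

open MeasureTheory OrGraph

variable {N : ℕ} {V E : Type*} {Γ : OrGraph V E} {x₀ : V}

/-- A measure on `∂²` that is finite on the cylinders is determined by its values on them. -/
lemma measure_ext_of_cyl [Finite V] [Finite E] {μ ν : Measure (Γ.cover x₀).Boundary2}
    (hfin : ∀ l, (Γ.cover x₀).IsGeodesic l → μ ((Γ.cover x₀).cyl l) < ∞)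
    (h : ∀ l, (Γ.cover x₀).IsGeodesic l → μ ((Γ.cover x₀).cyl l) = ν ((Γ.cover x₀).cyl l)) :
    μ = ν := by
  have hb := (cover_isTree Γ x₀).isTopologicalBasis_cylinders
  have hc : (Γ.cover x₀).cylinders.Countable := countable_cylinders
  have : SecondCountableTopology (Γ.cover x₀).Boundary2 := hb.secondCountableTopology hc
  refine Measure.ext_of_generateFrom_of_cover_subset
    ((BorelSpace.measurable_eq (α := (Γ.cover x₀).Boundary2)).trans hb.borel_eq_generateFrom)
    (cover_isTree Γ x₀).isPiSystem_cylinders subset_rfl hc hb.sUnion_eq ?_ ?_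
  · rintro _ ⟨l, hl, rfl⟩
    exact (hfin l hl).ne
  · rintro _ ⟨l, hl, rfl⟩
    exact h l hl

variable (C : SimplicialChart N Γ x₀)

/-- A measure on `∂²` is a geodesic current if its value on a cylinder is finite, depends only on
the projection of the path, and does not change when the path is inverted. -/
def GeodesicCurrent.ofWeights [Finite V] [Finite E] (μ : Measure (Γ.cover x₀).Boundary2)
    (hfin : ∀ l, (Γ.cover x₀).IsGeodesic l → μ ((Γ.cover x₀).cyl l) < ∞)
    (hdeck : ∀ l m, (Γ.cover x₀).IsGeodesic l → (Γ.cover x₀).IsGeodesic m →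
      l.map CoverEdge.proj = m.map CoverEdge.proj →
      μ ((Γ.cover x₀).cyl l) = μ ((Γ.cover x₀).cyl m))
    (hflip : ∀ l, (Γ.cover x₀).IsGeodesic l →
      μ ((Γ.cover x₀).cyl ((Γ.cover x₀).invPath l)) = μ ((Γ.cover x₀).cyl l)) :
    GeodesicCurrent C where
  measure := μ
  finite_on_compact K hK := by
    have : IsLocallyFiniteMeasure μ := ⟨fun P => by
      obtain ⟨_, ⟨l, hl, rfl⟩, hP, -⟩ := (cover_isTree Γ x₀).isTopologicalBasis_cylinders
        |>.exists_subset_of_mem_open (Set.mem_univ P) isOpen_univ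
      exact ⟨_, hl.isOpen_cyl.mem_nhds hP, hfin l hl⟩⟩
    exact hK.measure_lt_top
  invariant g A hA := by
    have hm := (continuous_smul_boundary2 (C.marking g)).measurable
    rw [← Measure.map_apply hm hA]
    congr 1
    have key : ∀ l, (Γ.cover x₀).IsGeodesic l →
        μ.map (fun P => C.marking g • P) ((Γ.cover x₀).cyl l) = μ ((Γ.cover x₀).cyl l) := by
      intro l hl
      rw [Measure.map_apply hm hl.isOpen_cyl.measurableSet, smul_preimage_cyl]
      exact hdeck _ _ (hl.smul _) hl (map_proj_map_smul _ _)
    exact measure_ext_of_cyl (fun l hl => (key l hl).trans_lt (hfin l hl)) key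
  flip_invariant A hA := by
    have hm := (continuous_flip (Γ := Γ) (x₀ := x₀)).measurable
    rw [← Measure.map_apply hm hA]
    congr 1
    have key : ∀ l, (Γ.cover x₀).IsGeodesic l →
        μ.map OrGraph.flip ((Γ.cover x₀).cyl l) = μ ((Γ.cover x₀).cyl l) := by
      intro l hl
      rw [Measure.map_apply hm hl.isOpen_cyl.measurableSet, flip_preimage_cyl]
      exact hflip l hl
    exact measure_ext_of_cyl (fun l hl => (key l hl).trans_lt (hfin l hl)) key

variable {C}

lemma GeodesicCurrent.isFiniteMeasureOnCompacts (ν : GeodesicCurrent C) :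
    IsFiniteMeasureOnCompacts ν.measure := ⟨fun {K} hK => ν.finite_on_compact K hK⟩

lemma GeodesicCurrent.cyl_lt_top [Finite E] (ν : GeodesicCurrent C) {l : List (Γ.CoverEdge x₀)}
    (hl : (Γ.cover x₀).IsGeodesic l) : ν.measure ((Γ.cover x₀).cyl l) < ∞ :=
  ν.finite_on_compact _ ((cover_isTree Γ x₀).isCompact_cyl hl)

/-- The weight of a path is the sum of the weights of its continuations by one edge. -/
lemma measure_cyl_eq_sum [Fintype E] (μ : Measure (Γ.cover x₀).Boundary2)
    {l : List (Γ.CoverEdge x₀)} (hl : (Γ.cover x₀).IsGeodesic l) {W : List E → ℝ≥0∞}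
    (hW : ∀ m, (Γ.cover x₀).IsGeodesic m → m.length = l.length + 1 →
      μ ((Γ.cover x₀).cyl m) = W (m.map CoverEdge.proj))
    (hW0 : ∀ e, l.map CoverEdge.proj ++ [e] ∉ Γ.Omega (l.length + 1) →
      W (l.map CoverEdge.proj ++ [e]) = 0) :
    μ ((Γ.cover x₀).cyl l) = ∑ e, W (l.map CoverEdge.proj ++ [e]) := by
  let A : E → Set (Γ.cover x₀).Boundary2 := fun e =>
    ⋃ f ∈ {f | ((Γ.cover x₀).t (l.getLast hl.1) = (Γ.cover x₀).o f ∧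
      f ≠ (Γ.cover x₀).inv (l.getLast hl.1)) ∧ f.proj = e}, (Γ.cover x₀).cyl (l ++ [f])
  have h1 : (Γ.cover x₀).cyl l = ⋃ e, A e := by
    rw [(cover_isTree Γ x₀).cyl_eq_iUnion hl.1]
    ext P
    simp only [A, Set.mem_iUnion]
    exact ⟨fun ⟨f, hf, hP⟩ => ⟨f.proj, f, ⟨hf, rfl⟩, hP⟩, fun ⟨_, f, hf, hP⟩ => ⟨f, hf.1, hP⟩⟩
  have h2 : Pairwise (Function.onFun Disjoint A) := by
    intro e e' hne
    refine Set.disjoint_left.2 fun P hP hP' => ?_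
    simp only [A, Set.mem_iUnion] at hP hP'
    obtain ⟨f, hf, hP⟩ := hP
    obtain ⟨f', hf', hP'⟩ := hP'
    refine Set.disjoint_left.1 ((cover_isTree Γ x₀).disjoint_cyl_append hl.1 ?_) hP hP'
    rintro rfl
    exact hne (hf.2.symm.trans hf'.2)
  have h3 : ∀ e f, f ∈ {f | ((Γ.cover x₀).t (l.getLast hl.1) = (Γ.cover x₀).o f ∧
      f ≠ (Γ.cover x₀).inv (l.getLast hl.1)) ∧ f.proj = e} → A e = (Γ.cover x₀).cyl (l ++ [f]) := by
    intro e f hf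
    have : ∀ f', f' ∈ {f | ((Γ.cover x₀).t (l.getLast hl.1) = (Γ.cover x₀).o f ∧
      f ≠ (Γ.cover x₀).inv (l.getLast hl.1)) ∧ f.proj = e} → f' = f := fun f' hf' =>
        CoverEdge.ext (hf'.1.1.symm.trans hf.1.1) (hf'.2.trans hf.2.symm)
    ext P
    simp only [A, Set.mem_iUnion]
    exact ⟨fun ⟨f', hf', hP⟩ => this f' hf' ▸ hP, fun hP => ⟨f, hf, hP⟩⟩
  have h4 : ∀ e, MeasurableSet (A e) ∧ μ (A e) = W (l.map CoverEdge.proj ++ [e]) := by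
    intro e
    by_cases he : l.map CoverEdge.proj ++ [e] ∈ Γ.Omega (l.length + 1)
    · obtain ⟨f, hf⟩ := hl.exists_continuation he
      have h5 := hl.append_singleton hf.1.1 hf.1.2
      rw [h3 e f hf, hW _ h5 (by simp), List.map_append, ← hf.2]
      exact ⟨h5.isOpen_cyl.measurableSet, rfl⟩
    · have : A e = ∅ := by
        refine Set.eq_empty_of_forall_notMem fun P hP => he ?_
        simp only [A, Set.mem_iUnion] at hP
        obtain ⟨f, hf, -⟩ := hP
        have h5 := (hl.append_singleton hf.1.1 hf.1.2).map_proj_mem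
        rw [List.map_append, List.length_append] at h5
        exact hf.2 ▸ h5
      rw [this, hW0 _ he]
      exact ⟨.empty, measure_empty⟩
  rw [h1, measure_iUnion h2 fun e => (h4 e).1, tsum_fintype]
  exact Finset.sum_congr rfl fun e _ => (h4 e).2

end Weights

namespace OrGraph

/-! ### Half-trees and distances in a tree -/

section TreeMetric

variable {V E : Type*} {T : OrGraph V E}

lemma exists_isReduced_path {x y : V} {l : List E} (h : T.IsPath x l y) :
    ∃ m, T.IsReduced m ∧ T.IsPath x m y ∧ m.length ≤ l.length := by
  induction l generalizing x with
  | nil => exact ⟨[], List.isChain_nil, h, le_rfl⟩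
  | cons e l ih =>
    obtain ⟨m, h1, h2, h3⟩ := ih h.2
    by_cases h4 : m.head? = some (T.inv e)
    · cases m with
      | nil => simp at h4
      | cons f m =>
        obtain rfl : f = T.inv e := by simpa using h4
        refine ⟨m, h1.tail, ?_, ?_⟩
        · have := h2.2
          rwa [T.t_inv, h.1] at this
        · simp only [List.length_cons] at h3 ⊢
          omega
    · exact ⟨e :: m, isReduced_cons h1 h4, ⟨h.1, h2⟩, by simpa using h3⟩

lemma IsTree.mem_halfTree_or (hT : T.IsTree) (e : E) (y : V) :
    y ∈ T.halfTree e ∨ y ∈ T.halfTree (T.inv e) := by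
  obtain ⟨l, hl⟩ := hT.connected (T.o e) y
  obtain ⟨m, h1, h2, -⟩ := exists_isReduced_path hl
  by_cases h3 : m.head? = some e
  · cases m with
    | nil => simp at h3
    | cons f m =>
      obtain rfl : f = e := by simpa using h3
      exact .inl ⟨m, h1, h2⟩
  · refine .inr ⟨m, isReduced_cons h1 (by rwa [T.inv_inv]), rfl, ?_⟩
    rwa [T.t_inv]

lemma IsTree.disjoint_halfTree_inv (hT : T.IsTree) (e : E) :
    Disjoint (T.halfTree e) (T.halfTree (T.inv e)) := by
  rw [Set.disjoint_left]
  rintro y ⟨l, h1, h2⟩ ⟨m, h3, h4⟩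
  have h5 := h4.2
  rw [T.t_inv] at h5
  obtain rfl := hT.unique h1 h3.tail h2 h5
  exact (isReduced_cons_cons.1 h3).1 (T.inv_inv e).symm

lemma halfTree_subset_halfTree {e f : E} (h : T.t e = T.o f) (h' : f ≠ T.inv e) :
    T.halfTree f ⊆ T.halfTree e := by
  rintro y ⟨l, h1, h2⟩
  exact ⟨f :: l, isReduced_cons_cons.2 ⟨h', h1⟩, rfl, by rwa [h]⟩

lemma Ray.antitone_halfTree (r : T.Ray) : Antitone fun n => T.halfTree (r.edge n) :=
  antitone_nat_of_succ_le fun n => halfTree_subset_halfTree (r.isReduced n).1 (r.isReduced n).2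

lemma Line.antitone_halfTree (c : T.Line) : Antitone fun i => T.halfTree (c.edge i) :=
  antitone_int_of_succ_le fun n => halfTree_subset_halfTree (c.isReduced n).1 (c.isReduced n).2

lemma Ray.exists_halfTree_subset (r : T.Ray) {a : E} (h : r.toEnd ∈ T.shadow a) :
    ∃ m, ∀ n, m ≤ n → T.halfTree (r.edge n) ⊆ T.halfTree a := by
  obtain ⟨s, rfl, hs⟩ := h
  obtain ⟨m, n, hmn⟩ := Ray.toEnd_eq_iff.1 hs
  refine ⟨n, fun k hk => ?_⟩
  obtain ⟨k, rfl⟩ := Nat.exists_eq_add_of_le hk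
  rw [← hmn k]
  exact s.antitone_halfTree (Nat.zero_le _)

lemma Ray.exists_path_of_mem_halfTree (r : T.Ray) {n : ℕ} {y : V}
    (h : y ∈ T.halfTree (r.edge n)) :
    ∃ l, T.IsReduced (r.edge 0 :: l) ∧ T.IsPath (T.o (r.edge 0)) (r.edge 0 :: l) y ∧
      n ≤ l.length := by
  induction n generalizing r with
  | zero =>
    obtain ⟨l, h1, h2⟩ := h
    exact ⟨l, h1, h2, Nat.zero_le _⟩
  | succ n ih =>
    obtain ⟨l, h1, h2, h3⟩ := ih (r.drop 1) (by
      change y ∈ T.halfTree (r.edge (1 + n))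
      rwa [add_comm])
    have h4 : (r.drop 1).edge 0 = r.edge 1 := rfl
    rw [h4] at h1 h2
    have h5 := r.isReduced 0
    refine ⟨r.edge 1 :: l, isReduced_cons_cons.2 ⟨h5.2, h1⟩, ⟨rfl, ?_⟩, by simpa using h3⟩
    rw [h5.1]
    exact h2

/-- Every vertex lies on the forward side of all edges of a line that are far enough behind. -/
lemma IsTree.exists_mem_halfTree (hT : T.IsTree) (c : T.Line) (y : V) :
    ∃ m : ℤ, ∀ i ≤ m, y ∈ T.halfTree (c.edge i) := by
  obtain ⟨l, hl⟩ := hT.connected (T.o (c.backward.edge 0)) y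
  obtain ⟨m, h1, h2, -⟩ := exists_isReduced_path hl
  have h3 : y ∈ T.halfTree (c.edge (-1 - m.length)) := by
    refine (hT.mem_halfTree_or _ y).resolve_right fun h3 => ?_
    obtain ⟨l', h4, h5, h6⟩ := c.backward.exists_path_of_mem_halfTree h3
    obtain rfl := hT.unique h1 h4 h2 h5
    simp at h6
  exact ⟨_, fun i hi => c.antitone_halfTree hi h3⟩

lemma pathDist_le {x y : V} {l : List E} (h : T.IsPath x l y) : T.pathDist x y ≤ l.length :=
  Nat.sInf_le ⟨l, h, rfl⟩

lemma Connected.exists_path_length_eq (hT : T.Connected) (x y : V) :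
    ∃ l, T.IsPath x l y ∧ l.length = T.pathDist x y := by
  obtain ⟨l, hl⟩ := hT x y
  exact Nat.sInf_mem (s := {n | ∃ l, T.IsPath x l y ∧ l.length = n}) ⟨_, l, hl, rfl⟩

lemma Connected.pathDist_triangle (hT : T.Connected) (x y z : V) :
    T.pathDist x z ≤ T.pathDist x y + T.pathDist y z := by
  obtain ⟨l, h1, h2⟩ := hT.exists_path_length_eq x y
  obtain ⟨m, h3, h4⟩ := hT.exists_path_length_eq y z
  rw [← h2, ← h4, ← List.length_append]
  exact pathDist_le (T.isPath_append h1 h3)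

lemma Connected.pathDist_comm (hT : T.Connected) (x y : V) : T.pathDist x y = T.pathDist y x := by
  have : ∀ x y, T.pathDist x y ≤ T.pathDist y x := fun x y => by
    obtain ⟨l, h1, h2⟩ := hT.exists_path_length_eq y x
    rw [← h2]
    simpa [invPath] using pathDist_le (T.isPath_invPath h1)
  exact le_antisymm (this x y) (this y x)

lemma IsTree.pathDist_eq_length (hT : T.IsTree) {x y : V} {l : List E} (h : T.IsPath x l y)
    (h' : T.IsReduced l) : T.pathDist x y = l.length := by
  obtain ⟨m, h1, h2⟩ := hT.connected.exists_path_length_eq x y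
  obtain ⟨m', h3, h4, h5⟩ := exists_isReduced_path h1
  obtain rfl := hT.unique h' h3 h h4
  exact le_antisymm (pathDist_le h) (h2 ▸ h5)

lemma IsTree.pathDist_line (hT : T.IsTree) (c : T.Line) (i j : ℤ) :
    T.pathDist (T.o (c.edge i)) (T.o (c.edge j)) = (j - i).natAbs := by
  have h : ∀ i (n : ℕ), T.pathDist (T.o (c.edge i)) (T.o (c.edge (i + n))) = n := fun i n => by
    rw [hT.pathDist_eq_length (c.isPath_segment i n) (c.isReduced_segment i n),
      c.length_segment]
  rcases le_total i j with hij | hij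
  · have := h i (j - i).natAbs
    rwa [show i + ((j - i).natAbs : ℤ) = j by omega] at this
  · have := h j (j - i).natAbs
    rwa [show j + ((j - i).natAbs : ℤ) = i by omega, hT.connected.pathDist_comm] at this

/-- A sequence of vertices of a tree converges to at most one end. -/
lemma IsTree.convergesTo_unique (hT : T.IsTree) {u : ℕ → V} {x y : T.Boundary}
    (hx : T.ConvergesTo u x) (hy : T.ConvergesTo u y) : x = y := by
  by_contra h
  obtain ⟨c, rfl, rfl⟩ := hT.exists_line h
  obtain ⟨n, h1, h2⟩ :=
    ((hx _ (c.backward_mem_shadow 0)).and (hy _ (c.forward_mem_shadow 0))).exists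
  exact Set.disjoint_left.1 (hT.disjoint_halfTree_inv _) h2 h1

end TreeMetric

/-! ### Translation axes -/

section Axis

variable {V E : Type*} {Γ : OrGraph V E} {x₀ : V}

lemma eq_one_of_smul_edge_eq {g : Γ.pi1 x₀} {q : Γ.CoverEdge x₀} (h : g • q = q) : g = 1 := by
  have h1 : g.1 * q.start.cls = q.start.cls := congrArg (fun q => q.start.cls) h
  exact Subtype.ext (mul_eq_right.1 h1)

/-- The covering transformations act transitively on the lifts of an edge. -/
lemma exists_smul_edge_eq {q q' : Γ.CoverEdge x₀} (h : q.proj = q'.proj) :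
    ∃ g : Γ.pi1 x₀, g • q = q' := by
  have hterm : q.start.term = q'.start.term := by rw [← q.o_proj, ← q'.o_proj, h]
  obtain ⟨l, h1, h2⟩ := q.start.exists_path
  obtain ⟨m, h3, h4⟩ := q'.start.exists_path
  rw [hterm] at h1
  refine ⟨⟨q'.start.cls * q.start.cls⁻¹, m ++ Γ.invPath l,
    Γ.isPath_append h3 (Γ.isPath_invPath h1), ?_⟩, ?_⟩
  · rw [word_append, word_invPath, h2, h4]
  · exact CoverEdge.ext (CoverVertex.ext (inv_mul_cancel_right _ _) hterm) h

lemma smul_mem_shadow {g : Γ.pi1 x₀} {q : Γ.CoverEdge x₀} {x : (Γ.cover x₀).Boundary}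
    (h : x ∈ (Γ.cover x₀).shadow q) : g • x ∈ (Γ.cover x₀).shadow (g • q) := by
  obtain ⟨r, rfl, rfl⟩ := h
  exact ⟨g • r, rfl, rfl⟩

lemma smul_mem_halfTree {g : Γ.pi1 x₀} {q : Γ.CoverEdge x₀} {p : Γ.CoverVertex x₀}
    (h : p ∈ (Γ.cover x₀).halfTree q) : g • p ∈ (Γ.cover x₀).halfTree (g • q) := by
  obtain ⟨l, h1, h2⟩ := h
  exact ⟨l.map (g • ·), isReduced_map_smul g h1, isPath_map_smul g h2⟩

lemma ConvergesTo.smul {u : ℕ → Γ.CoverVertex x₀} {x : (Γ.cover x₀).Boundary}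
    (h : (Γ.cover x₀).ConvergesTo u x) (g : Γ.pi1 x₀) :
    (Γ.cover x₀).ConvergesTo (fun n => g • u n) (g • x) := by
  intro q hq
  have h1 := smul_mem_shadow (g := g⁻¹) hq
  rw [inv_smul_smul] at h1
  filter_upwards [h _ h1] with n hn
  simpa using smul_mem_halfTree (g := g) hn

/-- If `uₙ = gⁿ p` converges to an end, then this end is fixed by `g`. -/
lemma smul_eq_of_convergesTo {g : Γ.pi1 x₀} {p : Γ.CoverVertex x₀} {x : (Γ.cover x₀).Boundary}
    (h : (Γ.cover x₀).ConvergesTo (fun n => g ^ n • p) x) : g • x = x := by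
  refine (cover_isTree Γ x₀).convergesTo_unique (h.smul g) fun e he => ?_
  filter_upwards [(Filter.tendsto_add_atTop_nat 1).eventually (h e he)] with n hn
  rwa [smul_smul, ← pow_succ']

lemma pathDist_smul (g : Γ.pi1 x₀) (p q : Γ.CoverVertex x₀) :
    (Γ.cover x₀).pathDist (g • p) (g • q) = (Γ.cover x₀).pathDist p q := by
  have h : ∀ (g : Γ.pi1 x₀) (p q : Γ.CoverVertex x₀),
      (Γ.cover x₀).pathDist (g • p) (g • q) ≤ (Γ.cover x₀).pathDist p q := fun g p q => by
    obtain ⟨l, h1, h2⟩ := cover_connected.exists_path_length_eq p q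
    rw [← h2, ← List.length_map (g • ·)]
    exact pathDist_le (isPath_map_smul g h1)
  refine le_antisymm (h g p q) ?_
  have := h g⁻¹ (g • p) (g • q)
  rwa [inv_smul_smul, inv_smul_smul] at this

lemma pathDist_pow_smul_le (g : Γ.pi1 x₀) (p : Γ.CoverVertex x₀) (n : ℕ) :
    (Γ.cover x₀).pathDist p (g ^ n • p) ≤ n * (Γ.cover x₀).pathDist p (g • p) := by
  induction n with
  | zero => simpa using pathDist_le (T := Γ.cover x₀) (l := []) (rfl : p = p)
  | succ n ih =>
    refine (cover_connected.pathDist_triangle p (g ^ n • p) _).trans ?_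
    rw [pow_succ, mul_smul, pathDist_smul, add_mul, one_mul]
    exact Nat.add_le_add_right ih _

/-- `g` translates the line `c` by `τ`. -/
def Line.IsTranslatedBy (c : (Γ.cover x₀).Line) (g : Γ.pi1 x₀) (τ : ℤ) : Prop :=
  ∀ i, g • c.edge i = c.edge (i + τ)

namespace Line.IsTranslatedBy

variable {c : (Γ.cover x₀).Line} {g : Γ.pi1 x₀} {τ : ℤ}

lemma pow (h : c.IsTranslatedBy g τ) (n : ℕ) : c.IsTranslatedBy (g ^ n) (n * τ) := by
  intro i
  induction n generalizing i with
  | zero => simp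
  | succ n ih =>
    rw [pow_succ, mul_smul, h, ih]
    exact congrArg c.edge (by push_cast; ring)

lemma inv (h : c.IsTranslatedBy g τ) : c.IsTranslatedBy g⁻¹ (-τ) := fun i => by
  rw [inv_smul_eq_iff, h, neg_add_cancel_right]

lemma zpow (h : c.IsTranslatedBy g τ) (n : ℤ) : c.IsTranslatedBy (g ^ n) (n * τ) := by
  obtain ⟨n, rfl | rfl⟩ := n.eq_nat_or_neg
  · rw [zpow_natCast]
    exact h.pow n
  · rw [zpow_neg, zpow_natCast, neg_mul]
    exact (h.pow n).inv

lemma ne_zero (h : c.IsTranslatedBy g τ) (hg : g ≠ 1) : τ ≠ 0 := by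
  rintro rfl
  exact hg (eq_one_of_smul_edge_eq ((h 0).trans (by simp)))

/-- The minimal displacement is attained on the axis. -/
lemma iInf_pathDist (h : c.IsTranslatedBy g τ) :
    ⨅ p : Γ.CoverVertex x₀, (Γ.cover x₀).pathDist p (g • p) = τ.natAbs := by
  have : Nonempty (Γ.CoverVertex x₀) := ⟨Γ.coverBase x₀⟩
  set p₀ := (Γ.cover x₀).o (c.edge 0)
  have h1 : ∀ n : ℕ, (Γ.cover x₀).pathDist p₀ (g ^ n • p₀) = n * τ.natAbs := fun n => by
    rw [← cover_o_smul, h.pow, (cover_isTree Γ x₀).pathDist_line, zero_add, sub_zero,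
      Int.natAbs_mul, Int.natAbs_natCast]
  refine le_antisymm ((ciInf_le (OrderBot.bddBelow _) p₀).trans ?_) (le_ciInf fun p => ?_)
  · simpa using (h1 1).le
  · set d := (Γ.cover x₀).pathDist p (g • p)
    set D := (Γ.cover x₀).pathDist p₀ p
    have h2 : ∀ n : ℕ, n * τ.natAbs ≤ D + (n * d + D) := fun n => by
      rw [← h1 n]
      refine (cover_connected.pathDist_triangle _ p _).trans (Nat.add_le_add_left ?_ _)
      refine (cover_connected.pathDist_triangle _ (g ^ n • p) _).trans
        (Nat.add_le_add (pathDist_pow_smul_le g p n) ?_)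
      rw [pathDist_smul, cover_connected.pathDist_comm]
    by_contra! h3
    have h4 := h2 (2 * D + 1)
    have h5 : (2 * D + 1) * (d + 1) ≤ (2 * D + 1) * τ.natAbs := Nat.mul_le_mul_left _ h3
    rw [Nat.mul_add] at h5
    omega

end Line.IsTranslatedBy

end Axis

end OrGraph

/-! ### Weights of counting currents -/

section Counting

open MeasureTheory OrGraph

variable {N : ℕ} {V E : Type*} {Γ : OrGraph V E} {x₀ : V}

open Classical in
/-- The number of occurrences of the word `v` in one period of a bi-infinite sequence of
period `n`. -/
noncomputable def occurrences (b : ℤ → E) (n : ℕ) (v : List E) : ℕ :=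
  ((Finset.range n).filter fun i : ℕ => ∀ (j : ℕ) (h : j < v.length), b (i + j) = v[j]).card

/-- Lifts of a bi-infinite path are determined by one of their edges. -/
lemma OrGraph.Line.eq_of_proj_eq {c d : (Γ.cover x₀).Line}
    (h : ∀ i, (c.edge i).proj = (d.edge i).proj) (h0 : c.edge 0 = d.edge 0) : c = d := by
  refine Line.ext (funext fun i => ?_)
  induction i using Int.induction_on with
  | zero => exact h0
  | succ i ih =>
    refine CoverEdge.ext ?_ (h _)
    have h1 := (c.isReduced i).1
    rw [ih, (d.isReduced i).1] at h1
    exact h1.symm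
  | pred i ih =>
    have h1 := (c.isReduced (-i - 1)).1
    have h2 := (d.isReduced (-i - 1)).1
    rw [sub_add_cancel] at h1 h2
    rw [ih, ← h2] at h1
    have hterm : (c.edge (-i - 1)).start.term = (d.edge (-i - 1)).start.term := by
      rw [← CoverEdge.o_proj, ← CoverEdge.o_proj, h]
    refine CoverEdge.ext (CoverVertex.ext ?_ hterm) (h _)
    have h3 : (c.edge (-i - 1)).start.cls * Γ.gen (c.edge (-i - 1)).proj =
      (d.edge (-i - 1)).start.cls * Γ.gen (d.edge (-i - 1)).proj := congrArg CoverVertex.cls h1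
    rw [h] at h3
    exact mul_right_cancel h3

variable {C : SimplicialChart N Γ x₀} {γ : FreeGroup (Fin N)} {c : (Γ.cover x₀).Line}
  {P : (Γ.cover x₀).Boundary2} {τ : ℤ}

lemma OrGraph.Line.IsTranslatedBy.smul_eq {g : Γ.pi1 x₀} (h : c.IsTranslatedBy g τ)
    (hb : c.backward.toEnd = P.1.1) (hf : c.forward.toEnd = P.1.2) : g • P = P := by
  have h1 : c.deck g = c.shift τ := Line.ext (funext h)
  refine Subtype.ext (Prod.ext ?_ ?_)
  · change g • P.1.1 = P.1.1
    rw [← hb, ← Line.toEnd_backward_deck, h1, Line.toEnd_backward_shift]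
  · change g • P.1.2 = P.1.2
    rw [← hf, ← Line.toEnd_forward_deck, h1, Line.toEnd_forward_shift]

/-- The translates of an axis that run through a lift of `v` correspond to the occurrences of `v`
in one period of the projection of the axis. -/
lemma tsum_indicator_cyl (hc : c.IsTranslatedBy (C.marking γ) τ) (hτ : τ ≠ 0)
    (hb : c.backward.toEnd = P.1.1) (hf : c.forward.toEnd = P.1.2)
    {l : List (Γ.CoverEdge x₀)} (hl : (Γ.cover x₀).IsGeodesic l) :
    ∑' h : FreeGroup (Fin N) ⧸ Subgroup.zpowers γ,
      ((Γ.cover x₀).cyl l).indicator (1 : (Γ.cover x₀).Boundary2 → ℝ≥0∞) (C.marking h.out • P) =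
    occurrences (fun i => (c.edge i).proj) τ.natAbs (l.map CoverEdge.proj) := by
  classical
  have hT := cover_isTree Γ x₀
  have hl0 := List.length_pos_of_ne_nil hl.1
  have hτ' : 0 < τ.natAbs := Int.natAbs_pos.2 hτ
  -- Elements of `⟨γ⟩` translate the axis by multiples of `τ`.
  have hpow : ∀ h ∈ Subgroup.zpowers γ, ∃ k : ℤ, c.IsTranslatedBy (C.marking h) (k * τ) := by
    rintro _ ⟨k, rfl⟩
    refine ⟨k, ?_⟩
    change c.IsTranslatedBy (C.marking (γ ^ k)) _
    rw [map_zpow]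
    exact hc.zpow k
  -- The translate of `P` by a group element that carries the occurrence at time `i` to `l`.
  have hmem : ∀ (h : FreeGroup (Fin N)) (i : ℤ), (∀ (j : ℕ) (hj : j < l.length),
      (c.edge (i + j)).proj = l[j].proj) → C.marking h • c.edge i = l[0] →
      C.marking h • P ∈ (Γ.cover x₀).cyl l := by
    intro h i hi h0
    have hQ1 : ((c.deck (C.marking h)).shift i).backward.toEnd = (C.marking h • P).1.1 := by
      rw [Line.toEnd_backward_shift, Line.toEnd_backward_deck, hb]; rfl
    have hQ2 : ((c.deck (C.marking h)).shift i).forward.toEnd = (C.marking h • P).1.2 := by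
      rw [Line.toEnd_forward_shift, Line.toEnd_forward_deck, hf]; rfl
    refine ⟨_, hQ1, hQ2, 0, ?_⟩
    have h1 : ((c.deck (C.marking h)).shift i).segment 0 l.length = l := by
      obtain ⟨-, -, p, q, hp⟩ := hl
      have h2 := ((c.deck (C.marking h)).shift i).isPath_segment 0 l.length
      have h3 : (Γ.cover x₀).o (((c.deck (C.marking h)).shift i).edge 0) = p := by
        have : ((c.deck (C.marking h)).shift i).edge 0 = l[0] := by
          rw [← h0]
          exact congrArg (fun i => C.marking h • c.edge i) (zero_add i)
        rw [this, ← List.head_eq_getElem (List.ne_nil_of_length_pos hl0)]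
        exact (hp.eq_o_head _).symm
      rw [h3] at h2
      refine lift_unique h2 hp (List.ext_getElem (by simp [Line.length_segment]) fun j h4 h5 => ?_)
      rw [List.getElem_map, List.getElem_map, Line.getElem_segment, zero_add,
        ← hi j (by simpa using h5), add_comm i]
      rfl
    intro j hj
    rw [← Line.getElem_segment _ 0 l.length j (by rwa [Line.length_segment])]
    simp only [h1]
  have hex : ∀ i : ℕ, (∀ (j : ℕ) (hj : j < l.length), (c.edge (i + j)).proj = l[j].proj) →
      ∃ h : FreeGroup (Fin N), C.marking h • c.edge i = l[0] := by
    intro i hi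
    have h1 := hi 0 hl0
    rw [Nat.cast_zero, add_zero] at h1
    obtain ⟨g, hg⟩ := exists_smul_edge_eq h1
    obtain ⟨h, rfl⟩ := C.marking.surjective g
    exact ⟨h, hg⟩
  choose! H hH using hex
  set s : Finset ℕ :=
    (Finset.range τ.natAbs).filter fun i : ℕ =>
      ∀ (j : ℕ) (hj : j < l.length), (c.edge (i + j)).proj = l[j].proj with hs
  have hocc : occurrences (fun i => (c.edge i).proj) τ.natAbs (l.map CoverEdge.proj) = s.card := by
    refine congrArg Finset.card (Finset.ext fun i => ?_)
    simp [hs]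
  let f : ℕ → FreeGroup (Fin N) ⧸ Subgroup.zpowers γ := fun i => (H i : _ ⧸ _)
  have hinj : Set.InjOn f s := by
    intro i hi j hj hij
    rw [Finset.mem_coe, hs, Finset.mem_filter, Finset.mem_range] at hi hj
    obtain ⟨k, hk⟩ := hpow _ (QuotientGroup.eq.1 hij)
    have h1 := hk j
    rw [map_mul, mul_smul, hH j hj.2, ← hH i hi.2, map_inv, inv_smul_smul] at h1
    have h2 := hT.line_edge_injective c h1
    have h3 : ((τ.natAbs : ℤ)) ∣ i - j := (Int.natAbs_dvd.2 ⟨k, by rw [h2]; ring⟩)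
    have h4 := Int.eq_zero_of_abs_lt_dvd h3 (by rw [abs_lt]; omega)
    omega
  have hind : ∀ h : FreeGroup (Fin N) ⧸ Subgroup.zpowers γ,
      ((Γ.cover x₀).cyl l).indicator (1 : (Γ.cover x₀).Boundary2 → ℝ≥0∞) (C.marking h.out • P) =
      if h ∈ s.image f then 1 else 0 := by
    intro h
    rw [Set.indicator_apply]
    refine if_congr ⟨fun hh => ?_, fun hh => ?_⟩ rfl rfl
    · obtain ⟨m, hm⟩ := (hT.mem_cyl_iff_of_line (c := c.deck (C.marking h.out))
        (by rw [Line.toEnd_backward_deck, hb]; rfl)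
        (by rw [Line.toEnd_forward_deck, hf]; rfl)).1 hh
      -- Move the occurrence into the period `0, …, |τ| - 1`.
      obtain ⟨k, i, hi, hki⟩ : ∃ (k : ℤ) (i : ℕ), i < τ.natAbs ∧ m = i + k * τ := by
        refine ⟨m / τ, (m % τ).toNat, ?_, ?_⟩
        · have := Int.emod_lt m hτ
          have := Int.emod_nonneg m hτ
          omega
        · rw [Int.toNat_of_nonneg (Int.emod_nonneg m hτ), mul_comm, Int.emod_add_mul_ediv]
      have hk := hc.zpow k
      rw [← map_zpow] at hk
      have h1 : ∀ j : ℕ, C.marking (h.out * γ ^ k) • c.edge (i + j) =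
          (c.deck (C.marking h.out)).edge (m + j) := fun j => by
        rw [map_mul, mul_smul, hk, hki]
        exact congrArg (fun i => C.marking h.out • c.edge i) (by ring)
      have h2 : ∀ (j : ℕ) (hj : j < l.length), (c.edge (i + j)).proj = l[j].proj :=
        fun j hj => by rw [← hm j hj, ← h1, proj_smul]
      refine Finset.mem_image.2 ⟨i, ?_, ?_⟩
      · rw [hs, Finset.mem_filter, Finset.mem_range]
        exact ⟨hi, h2⟩
      · have h3 := h1 0
        rw [hm 0 hl0, Nat.cast_zero, add_zero, ← hH i h2] at h3
        have h4 := eq_one_of_smul_edge_eq (g := (C.marking (H i))⁻¹ * C.marking (h.out * γ ^ k))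
          (by rw [mul_smul, h3, inv_smul_smul])
        have h5 := C.marking.injective (inv_mul_eq_one.1 h4)
        change ((H i : FreeGroup (Fin N)) : _ ⧸ _) = h
        rw [h5, ← QuotientGroup.out_eq' h, QuotientGroup.eq]
        simp only [QuotientGroup.out_eq']
        rw [mul_inv_rev, mul_assoc, inv_mul_cancel, mul_one]
        exact inv_mem (Subgroup.zpow_mem _ (Subgroup.mem_zpowers γ) k)
    · obtain ⟨i, hi, rfl⟩ := Finset.mem_image.1 hh
      rw [hs, Finset.mem_filter, Finset.mem_range] at hi
      obtain ⟨k, hk⟩ := hpow _ (QuotientGroup.eq.1 (QuotientGroup.out_eq' (f i)))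
      have h1 := hk.smul_eq hb hf
      rw [map_mul, map_inv, mul_smul, inv_smul_eq_iff] at h1
      rw [← h1]
      exact hmem _ _ hi.2 (hH i hi.2)
  rw [hocc, tsum_congr hind, tsum_eq_sum (s := s.image f) fun h hh => if_neg hh,
    Finset.sum_congr rfl fun h hh => if_pos hh, Finset.sum_const, Finset.card_image_of_injOn hinj,
    nsmul_eq_mul, mul_one]

lemma smul_flip (g : Γ.pi1 x₀) : g • flip P = flip (g • P) := rfl

/-- The weights of a counting current. -/
lemma countingMeasure_cyl (hc : c.IsTranslatedBy (C.marking γ) τ) (hτ : τ ≠ 0)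
    (hb : c.backward.toEnd = P.1.1) (hf : c.forward.toEnd = P.1.2)
    {l : List (Γ.CoverEdge x₀)} (hl : (Γ.cover x₀).IsGeodesic l) :
    countingMeasure C γ P ((Γ.cover x₀).cyl l) =
      occurrences (fun i => (c.edge i).proj) τ.natAbs (l.map CoverEdge.proj) +
      occurrences (fun i => (c.edge i).proj) τ.natAbs (Γ.invPath (l.map CoverEdge.proj)) := by
  have hm := hl.isOpen_cyl.measurableSet
  rw [countingMeasure, Measure.sum_apply _ hm, ← map_proj_invPath,
    ← tsum_indicator_cyl hc hτ hb hf hl, ← tsum_indicator_cyl hc hτ hb hf hl.invPath,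
    ← ENNReal.tsum_add]
  refine tsum_congr fun h => ?_
  rw [Measure.add_apply, Measure.dirac_apply' _ hm, Measure.dirac_apply' _ hm, smul_flip,
    ← flip_preimage_cyl]
  rfl

/-- The pole pair of a group element consists of the ends of an axis. -/
lemma IsPolePair.exists_axis (h : IsPolePair C γ P) :
    ∃ (c : (Γ.cover x₀).Line) (τ : ℤ), c.IsTranslatedBy (C.marking γ) τ ∧
      c.backward.toEnd = P.1.1 ∧ c.forward.toEnd = P.1.2 := by
  obtain ⟨c, hb, hf⟩ := (cover_isTree Γ x₀).exists_line P.2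
  have h1 := h.1
  have h2 := h.2
  simp only [map_pow, map_inv] at h1 h2
  have h3 := inv_smul_eq_iff.1 (smul_eq_of_convergesTo h1)
  have h4 := smul_eq_of_convergesTo h2
  obtain ⟨τ, hτ⟩ := (cover_isTree Γ x₀).line_unique (c := c) (d := c.deck (C.marking γ))
    (by rw [Line.toEnd_backward_deck, hb, ← h3]) (by rw [Line.toEnd_forward_deck, hf, h4])
  exact ⟨c, τ, fun i => congrFun (congrArg Line.edge hτ) i, hb, hf⟩

/-- The ends of an axis along which `γ` translates forward are the pole pair of `γ`. -/
lemma isPolePair_of_isTranslatedBy (hc : c.IsTranslatedBy (C.marking γ) τ) (hτ : 0 < τ)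
    (hb : c.backward.toEnd = P.1.1) (hf : c.forward.toEnd = P.1.2) : IsPolePair C γ P := by
  have key : ∀ {c : (Γ.cover x₀).Line} {g : Γ.pi1 x₀}, c.IsTranslatedBy g τ →
      (Γ.cover x₀).ConvergesTo (fun n => g ^ n • Γ.coverBase x₀) c.forward.toEnd := by
    intro c g hc q hq
    obtain ⟨m, hm⟩ := c.forward.exists_halfTree_subset hq
    obtain ⟨k, hk⟩ := (cover_isTree Γ x₀).exists_mem_halfTree c (Γ.coverBase x₀)
    refine Filter.eventually_atTop.2 ⟨(m - k).toNat, fun n hn => hm m le_rfl ?_⟩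
    have h1 : (m : ℤ) - n * τ ≤ k := by
      have h3 : (m - k : ℤ) ≤ n := Int.toNat_le.1 hn
      have h4 : (n : ℤ) * 1 ≤ n * τ := mul_le_mul_of_nonneg_left hτ (Int.natCast_nonneg n)
      omega
    have h2 := smul_mem_halfTree (g := g ^ n) (hk _ h1)
    rw [hc.pow, sub_add_cancel] at h2
    exact h2
  have hr : c.reverse.IsTranslatedBy (C.marking γ)⁻¹ τ := fun i => by
    change (C.marking γ)⁻¹ • (Γ.cover x₀).inv (c.edge (-1 - i)) =
      (Γ.cover x₀).inv (c.edge (-1 - (i + τ)))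
    rw [← cover_inv_smul, hc.inv]
    exact congrArg (fun i => (Γ.cover x₀).inv (c.edge i)) (by ring)
  constructor
  · simp only [map_pow, map_inv]
    rw [← hb, ← Line.forward_reverse]
    exact key hr
  · simp only [map_pow]
    rw [← hf]
    exact key hc

end Counting

/-! ### The intersection pairing -/

section Pairing

open MeasureTheory OrGraph

variable {N : ℕ} {V E : Type*} {Γ : OrGraph V E} {x₀ : V}

lemma SimplicialChart.exists_lift_edge (C : SimplicialChart N Γ x₀) (e : E) :
    ∃ q : Γ.CoverEdge x₀, q.proj = e := by
  obtain ⟨p, hp⟩ := C.connected.exists_coverVertex (x₀ := x₀) (Γ.o e)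
  exact ⟨⟨p, e, hp.symm⟩, rfl⟩

/-- A lift of an edge to the universal cover. -/
noncomputable def SimplicialChart.liftEdge (C : SimplicialChart N Γ x₀) (e : E) : Γ.CoverEdge x₀ :=
  (C.exists_lift_edge e).choose

lemma SimplicialChart.proj_liftEdge (C : SimplicialChart N Γ x₀) (e : E) :
    (C.liftEdge e).proj = e :=
  (C.exists_lift_edge e).choose_spec

lemma OrGraph.isGeodesic_singleton {T : OrGraph V E} (e : E) : T.IsGeodesic [e] :=
  ⟨by simp, List.isChain_singleton _, _, _, T.isPath_singleton e⟩

lemma GeodesicCurrent.continuous_integral {C : SimplicialChart N Γ x₀}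
    (f : CompactlySupportedContinuousMap (Γ.cover x₀).Boundary2 ℝ) :
    Continuous fun ν : GeodesicCurrent C => ∫ P, f P ∂ν.measure := by
  have h : Continuous fun ν : GeodesicCurrent C =>
      fun f : CompactlySupportedContinuousMap (Γ.cover x₀).Boundary2 ℝ => ∫ P, f P ∂ν.measure :=
    continuous_induced_dom
  exact (continuous_apply f).comp h

variable (C : SimplicialChart N Γ x₀) [Fintype E]

/-- Half of the sum of the weights of the oriented edges. -/
noncomputable def halfTotalWeight (ν : GeodesicCurrent C) : ℝ≥0 :=
  (∑ e, (ν.measure ((Γ.cover x₀).cyl [C.liftEdge e])).toNNReal) / 2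

variable {C}

lemma coe_halfTotalWeight (ν : GeodesicCurrent C) :
    (halfTotalWeight C ν : ℝ≥0∞) = (∑ e, ν.measure ((Γ.cover x₀).cyl [C.liftEdge e])) / 2 := by
  rw [halfTotalWeight, ENNReal.coe_div two_ne_zero, ENNReal.ofNNReal_finsetSum]
  congr 1
  exact Finset.sum_congr rfl fun e _ =>
    ENNReal.coe_toNNReal (ν.cyl_lt_top (isGeodesic_singleton _)).ne

lemma sum_occurrences_singleton (b : ℤ → E) (n : ℕ) :
    ∑ e, occurrences b n [e] = n := by
  classical
  have h := Finset.card_eq_sum_card_fiberwise (f := fun i : ℕ => b i) (s := Finset.range n)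
    (t := Finset.univ) (by simp)
  rw [Finset.card_range] at h
  refine Eq.trans (Finset.sum_congr rfl fun e _ => ?_) h.symm
  refine congrArg Finset.card (Finset.filter_congr fun i _ => ?_)
  refine ⟨fun h => by simpa using h 0 (by simp), fun h j hj => ?_⟩
  obtain rfl : j = 0 := by simpa using hj
  simpa using h

variable (C) in
/-- Half of the total weight of the edges is an intersection pairing: in one period of the axis
of `g` there are `‖g‖` edges, and the counting current sees each of them once in each
direction. -/
theorem isIntersectionPairing_halfTotalWeight [Finite V] :
    IsIntersectionPairing C (halfTotalWeight C) where
  continuous := by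
    change Continuous fun ν : GeodesicCurrent C =>
      (∑ e, (ν.measure ((Γ.cover x₀).cyl [C.liftEdge e])).toNNReal) / 2
    refine Continuous.div_const (continuous_finsetSum _ fun e _ => ?_) 2
    refine NNReal.isEmbedding_coe.continuous_iff.2 ?_
    have hc := (cover_isTree Γ x₀).isCompact_cyl (isGeodesic_singleton (C.liftEdge e))
    have ho := (isGeodesic_singleton (T := Γ.cover x₀) (C.liftEdge e)).isOpen_cyl
    refine (GeodesicCurrent.continuous_integral (hc.indicatorCc ho)).congr fun ν => ?_
    rw [hc.integral_indicatorCc ho]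
    rfl
  linear a b ν₁ ν₂ ν h := by
    have h1 : ∀ e, (ν.measure ((Γ.cover x₀).cyl [C.liftEdge e])).toNNReal =
        a * (ν₁.measure ((Γ.cover x₀).cyl [C.liftEdge e])).toNNReal +
        b * (ν₂.measure ((Γ.cover x₀).cyl [C.liftEdge e])).toNNReal := fun e => by
      have h2 := (ν₁.cyl_lt_top (isGeodesic_singleton (C.liftEdge e))).ne
      have h3 := (ν₂.cyl_lt_top (isGeodesic_singleton (C.liftEdge e))).ne
      rw [h, Measure.add_apply, Measure.smul_apply, Measure.smul_apply, ENNReal.smul_def,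
        ENNReal.smul_def, smul_eq_mul, smul_eq_mul,
        ENNReal.toNNReal_add (ENNReal.mul_ne_top ENNReal.coe_ne_top h2)
          (ENNReal.mul_ne_top ENNReal.coe_ne_top h3), ENNReal.toNNReal_mul, ENNReal.toNNReal_mul,
        ENNReal.toNNReal_coe, ENNReal.toNNReal_coe]
    simp only [halfTotalWeight, h1, Finset.sum_add_distrib, ← Finset.mul_sum]
    ring
  counting g hg P hP η hη := by
    obtain ⟨c, τ, hc, hb, hf⟩ := hP.exists_axis
    have hτ : τ ≠ 0 := hc.ne_zero fun h => hg (by simpa using h)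
    have h1 : translationLength C g = τ.natAbs := hc.iInf_pathDist
    have h2 : ∀ e, η.measure ((Γ.cover x₀).cyl [C.liftEdge e]) =
        ((occurrences (fun i => (c.edge i).proj) τ.natAbs [e] +
        occurrences (fun i => (c.edge i).proj) τ.natAbs [Γ.inv e] : ℕ) : ℝ≥0∞) := fun e => by
      rw [hη, countingMeasure_cyl hc hτ hb hf (isGeodesic_singleton _), List.map_singleton,
        C.proj_liftEdge, Nat.cast_add]
      rfl
    let σ : E ≃ E := ⟨Γ.inv, Γ.inv, Γ.inv_inv, Γ.inv_inv⟩
    have h3 : ∑ e, occurrences (fun i => (c.edge i).proj) τ.natAbs [Γ.inv e] = τ.natAbs :=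
      (Equiv.sum_comp σ fun e => occurrences (fun i => (c.edge i).proj) τ.natAbs [e]).trans
        (sum_occurrences_singleton _ _)
    simp only [halfTotalWeight, h2, ENNReal.toNNReal_natCast]
    rw [← Nat.cast_sum, Finset.sum_add_distrib, sum_occurrences_singleton, h3, h1, Nat.cast_add,
      add_self_div_two]

end Pairing

/-! ### Currents on which the pairing is determined by its values at counting currents -/

section Rational

open MeasureTheory OrGraph

variable {N : ℕ} {V E : Type*} {Γ : OrGraph V E} {x₀ : V} {C : SimplicialChart N Γ x₀}

/-- All intersection pairings have the same value at `ν`. -/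
def GeodesicCurrent.IsPairingDetermined (ν : GeodesicCurrent C) : Prop :=
  ∀ I J, IsIntersectionPairing C I → IsIntersectionPairing C J → I ν = J ν

lemma GeodesicCurrent.isPairingDetermined_of_linear {a b : ℝ≥0} {ν₁ ν₂ ν : GeodesicCurrent C}
    (h₁ : ν₁.IsPairingDetermined) (h₂ : ν₂.IsPairingDetermined)
    (h : ν.measure = a • ν₁.measure + b • ν₂.measure) : ν.IsPairingDetermined :=
  fun I J hI hJ => by
    rw [hI.linear a b ν₁ ν₂ ν h, hJ.linear a b ν₁ ν₂ ν h, h₁ I J hI hJ, h₂ I J hI hJ]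

/-- Bi-infinite paths lift to the universal cover. -/
lemma SimplicialChart.exists_lift_line (C : SimplicialChart N Γ x₀) (b : Γ.Line) :
    ∃ c : (Γ.cover x₀).Line, ∀ i, (c.edge i).proj = b.edge i := by
  obtain ⟨p, hp⟩ := C.connected.exists_coverVertex (x₀ := x₀) (Γ.o (b.edge 0))
  have h1 : Γ.o (b.forward.edge 0) = p.term := hp.symm
  have h2 : Γ.o (b.backward.edge 0) = p.term := by
    rw [hp]
    have := (b.isReduced (-1)).1
    exact this
  have hstart : ∀ (r : Γ.Ray) (h : Γ.o (r.edge 0) = p.term),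
      ((r.lift p h).edge 0).start = p := fun r h =>
    CoverVertex.ext (by simp [Ray.lift, Ray.take, word]) h
  have h3 : (Γ.cover x₀).o ((b.backward.lift p h2).edge 0) =
      (Γ.cover x₀).o ((b.forward.lift p h1).edge 0) :=
    (hstart _ h2).trans (hstart _ h1).symm
  have h4 : (b.backward.lift p h2).edge 0 ≠ (b.forward.lift p h1).edge 0 := by
    intro h
    have h5 : Γ.inv (b.edge (-1 - ((0 : ℕ) : ℤ))) = b.edge ((0 : ℕ) : ℤ) :=
      congrArg CoverEdge.proj h
    exact (b.isReduced (-1)).2 (by simpa using h5.symm)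
  refine ⟨Line.join _ _ h3 h4, fun i => ?_⟩
  match i with
  | Int.ofNat n => rfl
  | Int.negSucc n =>
    change Γ.inv (Γ.inv (b.edge (-1 - (n : ℤ)))) = _
    rw [Γ.inv_inv]
    exact congrArg b.edge (by omega)

lemma OrGraph.invPath_invPath (l : List E) : Γ.invPath (Γ.invPath l) = l := by
  simp [invPath, Function.comp_def, Γ.inv_inv]

/-- Every periodic bi-infinite path is the projection of the axis of a group element, and the
counting current of this element is a geodesic current. -/
lemma SimplicialChart.exists_counting_current [Finite V] [Finite E] (C : SimplicialChart N Γ x₀)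
    (b : Γ.Line) {n : ℕ} (hn : 0 < n) (hb : ∀ i, b.edge (i + n) = b.edge i) :
    ∃ η : GeodesicCurrent C, η.IsPairingDetermined ∧ ∀ l, (Γ.cover x₀).IsGeodesic l →
      η.measure ((Γ.cover x₀).cyl l) = occurrences b.edge n (l.map CoverEdge.proj) +
        occurrences b.edge n (Γ.invPath (l.map CoverEdge.proj)) := by
  obtain ⟨c, hc⟩ := C.exists_lift_line b
  obtain ⟨g, hg⟩ := exists_smul_edge_eq (q := c.edge 0) (q' := c.edge n)
    (by rw [hc, hc, ← hb 0, zero_add])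
  obtain ⟨γ, rfl⟩ := C.marking.surjective g
  have hγ : c.IsTranslatedBy (C.marking γ) n := fun i => by
    have : c.deck (C.marking γ) = c.shift n := Line.eq_of_proj_eq (fun i => by
      change (c.edge i).proj = (c.edge (i + n)).proj
      rw [hc, hc, hb]) (hg.trans (congrArg c.edge (zero_add _).symm))
    exact congrFun (congrArg Line.edge this) i
  have hn' : (n : ℤ) ≠ 0 := by omega
  have hne : c.backward.toEnd ≠ c.forward.toEnd := fun h =>
    Set.disjoint_left.1 ((cover_isTree Γ x₀).disjoint_shadow_inv (c.edge 0))
      (c.forward_mem_shadow 0) (h ▸ c.backward_mem_shadow 0)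
  let P : (Γ.cover x₀).Boundary2 := ⟨(c.backward.toEnd, c.forward.toEnd), hne⟩
  have hw : ∀ l, (Γ.cover x₀).IsGeodesic l → countingMeasure C γ P ((Γ.cover x₀).cyl l) =
      occurrences b.edge n (l.map CoverEdge.proj) +
        occurrences b.edge n (Γ.invPath (l.map CoverEdge.proj)) := fun l hl => by
    rw [countingMeasure_cyl (P := P) hγ hn' rfl rfl hl, Int.natAbs_natCast, funext hc]
  refine ⟨GeodesicCurrent.ofWeights C (countingMeasure C γ P) (fun l hl => ?_)
    (fun l m hl hm h => ?_) fun l hl => ?_, fun I J hI hJ => ?_, hw⟩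
  · rw [hw l hl]
    exact ENNReal.add_lt_top.2 ⟨ENNReal.natCast_lt_top _, ENNReal.natCast_lt_top _⟩
  · rw [hw l hl, hw m hm, h]
  · rw [hw l hl, hw _ hl.invPath, map_proj_invPath, invPath_invPath, add_comm]
  · have hγ1 : γ ≠ 1 := by
      rintro rfl
      rw [map_one, one_smul] at hg
      exact hn' ((cover_isTree Γ x₀).line_edge_injective c hg).symm
    have hP := isPolePair_of_isTranslatedBy (P := P) hγ (by omega) rfl rfl
    rw [hI.counting γ hγ1 P hP _ rfl, hJ.counting γ hγ1 P hP _ rfl]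

end Rational

/-! ### Decomposition of circulations into cycles -/

section Circulation

open OrGraph

variable {V E : Type*} {Γ : OrGraph V E}

lemma occurrences_eq_card_segment [DecidableEq E] (b : Γ.Line) (n : ℕ) {K : ℕ} {v : List E}
    (hv : v.length = K) :
    occurrences b.edge n v = ((Finset.range n).filter fun i : ℕ => b.segment i K = v).card := by
  refine congrArg Finset.card (Finset.ext fun i => ?_)
  simp only [Finset.mem_filter]
  refine and_congr_right fun _ => ⟨fun h => ?_, ?_⟩
  · refine List.ext_getElem (by rw [Line.length_segment, hv]) fun j h1 h2 => ?_
    rw [Line.getElem_segment, h j h2]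
  · rintro rfl j hj
    rw [Line.getElem_segment]

lemma Function.sum_range_succ_of_periodic (f : ℤ → ℕ) {n : ℕ} (hf : ∀ i, f (i + n) = f i) :
    ∑ i ∈ Finset.range n, f (i + 1) = ∑ i ∈ Finset.range n, f i := by
  have h1 := Finset.sum_range_succ (fun i : ℕ => f i) n
  have h2 := Finset.sum_range_succ' (fun i : ℕ => f i) n
  have h3 := hf 0
  rw [zero_add] at h3
  rw [h1, h3] at h2
  push_cast at h2
  omega

lemma OrGraph.t_eq_o_of_mem_Omega {K : ℕ} {v : List E} (hv : v ∈ Γ.Omega K) (h : 1 < v.length) :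
    Γ.t v[0] = Γ.o v[1] ∧ v[1] ≠ Γ.inv v[0] := by
  obtain ⟨-, h3, x, y, h4⟩ := hv
  match v with
  | [] => simp at h
  | [_] => simp at h
  | e :: f :: v => exact ⟨h4.2.1.symm, (isReduced_cons_cons.1 h3).1⟩

variable [Fintype E]

/-- The occurrences of words in a periodic sequence form a circulation. -/
lemma sum_occurrences_cons (b : Γ.Line) {n : ℕ} (hb : ∀ i, b.edge (i + n) = b.edge i)
    (t : List E) :
    ∑ e, occurrences b.edge n (e :: t) = ∑ e, occurrences b.edge n (t ++ [e]) := by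
  classical
  have hseg : ∀ i, b.segment (i + n) t.length = b.segment i t.length := fun i =>
    List.ext_getElem (by simp [Line.length_segment]) fun j h1 h2 => by
      rw [Line.getElem_segment, Line.getElem_segment, ← hb (i + j)]
      exact congrArg b.edge (by ring)
  have h1 : ∀ e, occurrences b.edge n (e :: t) = ∑ i ∈ Finset.range n,
      if b.segment (i + 1) t.length = t ∧ b.edge i = e then 1 else 0 := fun e => by
    rw [occurrences_eq_card_segment b n rfl, Finset.card_filter]
    refine Finset.sum_congr rfl fun i _ => if_congr ?_ rfl rfl
    rw [List.length_cons, Line.segment_succ, List.cons.injEq, and_comm]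
  have h2 : ∀ e, occurrences b.edge n (t ++ [e]) = ∑ i ∈ Finset.range n,
      if b.segment i t.length = t ∧ b.edge (i + t.length) = e then 1 else 0 := fun e => by
    rw [occurrences_eq_card_segment b n (List.length_append ..), Finset.card_filter]
    refine Finset.sum_congr rfl fun i _ => if_congr ?_ rfl rfl
    rw [List.length_singleton, Line.segment_succ']
    refine ⟨fun h => ?_, fun h => by rw [h.1, h.2]⟩
    have h3 := List.append_inj h (by rw [Line.length_segment])
    exact ⟨h3.1, by simpa using h3.2⟩
  have h3 : ∀ (p : ℕ → Prop) [DecidablePred p] (q : ℕ → E), ∑ e, ∑ i ∈ Finset.range n,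
      (if p i ∧ q i = e then 1 else 0) = ∑ i ∈ Finset.range n, if p i then 1 else 0 := by
    intro p _ q
    rw [Finset.sum_comm]
    refine Finset.sum_congr rfl fun i _ => ?_
    by_cases hp : p i <;> simp [hp]
  simp only [h1, h2]
  rw [h3 (fun i => b.segment (i + 1) t.length = t), h3 (fun i => b.segment i t.length = t)]
  exact Function.sum_range_succ_of_periodic (fun i => if b.segment i t.length = t then 1 else 0)
    fun i => by simp only [hseg]

/-- In the support of a nonzero circulation there is a cycle without repetitions. -/
lemma exists_cycle {K : ℕ} (hK : 2 ≤ K) {w : List E → ℝ≥0}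
    (hsupp : ∀ v, w v ≠ 0 → v ∈ Γ.Omega K)
    (hcons : ∀ t : List E, t.length + 1 = K → ∑ e, w (e :: t) = ∑ e, w (t ++ [e]))
    {v₀ : List E} (hv₀ : w v₀ ≠ 0) :
    ∃ (b : Γ.Line) (n : ℕ), 0 < n ∧ (∀ i, b.edge (i + n) = b.edge i) ∧
      (∀ i, w (b.segment i K) ≠ 0) ∧
      Set.InjOn (fun i : ℕ => b.segment i K) (Finset.range n) := by
  -- Every word of the support has a successor in the support.
  have hnext : ∀ v, w v ≠ 0 → ∃ v', w v' ≠ 0 ∧ ∃ e, v' = v.tail ++ [e] := by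
    intro v hv
    have hlen := (hsupp v hv).1
    cases v with
    | nil => simp at hlen; omega
    | cons a t =>
      have h1 : ∑ e, w (t ++ [e]) ≠ 0 := by
        rw [← hcons t hlen]
        exact fun h => hv (Finset.sum_eq_zero_iff.1 h a (Finset.mem_univ a))
      obtain ⟨e, -, he⟩ := Finset.exists_ne_zero_of_sum_ne_zero h1
      exact ⟨_, he, e, rfl⟩
  choose! F hF hF' using hnext
  have hiter : ∀ (v : List E), w v ≠ 0 → ∀ k, w (F^[k] v) ≠ 0 := by
    intro v hv k
    induction k with
    | zero => exact hv
    | succ k ih =>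
      rw [Function.iterate_succ_apply']
      exact hF _ ih
  have hfin : {v : List E | w v ≠ 0}.Finite :=
    (List.finite_length_eq E K).subset fun v hv => (hsupp v hv).1
  -- The orbit of `v₀` is finite, so it contains a periodic point `u`.
  obtain ⟨u, hu, n, hn, hper⟩ : ∃ u, w u ≠ 0 ∧ ∃ n, 0 < n ∧ Function.IsPeriodicPt F n u := by
    have : Finite {v : List E | w v ≠ 0} := hfin
    obtain ⟨i, j, hlt, h⟩ : ∃ i j, i < j ∧ F^[i] v₀ = F^[j] v₀ := by
      obtain ⟨i, j, hij, h⟩ := Finite.exists_ne_map_eq_of_infinite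
        fun k : ℕ => (⟨F^[k] v₀, hiter v₀ hv₀ k⟩ : {v : List E | w v ≠ 0})
      rcases hij.lt_or_gt with hlt | hlt
      · exact ⟨i, j, hlt, congrArg Subtype.val h⟩
      · exact ⟨j, i, hlt, (congrArg Subtype.val h).symm⟩
    refine ⟨_, hiter v₀ hv₀ i, j - i, by omega, ?_⟩
    rw [Function.IsPeriodicPt, Function.IsFixedPt, ← Function.iterate_add_apply,
      Nat.sub_add_cancel hlt.le, h]
  have hn := hper.minimalPeriod_pos hn
  set n := Function.minimalPeriod F u
  have hlen : ∀ k, (F^[k] u).length = K := fun k => (hsupp _ (hiter u hu k)).1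
  have hne : ∀ k, F^[k] u ≠ [] := fun k h => by
    have := hlen k
    rw [h, List.length_nil] at this
    omega
  let h : ℕ → E := fun k => (F^[k] u).head (hne k)
  have hmod : ∀ k, F^[k % n] u = F^[k] u := fun k => Function.iterate_mod_minimalPeriod_eq
  have hh : ∀ k l, F^[k] u = F^[l] u → h k = h l := fun k l hkl => by
    simp only [h, hkl]
  have hget : ∀ (j k : ℕ) (hj : j < (F^[k] u).length), (F^[k] u)[j] = h (k + j) := by
    intro j
    induction j with
    | zero => exact fun k hj => (List.head_eq_getElem _).symm
    | succ j ih =>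
      intro k hj
      have h1 := hF' _ (hiter u hu k)
      have h2 : j < (F^[k + 1] u).length := by rw [hlen] at hj ⊢; omega
      have h3 := ih (k + 1) h2
      rw [add_assoc, add_comm 1 j] at h3
      rw [← h3]
      obtain ⟨e, he⟩ := h1
      rw [← Function.iterate_succ_apply' F k u] at he
      have h4 : j < (F^[k] u).tail.length := by rw [List.length_tail]; omega
      simp only [he]
      rw [List.getElem_append_left h4, List.getElem_tail]
  let B : ℤ → E := fun i => h (i % n).toNat
  have hB : ∀ (i : ℤ) (j : ℕ), B (i + j) = h ((i % n).toNat + j) := by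
    intro i j
    refine hh _ _ ?_
    rw [← hmod ((i % n).toNat + j)]
    have hn' : (n : ℤ) ≠ 0 := by omega
    have h1 := Int.emod_nonneg i hn'
    have : ((i + j) % n).toNat = ((i % n).toNat + j) % n := by
      zify
      rw [Int.toNat_of_nonneg (Int.emod_nonneg _ hn'), Int.toNat_of_nonneg h1, Int.emod_add_emod]
    rw [this]
  have hred : ∀ i, Γ.t (B i) = Γ.o (B (i + 1)) ∧ B (i + 1) ≠ Γ.inv (B i) := by
    intro i
    have h1 := hB i 1
    rw [Nat.cast_one] at h1
    rw [h1]
    change Γ.t (h (i % n).toNat) = _ ∧ _ ≠ Γ.inv (h (i % n).toNat)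
    set k := (i % n).toNat
    have h2 := hlen k
    have h5 := hget 0 k (by omega)
    have h6 := hget 1 k (by omega)
    rw [add_zero] at h5
    rw [← h5, ← h6]
    exact t_eq_o_of_mem_Omega (hsupp _ (hiter u hu k)) _
  have hseg : ∀ i, (⟨B, hred⟩ : Γ.Line).segment i K = F^[(i % n).toNat] u := by
    intro i
    refine List.ext_getElem (by rw [Line.length_segment, hlen]) fun j h1 h2 => ?_
    rw [Line.getElem_segment, hget]
    exact hB i j
  refine ⟨⟨B, hred⟩, n, hn, fun i => ?_, fun i => ?_, fun i hi j hj hij => ?_⟩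
  · change h ((i + n) % n).toNat = h (i % n).toNat
    rw [Int.add_emod_right]
  · rw [hseg]
    exact hiter u hu _
  · simp only [Finset.coe_range, Set.mem_Iio] at hi hj
    simp only [hseg, ← Int.natCast_mod, Int.toNat_natCast, Nat.mod_eq_of_lt hi,
      Nat.mod_eq_of_lt hj] at hij
    exact Function.iterate_injOn_Iio_minimalPeriod hi hj hij

end Circulation

section CirculationCurrent

open MeasureTheory OrGraph

variable {N : ℕ} {V E : Type*} {Γ : OrGraph V E} {x₀ : V} {C : SimplicialChart N Γ x₀}

/-- The linear combination `a ν₁ + b ν₂` of geodesic currents. -/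
noncomputable def GeodesicCurrent.linearComb (a b : ℝ≥0) (ν₁ ν₂ : GeodesicCurrent C) :
    GeodesicCurrent C where
  measure := a • ν₁.measure + b • ν₂.measure
  finite_on_compact K hK := by
    simp only [Measure.add_apply, Measure.smul_apply, ENNReal.smul_def, smul_eq_mul]
    exact ENNReal.add_lt_top.2
      ⟨ENNReal.mul_lt_top ENNReal.coe_lt_top (ν₁.finite_on_compact K hK),
        ENNReal.mul_lt_top ENNReal.coe_lt_top (ν₂.finite_on_compact K hK)⟩
  invariant g A hA := by
    simp only [Measure.add_apply, Measure.smul_apply, ν₁.invariant g A hA, ν₂.invariant g A hA]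
  flip_invariant A hA := by
    simp only [Measure.add_apply, Measure.smul_apply, ν₁.flip_invariant A hA,
      ν₂.flip_invariant A hA]

/-- Every circulation on the reduced words of length `K` is the weight function of a geodesic
current, up to symmetrization. This current is a combination of counting currents: subtract from
the circulation a multiple of a cycle that makes its support smaller, and use induction. -/
theorem exists_current_of_circulation [Finite V] [Fintype E] (C : SimplicialChart N Γ x₀) {K : ℕ}
    (hK : 2 ≤ K) (w : List E → ℝ≥0) (hsupp : ∀ v, w v ≠ 0 → v ∈ Γ.Omega K)
    (hcons : ∀ t : List E, t.length + 1 = K → ∑ e, w (e :: t) = ∑ e, w (t ++ [e])) :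
    ∃ ν : GeodesicCurrent C, ν.IsPairingDetermined ∧ ∀ l, (Γ.cover x₀).IsGeodesic l →
      l.length = K → ν.measure ((Γ.cover x₀).cyl l) =
        w (l.map CoverEdge.proj) + w (Γ.invPath (l.map CoverEdge.proj)) := by
  classical
  induction hm : {v | w v ≠ 0}.ncard using Nat.strong_induction_on generalizing w with
  | _ m ih =>
  by_cases hw : ∃ v₀, w v₀ ≠ 0
  · obtain ⟨v₀, hv₀⟩ := hw
    obtain ⟨b, n, hn, hb, hbw, hinj⟩ := exists_cycle hK hsupp hcons hv₀
    obtain ⟨η, hη, hηw⟩ := C.exists_counting_current b hn hb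
    -- The smallest value of `w` on the cycle.
    obtain ⟨i₀, hi₀, hmin⟩ := Finset.exists_min_image (Finset.range n)
      (fun i : ℕ => w (b.segment i K)) ⟨0, Finset.mem_range.2 hn⟩
    set δ := w (b.segment i₀ K)
    have hocc : ∀ v : List E, v.length = K → occurrences b.edge n v =
        if ∃ i ∈ Finset.range n, b.segment (i : ℕ) K = v then 1 else 0 := by
      intro v hv
      rw [occurrences_eq_card_segment b n hv]
      split_ifs with h
      · obtain ⟨i, hi, rfl⟩ := h
        refine Finset.card_eq_one.2 ⟨i, Finset.ext fun j => ?_⟩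
        rw [Finset.mem_filter, Finset.mem_singleton]
        exact ⟨fun h => hinj h.1 hi h.2, fun h => by rw [h]; exact ⟨hi, rfl⟩⟩
      · exact Finset.card_eq_zero.2 (Finset.filter_eq_empty_iff.2 fun i hi h' => h ⟨i, hi, h'⟩)
    have hle : ∀ v : List E, v.length = K → δ * occurrences b.edge n v ≤ w v := by
      intro v hv
      rw [hocc v hv]
      split_ifs with h
      · obtain ⟨i, hi, rfl⟩ := h
        simpa using hmin i hi
      · simp
    let w' : List E → ℝ≥0 := fun v => w v - δ * occurrences b.edge n v
    have hw' : ∀ v : List E, v.length = K → w v = w' v + δ * occurrences b.edge n v :=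
      fun v hv => (tsub_add_cancel_of_le (hle v hv)).symm
    have hsub : ∀ v, w' v ≠ 0 → w v ≠ 0 := fun v h h0 => h (by simp [w', h0])
    have hfin : {v : List E | w v ≠ 0}.Finite :=
      (List.finite_length_eq E K).subset fun v hv => (hsupp v hv).1
    have hlt : {v | w' v ≠ 0}.ncard < m := by
      rw [← hm]
      refine Set.ncard_lt_ncard ⟨fun v => hsub v, fun h => ?_⟩ hfin
      refine h (hbw i₀) ?_
      simp only [w']
      rw [hocc _ (b.length_segment _ _), if_pos ⟨i₀, hi₀, rfl⟩, Nat.cast_one, mul_one, tsub_self]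
    obtain ⟨ν, hν, hνw⟩ := ih _ hlt w' (fun v hv => hsupp v (hsub v hv)) (fun t ht => by
      have h1 := hcons t ht
      rw [Finset.sum_congr rfl fun e _ => hw' (e :: t) (by simpa using ht),
        Finset.sum_congr rfl fun e _ => hw' (t ++ [e]) (by simpa using ht),
        Finset.sum_add_distrib, Finset.sum_add_distrib, ← Finset.mul_sum, ← Finset.mul_sum,
        ← Nat.cast_sum, ← Nat.cast_sum, sum_occurrences_cons b hb] at h1
      exact add_right_cancel h1) rfl
    refine ⟨.linearComb 1 δ ν η, GeodesicCurrent.isPairingDetermined_of_linear hν hη rfl,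
      fun l hl hlK => ?_⟩
    have h2 : (l.map CoverEdge.proj).length = K := by simpa using hlK
    have h3 : (Γ.invPath (l.map CoverEdge.proj)).length = K := by simpa [invPath] using hlK
    change ((1 : ℝ≥0) • ν.measure + δ • η.measure) _ = _
    rw [Measure.add_apply, Measure.smul_apply, Measure.smul_apply, one_smul, hνw l hl hlK,
      hηw l hl, hw' _ h2, hw' _ h3, ENNReal.smul_def, smul_eq_mul]
    push_cast
    ring
  · push Not at hw
    refine ⟨.ofWeights C 0 (by simp) (by simp) (by simp), fun I J hI hJ => ?_, fun l _ _ => ?_⟩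
    · have h := fun ν : GeodesicCurrent C => fun h : ν.measure = 0 =>
        And.intro (hI.linear 0 0 ν ν ν (by simp [h])) (hJ.linear 0 0 ν ν ν (by simp [h]))
      obtain ⟨h1, h2⟩ := h (.ofWeights C 0 (by simp) (by simp) (by simp)) rfl
      rw [h1, h2]
      simp
    · simp [hw, GeodesicCurrent.ofWeights]

end CirculationCurrent

/-! ### The weights of the Markov chain -/

namespace FSMC

open OrGraph

variable {V E : Type*} {Γ : OrGraph V E} {S : Finset E} {X : FSMC S} {μ₀ : S → ℝ}

lemma extP_nonneg (X : FSMC S) (e e' : E) : 0 ≤ X.extP e e' := by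
  unfold extP
  split_ifs
  · exact X.nonneg _ _
  · exact le_rfl

lemma extDist_nonneg (h : ∀ s, 0 ≤ μ₀ s) (e : E) : 0 ≤ extDist μ₀ e := by
  unfold extDist
  split_ifs
  · exact h _
  · exact le_rfl

lemma pathProb_nonneg (X : FSMC S) : ∀ v, 0 ≤ X.pathProb v
  | [] => zero_le_one
  | [_] => zero_le_one
  | e :: e' :: l => mul_nonneg (X.extP_nonneg e e') (pathProb_nonneg X (e' :: l))

lemma iterProb_nonneg (X : FSMC S) (h : ∀ s, 0 ≤ μ₀ s) : ∀ v, 0 ≤ X.iterProb μ₀ v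
  | [] => zero_le_one
  | e :: l => mul_nonneg (extDist_nonneg h e) (X.pathProb_nonneg (e :: l))

lemma pathProb_append (X : FSMC S) (e : E) :
    ∀ {v : List E} (hv : v ≠ []), X.pathProb (v ++ [e]) = X.pathProb v * X.extP (v.getLast hv) e
  | [], hv => absurd rfl hv
  | [a], _ => mul_comm _ _
  | a :: b :: l, _ => by
    have h := pathProb_append X e (v := b :: l) (by simp)
    change X.extP a b * X.pathProb (b :: l ++ [e]) = X.extP a b * X.pathProb (b :: l) * _
    rw [h, List.getLast_cons_cons, mul_assoc]

lemma iterProb_append (X : FSMC S) (e : E) {v : List E} (hv : v ≠ []) :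
    X.iterProb μ₀ (v ++ [e]) = X.iterProb μ₀ v * X.extP (v.getLast hv) e := by
  cases v with
  | nil => exact absurd rfl hv
  | cons a l =>
    change extDist μ₀ a * X.pathProb (a :: l ++ [e]) = extDist μ₀ a * X.pathProb (a :: l) * _
    rw [X.pathProb_append e hv, mul_assoc]

lemma getLast_mem_of_iterProb_ne_zero {v : List E} (hv : v ≠ []) (h : X.iterProb μ₀ v ≠ 0) :
    v.getLast hv ∈ S := by
  obtain ⟨l, e, rfl⟩ := List.eq_nil_or_concat' v |>.resolve_left hv
  rw [List.getLast_append_singleton]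
  by_contra he
  refine h ?_
  rcases eq_or_ne l [] with rfl | hl
  · exact mul_eq_zero_of_left (dif_neg he) _
  · rw [X.iterProb_append e hl]
    exact mul_eq_zero_of_right _ (dif_neg fun h => he h.2)

lemma sum_eq_sum_states [Fintype E] (f : E → ℝ) (h : ∀ e ∉ S, f e = 0) : ∑ e, f e = ∑ s : S, f s :=
  (Finset.sum_subset (Finset.subset_univ S) fun e _ he => h e he).symm.trans
    (Finset.sum_coe_sort S f).symm

/-- The weight of a word is the sum of the weights of its continuations to the right, since the
rows of the transition matrix sum to one. -/
lemma sum_iterProb_append [Fintype E] (X : FSMC S) {v : List E} (hv : v ≠ []) :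
    ∑ e, X.iterProb μ₀ (v ++ [e]) = X.iterProb μ₀ v := by
  simp only [X.iterProb_append _ hv, ← Finset.mul_sum]
  by_cases h : X.iterProb μ₀ v = 0
  · rw [h, zero_mul]
  · have hS := getLast_mem_of_iterProb_ne_zero hv h
    rw [sum_eq_sum_states _ fun e he => dif_neg fun h => he h.2]
    refine (congrArg _ (Eq.trans ?_ (X.row_sum ⟨_, hS⟩))).trans (mul_one _)
    exact Finset.sum_congr rfl fun s _ => dif_pos ⟨hS, s.2⟩

/-- The weight of a word is the sum of the weights of its continuations to the left, since the
distribution is stationary. -/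
lemma sum_iterProb_cons [Fintype E] (hμ₀ : X.IsStationary μ₀) {v : List E} (hv : v ≠ []) :
    ∑ e, X.iterProb μ₀ (e :: v) = X.iterProb μ₀ v := by
  cases v with
  | nil => exact absurd rfl hv
  | cons a l =>
    have h1 : ∀ e, X.iterProb μ₀ (e :: a :: l) =
        extDist μ₀ e * X.extP e a * X.pathProb (a :: l) := fun e => (mul_assoc _ _ _).symm
    simp only [h1, ← Finset.sum_mul]
    change _ = extDist μ₀ a * X.pathProb (a :: l)
    congr 1
    by_cases ha : a ∈ S
    · refine (sum_eq_sum_states _ fun e he => mul_eq_zero_of_left (dif_neg he) _).trans ?_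
      have h2 : extDist μ₀ a = μ₀ ⟨a, ha⟩ := dif_pos ha
      rw [h2, ← hμ₀.2.2 ⟨a, ha⟩]
      refine Finset.sum_congr rfl fun s _ => ?_
      rw [extDist, extP, dif_pos s.2, dif_pos ⟨s.2, ha⟩]
    · rw [extDist, dif_neg ha]
      exact Finset.sum_eq_zero fun e _ => mul_eq_zero_of_right _ (dif_neg fun h => ha h.2)

lemma sum_extDist [Fintype E] (hμ₀ : X.IsStationary μ₀) : ∑ e, extDist μ₀ e = 1 := by
  refine (sum_eq_sum_states _ fun e he => dif_neg he).trans (Eq.trans ?_ hμ₀.2.1)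
  exact Finset.sum_congr rfl fun s _ => dif_pos s.2

lemma t_eq_o_of_extP_ne_zero (hX : X.IsBased Γ) {e e' : E} (h : X.extP e e' ≠ 0) :
    Γ.t e = Γ.o e' ∧ e' ≠ Γ.inv e := by
  unfold extP at h
  split_ifs at h with hS
  · exact hX.2 ⟨e, hS.1⟩ ⟨e', hS.2⟩ (lt_of_le_of_ne (X.nonneg _ _) h.symm)
  · exact absurd rfl h

/-- Words of positive weight are reduced paths. -/
lemma mem_Omega_of_iterProb_ne_zero (hX : X.IsBased Γ) {v : List E} (hv : v ≠ [])
    (h : X.iterProb μ₀ v ≠ 0) : v ∈ Γ.Omega v.length := by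
  have key : ∀ v : List E, (hv : v ≠ []) → X.pathProb v ≠ 0 →
      Γ.IsReduced v ∧ ∃ y, Γ.IsPath (Γ.o (v.head hv)) v y := by
    intro v
    induction v with
    | nil => exact fun hv => absurd rfl hv
    | cons e v ih =>
      intro _ h
      cases v with
      | nil => exact ⟨List.isChain_singleton _, _, Γ.isPath_singleton e⟩
      | cons f v =>
        obtain ⟨h1, h2⟩ := mul_ne_zero_iff.1 (show X.extP e f * X.pathProb (f :: v) ≠ 0 from h)
        obtain ⟨h3, y, h4⟩ := ih (by simp) h2
        obtain ⟨h5, h6⟩ := t_eq_o_of_extP_ne_zero hX h1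
        exact ⟨isReduced_cons_cons.2 ⟨h6, h3⟩, y, rfl, by rwa [h5]⟩
  cases v with
  | nil => exact absurd rfl hv
  | cons e v =>
    obtain ⟨h1, y, h2⟩ := key _ hv (mul_ne_zero_iff.1 h).2
    exact ⟨rfl, h1, _, y, h2⟩

end FSMC

/-! ### The current of the Markov chain -/

section MarkovCurrent

open MeasureTheory OrGraph Filter Topology

variable {N : ℕ} {V E : Type*} {Γ : OrGraph V E} {x₀ : V} {S : Finset E} {X : FSMC S}
  {μ₀ : S → ℝ}

/-- The weight `μ₀[k](v) + μ₀[k](v⁻¹)` of a path. -/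
noncomputable def markovWeight (Γ : OrGraph V E) (X : FSMC S) (μ₀ : S → ℝ) (v : List E) : ℝ≥0∞ :=
  ENNReal.ofReal (X.iterProb μ₀ v + X.iterProb μ₀ (Γ.invPath v))

lemma markovWeight_invPath (v : List E) :
    markovWeight Γ X μ₀ (Γ.invPath v) = markovWeight Γ X μ₀ v := by
  rw [markovWeight, invPath_invPath, add_comm, markovWeight]

lemma OrGraph.invPath_append_singleton (v : List E) (e : E) :
    Γ.invPath (v ++ [e]) = Γ.inv e :: Γ.invPath v := by
  simp [invPath]

lemma OrGraph.invPath_ne_nil {v : List E} (hv : v ≠ []) : Γ.invPath v ≠ [] := by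
  simpa [invPath] using hv

lemma sum_markovWeight_append [Fintype E] (hμ₀ : X.IsStationary μ₀) {v : List E} (hv : v ≠ []) :
    ∑ e, markovWeight Γ X μ₀ (v ++ [e]) = markovWeight Γ X μ₀ v := by
  unfold markovWeight
  rw [← ENNReal.ofReal_sum_of_nonneg fun e _ =>
    add_nonneg (X.iterProb_nonneg hμ₀.1 _) (X.iterProb_nonneg hμ₀.1 _), Finset.sum_add_distrib,
    X.sum_iterProb_append hv, ← FSMC.sum_iterProb_cons hμ₀ (invPath_ne_nil hv)]
  simp only [invPath_append_singleton]
  let σ : E ≃ E := ⟨Γ.inv, Γ.inv, Γ.inv_inv, Γ.inv_inv⟩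
  exact congrArg _ (congrArg _ (Equiv.sum_comp σ fun e => X.iterProb μ₀ (e :: Γ.invPath v)))

lemma markovWeight_eq_zero (hX : X.IsBased Γ) {v : List E} (hv : v ≠ [])
    (h : v ∉ Γ.Omega v.length) : markovWeight Γ X μ₀ v = 0 := by
  have h1 : X.iterProb μ₀ v = 0 := by
    by_contra h1
    exact h (FSMC.mem_Omega_of_iterProb_ne_zero hX hv h1)
  have h2 : X.iterProb μ₀ (Γ.invPath v) = 0 := by
    by_contra h2
    obtain ⟨-, h3, x, y, h4⟩ := FSMC.mem_Omega_of_iterProb_ne_zero hX (invPath_ne_nil hv) h2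
    have h5 := isReduced_invPath h3
    have h6 := Γ.isPath_invPath h4
    rw [invPath_invPath] at h5 h6
    exact h ⟨rfl, h5, y, x, h6⟩
  rw [markovWeight, h1, h2, add_zero, ENNReal.ofReal_zero]

/-- The weights of the Markov chain on words of bounded length are the weights of a combination of
counting currents. -/
lemma exists_current_markovWeight_of_le [Finite V] [Fintype E] (C : SimplicialChart N Γ x₀)
    (hX : X.IsBased Γ) (hμ₀ : X.IsStationary μ₀) {K : ℕ} (hK : 2 ≤ K) :
    ∃ ν : GeodesicCurrent C, ν.IsPairingDetermined ∧ ∀ l, (Γ.cover x₀).IsGeodesic l →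
      l.length ≤ K →
        ν.measure ((Γ.cover x₀).cyl l) = markovWeight Γ X μ₀ (l.map CoverEdge.proj) := by
  classical
  let w : List E → ℝ≥0 := fun v => if v.length = K then (X.iterProb μ₀ v).toNNReal else 0
  have hsupp : ∀ v, w v ≠ 0 → v ∈ Γ.Omega K := by
    intro v hv
    simp only [w, ne_eq, ite_eq_right_iff, not_forall] at hv
    obtain ⟨rfl, h⟩ := hv
    refine FSMC.mem_Omega_of_iterProb_ne_zero (X := X) (μ₀ := μ₀) hX ?_ fun h0 => h (by simp [h0])
    rintro rfl
    simp at hK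
  have hcons : ∀ t : List E, t.length + 1 = K → ∑ e, w (e :: t) = ∑ e, w (t ++ [e]) := by
    intro t ht
    have ht0 : t ≠ [] := by
      rintro rfl
      simp at ht
      omega
    have h1 : ∀ e, w (e :: t) = (X.iterProb μ₀ (e :: t)).toNNReal := fun e => if_pos (by simpa)
    have h2 : ∀ e, w (t ++ [e]) = (X.iterProb μ₀ (t ++ [e])).toNNReal := fun e =>
      if_pos (by simpa)
    simp only [h1, h2]
    rw [← Real.toNNReal_sum_of_nonneg fun e _ => X.iterProb_nonneg hμ₀.1 _,
      ← Real.toNNReal_sum_of_nonneg fun e _ => X.iterProb_nonneg hμ₀.1 _,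
      X.sum_iterProb_append ht0, FSMC.sum_iterProb_cons hμ₀ ht0]
  obtain ⟨ν, hν, hw⟩ := exists_current_of_circulation C hK w hsupp hcons
  refine ⟨ν, hν, fun l hl hlK => ?_⟩
  induction hd : K - l.length generalizing l with
  | zero =>
    have hlK : l.length = K := by omega
    have h1 : w (l.map CoverEdge.proj) = (X.iterProb μ₀ (l.map CoverEdge.proj)).toNNReal :=
      if_pos (by simpa using hlK)
    have h2 : w (Γ.invPath (l.map CoverEdge.proj)) =
        (X.iterProb μ₀ (Γ.invPath (l.map CoverEdge.proj))).toNNReal :=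
      if_pos (by simpa [invPath] using hlK)
    rw [hw l hl hlK, h1, h2, markovWeight, ENNReal.ofReal_add (X.iterProb_nonneg hμ₀.1 _)
      (X.iterProb_nonneg hμ₀.1 _)]
    rfl
  | succ d ih =>
    have hl0 : l.map CoverEdge.proj ≠ [] := by simpa using hl.1
    rw [measure_cyl_eq_sum ν.measure hl (W := markovWeight Γ X μ₀)
      (fun m hm hml => ih m hm (by omega) (by omega)) fun e he =>
        markovWeight_eq_zero hX (by simp) (by simpa using he), sum_markovWeight_append hμ₀ hl0]

/-- The current of a Markov chain, as a limit of combinations of counting currents. -/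
lemma exists_current_markovWeight [Finite V] [Fintype E] (C : SimplicialChart N Γ x₀)
    (hX : X.IsBased Γ) (hμ₀ : X.IsStationary μ₀) :
    ∃ ν : GeodesicCurrent C, ν.IsPairingDetermined ∧ ∀ l, (Γ.cover x₀).IsGeodesic l →
      ν.measure ((Γ.cover x₀).cyl l) = markovWeight Γ X μ₀ (l.map CoverEdge.proj) := by
  have h := fun k : ℕ => exists_current_markovWeight_of_le C hX hμ₀ (Nat.le_add_left 2 k)
  choose ν hν hw using h
  have hfin := fun k => (ν k).isFiniteMeasureOnCompacts
  have hT := cover_isTree Γ x₀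
  have hev : ∀ l, (Γ.cover x₀).IsGeodesic l → ∀ᶠ k in atTop,
      (ν k).measure ((Γ.cover x₀).cyl l) = markovWeight Γ X μ₀ (l.map CoverEdge.proj) :=
    fun l hl => eventually_atTop.2 ⟨l.length, fun k hk => hw k l hl (by omega)⟩
  obtain ⟨m, hm, hlim, hcyl⟩ := exists_measure_tendsto_integral (μ := fun k => (ν k).measure)
    hT.isTopologicalBasis_cylinders hT.isPiSystem_cylinders
    (by rintro _ ⟨l, hl, rfl⟩; exact hT.isCompact_cyl hl)
    (by rintro _ ⟨l, hl, rfl⟩; exact ⟨_, hev l hl⟩)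
  have hmw : ∀ l, (Γ.cover x₀).IsGeodesic l →
      m ((Γ.cover x₀).cyl l) = markovWeight Γ X μ₀ (l.map CoverEdge.proj) := fun l hl => by
    obtain ⟨k, h1, h2⟩ := ((hev l hl).and (hcyl _ ⟨l, hl, rfl⟩)).exists
    exact h2.symm.trans h1
  let ν' : GeodesicCurrent C := .ofWeights C m
    (fun l hl => by rw [hmw l hl]; exact ENNReal.ofReal_lt_top)
    (fun l l' hl hl' h => by rw [hmw l hl, hmw l' hl', h])
    (fun l hl => by rw [hmw l hl, hmw _ hl.invPath, map_proj_invPath, markovWeight_invPath])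
  have htend : Tendsto ν atTop (𝓝 ν') := by
    rw [nhds_induced, tendsto_comap_iff, tendsto_pi_nhds]
    exact hlim
  refine ⟨ν', fun I J hI hJ => ?_, hmw⟩
  refine tendsto_nhds_unique ((hI.continuous.tendsto _).comp htend)
    (((hJ.continuous.tendsto _).comp htend).congr fun k => ?_)
  exact (hν k I J hI hJ).symm

end MarkovCurrent

section Existence

open OrGraph

theorem propositionp {N : ℕ} (hN : 2 ≤ N) {V E : Type*} [Finite V] [Finite E] [DecidableEq E]
    (Γ : OrGraph V E) (x₀ : V) (C : SimplicialChart N Γ x₀)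
    (S : Finset E) (X : FSMC S) (hirr : X.IsIrreducible) (hbased : X.IsBased Γ)
    (μ₀ : S → ℝ) (hμ₀ : X.IsStationary μ₀) :
    ∃! ν : GeodesicCurrent C,
      (∀ k : ℕ, 1 ≤ k → ∀ v ∈ Γ.Omega k,
        ν.HasWeight v (ENNReal.ofReal (X.iterProb μ₀ v + X.iterProb μ₀ (Γ.invPath v)))) ∧
      HasIntersectionNumber ν 1 := by
  have := Fintype.ofFinite E
  obtain ⟨ν, hν, hw⟩ := exists_current_markovWeight C hbased hμ₀
  have hpair := isIntersectionPairing_halfTotalWeight C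
  have hone : halfTotalWeight C ν = 1 := by
    have h1 : ∀ e, ν.measure ((Γ.cover x₀).cyl [C.liftEdge e]) =
        ENNReal.ofReal (FSMC.extDist μ₀ e + FSMC.extDist μ₀ (Γ.inv e)) := fun e => by
      have h2 : ∀ e, X.iterProb μ₀ [e] = FSMC.extDist μ₀ e := fun e => mul_one _
      rw [hw _ (isGeodesic_singleton _), List.map_singleton, C.proj_liftEdge, markovWeight,
        ← h2, ← h2]
      rfl
    let σ : E ≃ E := ⟨Γ.inv, Γ.inv, Γ.inv_inv, Γ.inv_inv⟩
    have h3 : ∑ e, FSMC.extDist μ₀ (Γ.inv e) = 1 :=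
      (Equiv.sum_comp σ (FSMC.extDist μ₀)).trans (FSMC.sum_extDist hμ₀)
    rw [← ENNReal.coe_inj, coe_halfTotalWeight]
    simp only [h1]
    rw [← ENNReal.ofReal_sum_of_nonneg fun e _ => add_nonneg (FSMC.extDist_nonneg hμ₀.1 _)
      (FSMC.extDist_nonneg hμ₀.1 _), Finset.sum_add_distrib, FSMC.sum_extDist hμ₀, h3]
    norm_num
    exact ENNReal.div_self two_ne_zero ENNReal.ofNat_ne_top
  refine ⟨ν, ⟨fun k hk v hv => ⟨C.connected.exists_isLift hv, fun l hl => ?_⟩,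
    ⟨_, hpair⟩, fun I hI => (hν I _ hI hpair).trans hone⟩, fun ν' hν' => ?_⟩
  · rw [hw l (hl.isGeodesic hk hv), hl.2]
    rfl
  · refine GeodesicCurrent.ext (measure_ext_of_cyl (fun l hl => ν'.cyl_lt_top hl) fun l hl => ?_)
    rw [hw l hl]
    exact (hν'.1 l.length (List.length_pos_of_ne_nil hl.1) _ hl.map_proj_mem).2 l hl.isLift

end Existence
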